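/- **Conventions.** Manifolds are smooth, finite-dimensional, Hausdorff and without boundary. A map $q\colon M\to S$ from a manifold to a set is a *Q-chart* if (a) whenever $q(x)=q(y)$ there is a local diffeomorphism $h$ of $M$, defined near $x$, with $h(x)=y$ and $q\circ h=q$; (b) if $T$ is a manifold and $f,h\colon T\to M$ are smooth with $q\circ f=q\circ h$, then $\{f=h\}$ is open in $T$. A *Q-manifold* is a set with (an equivalence class of) a surjective Q-chart, its *atlas*. A map $f$ of Q-manifolds with atlases $q_1\colon M_1\to S_1$, $q_2\colon M_2\to S_2$ is *Q-smooth* if for all $x\in M_1$, $y\in M_2$ with $f(q_1(x))=q_2(y)$ there is a smooth map $g$ from a neighbourhood of $x$ to $M_2$ with $g(x)=y$ and $q_2\circ g=f\circ q_1$. The tangent bundle $TS$ is the quotient of $TM$ by the tangent maps of the local smooth maps $g$ of $M$ with $q\circ g=q$, and a Q-smooth map $f$ has a tangent map $Tf$, given by the tangent maps of local lifts. A *Q-group* $G$ is a group and Q-manifold with Q-smooth operations; its Lie algebra $\mathfrak g=T_1G$ has the bracket of right-invariant vector fields. A *Q-principal bundle* is a Q-smooth map $\beta\colon P\to N$ from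 a Q-manifold to a manifold, with a free Q-smooth right action of a Q-group $G$ on $P$ whose orbits are the fibres of $\beta$, such that $N$ is covered by open sets $U$ that admit $G$-equivariant Q-diffeomorphisms $\beta^{-1}(U)\to U\times G$ over $U$. A *morphism* $P_1\to P_2$ is a Q-smooth map $F\colon P_1\to P_2$ over a smooth map $f\colon N_1\to N_2$, together with a Q-smooth homomorphism $\Theta\colon G_1\to G_2$, with $F(pg)=F(p)\Theta(g)$. These form the category $\mathbb{PB}$. An *abstract Atiyah sequence* over $N$ is a short exact sequence of Lie algebroids $L\xrightarrow{\,j\,}A\xrightarrow{\,a\,}TN$, where $A$ is a transitive Lie algebroid with anchor $a$ and $L$ is a (locally trivial) Lie algebra bundle. A *morphism* from $L\to A\to TN$ to $L'\to A'\to TN'$ over a smooth map $f\colon N\to N'$ is a pair of Lie algebroid morphisms $\varphi\colon A\to A'$, $\psi\colon L\to L'$ over $f$ with $\varphi\circ j=j'\circ\psi$. These form the category $\mathbb{AB}$. For a Q-principal bundle $P$ put $\mathfrak A(P)=(TP)/G$, $a_P(vG)=T\beta(v)$, and let $\iota_P\colon P\times_{\mathrm{Ad}}\mathfrak g\to\mathfrak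 A(P)$ send the class of $(p,w)$ to the class of the image of $w$ under the tangent map of $g\mapsto pg$. A morphism $F$ induces the map $\mathfrak A(F)\colon\mathfrak A(P_1)\to\mathfrak A(P_2)$, $vG_1\mapsto (TF(v))G_2$. **Proposition.** 1. For every Q-principal bundle $\beta\colon P\to N$ there is a structure of an abstract Atiyah sequence $$P\times_{\mathrm{Ad}}\mathfrak g\xrightarrow{\ \iota_P\ }\mathfrak A(P)\xrightarrow{\ a_P\ }TN$$ for which the quotient map $TP\to\mathfrak A(P)$ is a fibrewise linear Q-submersion, the quotient map $P\times\mathfrak g\to P\times_{\mathrm{Ad}}\mathfrak g$ is smooth and fibrewise linear, the bracket of sections of $\mathfrak A(P)$ is the bracket of the corresponding $G$-invariant vector fields on $P$, and the bracket of $P\times_{\mathrm{Ad}}\mathfrak g$ is fibrewise that of $\mathfrak g$. 2. With this structure, for every morphism $F\colon P_1\to P_2$ of Q-principal bundles over $f\colon N_1\to N_2$ with respect to $\Theta$, the map $\mathfrak A(F)\colon\mathfrak A(P_1)\to\mathfrak A(P_2)$ is a morphism of Lie algebroids over $f$. 3. There is a functor $\mathbb{PB}\to\mathbb{AB}$ that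 sends $P$ to the sequence in 1, and $F$ to the morphism over $f$ that consists of $\mathfrak A(F)$ and of the map $[(p,w)]\mapsto[(F(p),T_1\Theta(w))]$ from $P_1\times_{\mathrm{Ad}}\mathfrak g_1$ to $P_2\times_{\mathrm{Ad}}\mathfrak g_2$. -/

import Mathlib

open Set Function Topology CategoryTheory
open scoped Manifold ContDiff

universe u

/-- A smooth manifold: finite-dimensional, Hausdorff, without boundary. -/
structure SmoothMfd : Type (u + 1) where
  carrier : Type u
  dim : ℕ
  [top : TopologicalSpace carrier]
  [charted : ChartedSpace (EuclideanSpace ℝ (Fin dim)) carrier]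
  [mfd : IsManifold (𝓡 dim) ∞ carrier]
  [t2 : T2Space carrier]

instance : CoeSort SmoothMfd.{u} (Type u) := ⟨SmoothMfd.carrier⟩

attribute [instance] SmoothMfd.top SmoothMfd.charted SmoothMfd.mfd SmoothMfd.t2

/-- The tangent space `T_x N`. -/
abbrev SmoothMfd.T (N : SmoothMfd.{u}) (x : N) : Type := TangentSpace (𝓡 N.dim) x

/-! ### Q-charts, Q-manifolds, Q-smooth maps -/

/-- A map `q : M → S` from a smooth manifold to a set is a Q-chart if any two points of the same
fibre are related by a local diffeomorphism over `S`, and if two smooth maps into `M` with the same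
composition with `q` agree on an open set. -/
structure IsQChart (M : SmoothMfd.{u}) {S : Type u} (q : M → S) : Prop where
  transversal : ∀ x y : M, q x = q y →
    ∃ h : OpenPartialHomeomorph M M, x ∈ h.source ∧ h x = y ∧
      ContMDiffOn (𝓡 M.dim) (𝓡 M.dim) ∞ h h.source ∧
      ContMDiffOn (𝓡 M.dim) (𝓡 M.dim) ∞ h.symm h.target ∧
      ∀ z ∈ h.source, q (h z) = q z
  isOpen_eq : ∀ (E : Type) [NormedAddCommGroup E] [NormedSpace ℝ E] [FiniteDimensional ℝ E]
    (H : Type) [TopologicalSpace H] (J : ModelWithCorners ℝ E H) [J.Boundaryless]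
    (T : Type u) [TopologicalSpace T] [ChartedSpace H T] [IsManifold J ∞ T] [T2Space T]
    (f h : T → M), ContMDiff J (𝓡 M.dim) ∞ f → ContMDiff J (𝓡 M.dim) ∞ h →
    (∀ t, q (f t) = q (h t)) → IsOpen {t | f t = h t}

/-- A set with a Q-manifold structure, presented by a Q-atlas, i.e. a surjective Q-chart. All notions
below are invariant under replacing the atlas by an equivalent one: two atlases of the same
set are equivalent exactly when the identity map is Q-smooth in both directions. -/
structure QManifold : Type (u + 1) where
  carrier : Type u
  atlas : SmoothMfd.{u}
  chart : atlas → carrier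
  surjective : Surjective chart
  isQChart : IsQChart atlas chart

instance : CoeSort QManifold.{u} (Type u) := ⟨QManifold.carrier⟩

section QSmooth

variable {E₁ H₁ E₂ H₂ E₃ H₃ : Type}
  [NormedAddCommGroup E₁] [NormedSpace ℝ E₁] [TopologicalSpace H₁]
  [NormedAddCommGroup E₂] [NormedSpace ℝ E₂] [TopologicalSpace H₂]
  [NormedAddCommGroup E₃] [NormedSpace ℝ E₃] [TopologicalSpace H₃]
  {M₁ M₂ M₃ S₁ S₂ S₃ : Type u}
  [TopologicalSpace M₁] [ChartedSpace H₁ M₁]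
  [TopologicalSpace M₂] [ChartedSpace H₂ M₂]
  [TopologicalSpace M₃] [ChartedSpace H₃ M₃]
  (I₁ : ModelWithCorners ℝ E₁ H₁) (I₂ : ModelWithCorners ℝ E₂ H₂) (I₃ : ModelWithCorners ℝ E₃ H₃)

/-- Q-smoothness, on an open subset `s` of the source, of a map `f` between sets that carry the
Q-atlases `q₁` and `q₂`: through any two points over `s₁ ∈ s` and `f s₁` there is a local smooth
lift of `f`. A product of Q-manifolds has the product atlas, and a smooth manifold has the
identity map as atlas. -/
def QSmoothOn (q₁ : M₁ → S₁) (q₂ : M₂ → S₂) (f : S₁ → S₂) (s : Set S₁) : Prop :=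
  ∀ x y, q₁ x ∈ s → f (q₁ x) = q₂ y →
    ∃ (U : Set M₁) (g : M₁ → M₂), IsOpen U ∧ x ∈ U ∧ U ⊆ q₁ ⁻¹' s ∧
      ContMDiffOn I₁ I₂ ∞ g U ∧ g x = y ∧ ∀ z ∈ U, q₂ (g z) = f (q₁ z)

/-- Q-smoothness of a map between sets that carry the Q-atlases `q₁` and `q₂`. -/
def QSmooth (q₁ : M₁ → S₁) (q₂ : M₂ → S₂) (f : S₁ → S₂) : Prop :=
  QSmoothOn I₁ I₂ q₁ q₂ f univ

variable {I₁ I₂ I₃}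

theorem QSmooth.lift {q₁ : M₁ → S₁} {q₂ : M₂ → S₂} {f : S₁ → S₂}
    (hf : QSmooth I₁ I₂ q₁ q₂ f) (x : M₁) (y : M₂) (h : f (q₁ x) = q₂ y) :
    ∃ (U : Set M₁) (g : M₁ → M₂), IsOpen U ∧ x ∈ U ∧
      ContMDiffOn I₁ I₂ ∞ g U ∧ g x = y ∧ ∀ z ∈ U, q₂ (g z) = f (q₁ z) := by
  obtain ⟨U, g, h1, h2, -, h3⟩ := hf x y (mem_univ _) h
  exact ⟨U, g, h1, h2, h3⟩

theorem QSmooth.of_lift {q₁ : M₁ → S₁} {q₂ : M₂ → S₂} {f : S₁ → S₂}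
    (h : ∀ x y, f (q₁ x) = q₂ y → ∃ (U : Set M₁) (g : M₁ → M₂), IsOpen U ∧ x ∈ U ∧
      ContMDiffOn I₁ I₂ ∞ g U ∧ g x = y ∧ ∀ z ∈ U, q₂ (g z) = f (q₁ z)) :
    QSmooth I₁ I₂ q₁ q₂ f := by
  intro x y _ hxy
  obtain ⟨U, g, h1, h2, h3⟩ := h x y hxy
  exact ⟨U, g, h1, h2, fun _ _ => mem_univ _, h3⟩

theorem QSmooth.id (q : M₁ → S₁) (hq : ∀ x y, q x = q y → ∃ (U : Set M₁) (g : M₁ → M₁),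
    IsOpen U ∧ x ∈ U ∧ ContMDiffOn I₁ I₁ ∞ g U ∧ g x = y ∧ ∀ z ∈ U, q (g z) = q z) :
    QSmooth I₁ I₁ q q (fun s => s) :=
  QSmooth.of_lift hq

theorem QSmooth.comp {q₁ : M₁ → S₁} {q₂ : M₂ → S₂} {q₃ : M₃ → S₃} {f : S₁ → S₂} {f' : S₂ → S₃}
    (hf' : QSmooth I₂ I₃ q₂ q₃ f') (hf : QSmooth I₁ I₂ q₁ q₂ f) (hs : Surjective q₂) :
    QSmooth I₁ I₃ q₁ q₃ (fun s => f' (f s)) := by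
  refine QSmooth.of_lift fun x z hxz => ?_
  obtain ⟨y, hy⟩ := hs (f (q₁ x))
  obtain ⟨U, g, hU, hxU, hg, hgx, hgl⟩ := hf.lift x y hy.symm
  obtain ⟨V, g', hV, hyV, hg', hgy, hgl'⟩ := hf'.lift y z (by rw [hy, hxz])
  refine ⟨U ∩ g ⁻¹' V, g' ∘ g, hg.continuousOn.isOpen_inter_preimage hU hV,
    ⟨hxU, by simpa [hgx] using hyV⟩, ?_, by simp [hgx, hgy], ?_⟩
  · exact hg'.comp (hg.mono inter_subset_left) (fun z hz => hz.2)
  · intro w hw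
    simp only [comp_apply]
    rw [hgl' _ hw.2, hgl _ hw.1]

end QSmooth

namespace QManifold

/-- Q-smoothness of a map between Q-manifolds. -/
abbrev Smooth (S S' : QManifold.{u}) (f : S → S') : Prop :=
  QSmooth (𝓡 S.atlas.dim) (𝓡 S'.atlas.dim) S.chart S'.chart f

theorem exists_transversal (S : QManifold.{u}) (x y : S.atlas) (h : S.chart x = S.chart y) :
    ∃ (U : Set S.atlas) (g : S.atlas → S.atlas), IsOpen U ∧ x ∈ U ∧
      ContMDiffOn (𝓡 S.atlas.dim) (𝓡 S.atlas.dim) ∞ g U ∧ g x = y ∧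
      ∀ z ∈ U, S.chart (g z) = S.chart z := by
  obtain ⟨k, h1, h2, h3, -, h4⟩ := S.isQChart.transversal x y h
  exact ⟨k.source, k, k.open_source, h1, h3, h2, h4⟩

theorem smooth_id (S : QManifold.{u}) : S.Smooth S (fun s => s) :=
  QSmooth.id _ S.exists_transversal

variable {E H : Type} [NormedAddCommGroup E] [NormedSpace ℝ E] [FiniteDimensional ℝ E]
  [TopologicalSpace H] {J : ModelWithCorners ℝ E H} [J.Boundaryless]
  {T : Type u} [TopologicalSpace T] [ChartedSpace H T] [IsManifold J ∞ T] [T2Space T]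

/-- Two local lifts of the same map that agree at a point agree near that point. -/
theorem eventuallyEq_of_lift (S : QManifold.{u}) {f g : T → S.atlas} {U : Set T} (hU : IsOpen U)
    {t : T} (ht : t ∈ U) (hf : ContMDiffOn J (𝓡 S.atlas.dim) ∞ f U)
    (hg : ContMDiffOn J (𝓡 S.atlas.dim) ∞ g U)
    (hfg : ∀ z ∈ U, S.chart (f z) = S.chart (g z)) (h : f t = g t) : f =ᶠ[𝓝 t] g := by
  let V : TopologicalSpace.Opens T := ⟨U, hU⟩
  have hsub : ContMDiff J J ∞ (Subtype.val : V → T) := contMDiff_subtype_val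
  have key := S.isQChart.isOpen_eq E H J V (fun z => f z.1) (fun z => g z.1)
    (hf.comp_contMDiff hsub (fun z => z.2)) (hg.comp_contMDiff hsub (fun z => z.2))
    (fun z => hfg _ z.2)
  have h2 : IsOpen (Subtype.val '' {z : V | f z.1 = g z.1}) :=
    hU.isOpenMap_subtype_val _ key
  refine Filter.mem_of_superset (h2.mem_nhds ⟨⟨t, ht⟩, h, rfl⟩) ?_
  rintro _ ⟨z, hz, rfl⟩
  exact hz

end QManifold

/-! ### The tangent bundle of a Q-manifold -/

namespace QManifold

/-- Two tangent vectors of the atlas represent the same tangent vector of the Q-manifold if a local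
transformation over `S` carries one to the other. -/
def TangentRel (S : QManifold.{u}) (a b : TangentBundle (𝓡 S.atlas.dim) S.atlas) : Prop :=
  ∃ (U : Set S.atlas) (g : S.atlas → S.atlas), IsOpen U ∧ a.proj ∈ U ∧
    ContMDiffOn (𝓡 S.atlas.dim) (𝓡 S.atlas.dim) ∞ g U ∧ (∀ z ∈ U, S.chart (g z) = S.chart z) ∧
    tangentMap (𝓡 S.atlas.dim) (𝓡 S.atlas.dim) g a = b

section

variable {E H : Type} [NormedAddCommGroup E] [NormedSpace ℝ E] [FiniteDimensional ℝ E]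
  [TopologicalSpace H] {J : ModelWithCorners ℝ E H} [J.Boundaryless]
  {T : Type u} [TopologicalSpace T] [ChartedSpace H T] [IsManifold J ∞ T] [T2Space T]

set_option linter.unusedSectionVars false in
theorem tangentMap_comp_of_lift (S : QManifold.{u}) {f : T → S.atlas}
    {g : S.atlas → S.atlas} {U : Set T} {V : Set S.atlas} (hU : IsOpen U) (hV : IsOpen V)
    (a : TangentBundle J T) (ha : a.proj ∈ U) (hb : f a.proj ∈ V)
    (hf : ContMDiffOn J (𝓡 S.atlas.dim) ∞ f U)
    (hg : ContMDiffOn (𝓡 S.atlas.dim) (𝓡 S.atlas.dim) ∞ g V) :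
    tangentMap J (𝓡 S.atlas.dim) (g ∘ f) a =
      tangentMap (𝓡 S.atlas.dim) (𝓡 S.atlas.dim) g (tangentMap J (𝓡 S.atlas.dim) f a) := by
  have h1 : MDifferentiableAt J (𝓡 S.atlas.dim) f a.proj :=
    (hf.contMDiffAt (hU.mem_nhds ha)).mdifferentiableAt (by simp)
  have h2 : MDifferentiableAt (𝓡 S.atlas.dim) (𝓡 S.atlas.dim) g (f a.proj) :=
    (hg.contMDiffAt (hV.mem_nhds hb)).mdifferentiableAt (by simp)
  exact tangentMap_comp_at a h2 h1

/-- The derivatives of two local lifts of the same map represent the same tangent vector. -/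
theorem tangentRel_of_lift (S : QManifold.{u}) {f g : T → S.atlas} {U : Set T} (hU : IsOpen U)
    (a : TangentBundle J T) (ha : a.proj ∈ U) (hf : ContMDiffOn J (𝓡 S.atlas.dim) ∞ f U)
    (hg : ContMDiffOn J (𝓡 S.atlas.dim) ∞ g U)
    (hfg : ∀ z ∈ U, S.chart (f z) = S.chart (g z)) :
    S.TangentRel (tangentMap J (𝓡 S.atlas.dim) f a) (tangentMap J (𝓡 S.atlas.dim) g a) := by
  obtain ⟨V, h, hV, hfV, hh, hfg', hl⟩ := S.exists_transversal _ _ (hfg _ ha)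
  refine ⟨V, h, hV, hfV, hh, hl, ?_⟩
  rw [← S.tangentMap_comp_of_lift hU hV a ha hfV hf hh]
  have hW : IsOpen (U ∩ f ⁻¹' V) := hf.continuousOn.isOpen_inter_preimage hU hV
  have heq : (h ∘ f) =ᶠ[𝓝 a.proj] g := by
    refine S.eventuallyEq_of_lift hW ⟨ha, hfV⟩
      (hh.comp (hf.mono inter_subset_left) (fun z hz => hz.2)) (hg.mono inter_subset_left) ?_ ?_
    · intro z hz
      simp only [comp_apply]
      rw [hl _ hz.2, hfg _ hz.1]
    · simpa using hfg'
  obtain ⟨x, v⟩ := a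
  have h1 : (h ∘ f) x = g x := heq.self_of_nhds
  have h2 : mfderiv J (𝓡 S.atlas.dim) (h ∘ f) x = mfderiv J (𝓡 S.atlas.dim) g x := heq.mfderiv_eq
  simp only [tangentMap]
  exact Bundle.TotalSpace.ext h1 (heq_of_eq (congrArg (fun L => L v) h2))

end

theorem tangentRel_equivalence (S : QManifold.{u}) : Equivalence S.TangentRel where
  refl a := ⟨univ, id, isOpen_univ, mem_univ _, contMDiffOn_id, fun _ _ => rfl, by
    rw [tangentMap_id]; rfl⟩
  symm := by
    rintro a b ⟨U, g, hU, haU, hg, hl, rfl⟩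
    have := S.tangentRel_of_lift hU a haU hg contMDiffOn_id hl
    rwa [tangentMap_id] at this
  trans := by
    rintro a b c ⟨U, g, hU, haU, hg, hl, rfl⟩ ⟨V, h, hV, hbV, hh, hl', rfl⟩
    refine ⟨U ∩ g ⁻¹' V, h ∘ g, hg.continuousOn.isOpen_inter_preimage hU hV, ⟨haU, hbV⟩,
      hh.comp (hg.mono inter_subset_left) (fun z hz => hz.2), ?_, ?_⟩
    · intro z hz
      simp only [comp_apply]
      rw [hl' _ hz.2, hl _ hz.1]
    · exact S.tangentMap_comp_of_lift hU hV a haU hbV hg hh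

def tangentSetoid (S : QManifold.{u}) : Setoid (TangentBundle (𝓡 S.atlas.dim) S.atlas) :=
  ⟨S.TangentRel, S.tangentRel_equivalence⟩

/-- The total space `TS` of the tangent bundle of a Q-manifold `S`. -/
def TS (S : QManifold.{u}) : Type u := Quotient S.tangentSetoid

/-- The tangent map `TM → TS` of the atlas `M → S`. -/
def tmk (S : QManifold.{u}) (x : S.atlas) (v : S.atlas.T x) : S.TS :=
  Quotient.mk S.tangentSetoid ⟨x, v⟩

theorem tmk_eq (S : QManifold.{u}) {a b : TangentBundle (𝓡 S.atlas.dim) S.atlas}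
    (h : S.TangentRel a b) : S.tmk a.proj a.2 = S.tmk b.proj b.2 :=
  Quotient.sound h

/-- The bundle projection `TS → S`. -/
def tproj (S : QManifold.{u}) : S.TS → S :=
  Quotient.lift (fun a => S.chart a.proj) (by
    rintro a b ⟨U, g, hU, haU, hg, hl, rfl⟩
    exact (hl _ haU).symm)

@[simp] theorem tproj_tmk (S : QManifold.{u}) (x : S.atlas) (v : S.atlas.T x) :
    S.tproj (S.tmk x v) = S.chart x := rfl

theorem tind (S : QManifold.{u}) {p : S.TS → Prop} (h : ∀ x v, p (S.tmk x v)) (w : S.TS) : p w := by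
  induction w using Quotient.inductionOn with
  | h a => exact h a.proj a.2

/-- Every tangent vector at `s` is represented at every point of the atlas over `s`. -/
theorem exists_tmk_eq (S : QManifold.{u}) (w : S.TS) (y : S.atlas) (h : S.tproj w = S.chart y) :
    ∃ v : S.atlas.T y, S.tmk y v = w := by
  induction w using S.tind with
  | h x v =>
    obtain ⟨U, g, hU, hxU, hg, rfl, hl⟩ := S.exists_transversal x y h
    exact ⟨_, (S.tmk_eq (a := ⟨x, v⟩) ⟨U, g, hU, hxU, hg, hl, rfl⟩ :
      S.tmk x v = S.tmk (g x) (mfderiv (𝓡 S.atlas.dim) (𝓡 S.atlas.dim) g x v)).symm⟩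

variable {S S' S'' : QManifold.{u}}

/-- The tangent map of a Q-smooth map on representatives, through a local lift. -/
noncomputable def Smooth.tmapAux {f : S → S'} (hf : S.Smooth S' f)
    (a : TangentBundle (𝓡 S.atlas.dim) S.atlas) : S'.TS :=
  let y := (S'.surjective (f (S.chart a.proj))).choose
  let g := (hf.lift a.proj y (S'.surjective (f (S.chart a.proj))).choose_spec.symm).choose_spec.choose
  S'.tmk (g a.proj) (mfderiv (𝓡 S.atlas.dim) (𝓡 S'.atlas.dim) g a.proj a.2)

theorem Smooth.tmapAux_eq {f : S → S'} (hf : S.Smooth S' f)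
    (a : TangentBundle (𝓡 S.atlas.dim) S.atlas) {U : Set S.atlas} {g : S.atlas → S'.atlas}
    (hU : IsOpen U) (ha : a.proj ∈ U) (hg : ContMDiffOn (𝓡 S.atlas.dim) (𝓡 S'.atlas.dim) ∞ g U)
    (hl : ∀ z ∈ U, S'.chart (g z) = f (S.chart z)) :
    hf.tmapAux a = S'.tmk (g a.proj) (mfderiv (𝓡 S.atlas.dim) (𝓡 S'.atlas.dim) g a.proj a.2) := by
  have hy := (S'.surjective (f (S.chart a.proj))).choose_spec
  obtain ⟨hV, haV, hk, -, hl'⟩ := (hf.lift a.proj _ hy.symm).choose_spec.choose_spec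
  exact S'.tmk_eq (S'.tangentRel_of_lift (hV.inter hU) a ⟨haV, ha⟩ (hk.mono inter_subset_left)
    (hg.mono inter_subset_right) (fun z hz => by rw [hl' z hz.1, hl z hz.2]))

/-- The tangent map `Tf : TS → TS'` of a Q-smooth map `f : S → S'`. -/
noncomputable def Smooth.tmap {f : S → S'} (hf : S.Smooth S' f) : S.TS → S'.TS :=
  Quotient.lift hf.tmapAux (by
    rintro a b ⟨U, g, hU, haU, hg, hl, rfl⟩
    obtain ⟨y, hy⟩ := S'.surjective (f (S.chart (g a.proj)))
    obtain ⟨V, k, hV, hbV, hk, hky, hl'⟩ := hf.lift (g a.proj) y hy.symm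
    have h1 := hf.tmapAux_eq (tangentMap (𝓡 S.atlas.dim) (𝓡 S.atlas.dim) g a) hV hbV hk hl'
    rw [h1, hf.tmapAux_eq a (g := k ∘ g) (hg.continuousOn.isOpen_inter_preimage hU hV) ⟨haU, hbV⟩
      (hk.comp (hg.mono inter_subset_left) (fun z hz => hz.2))
      (fun z hz => by simp only [comp_apply]; rw [hl' _ hz.2, hl _ hz.1])]
    have e : mfderiv (𝓡 S.atlas.dim) (𝓡 S'.atlas.dim) (k ∘ g) a.proj = _ :=
      mfderiv_comp a.proj ((hk.contMDiffAt (hV.mem_nhds hbV)).mdifferentiableAt (by simp))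
        ((hg.contMDiffAt (hU.mem_nhds haU)).mdifferentiableAt (by simp))
    rw [e]
    rfl)

/-- The tangent map is computed by the derivative of any local lift. -/
theorem Smooth.tmap_tmk {f : S → S'} (hf : S.Smooth S' f) {x : S.atlas} (v : S.atlas.T x)
    {U : Set S.atlas} {g : S.atlas → S'.atlas} (hU : IsOpen U) (hx : x ∈ U)
    (hg : ContMDiffOn (𝓡 S.atlas.dim) (𝓡 S'.atlas.dim) ∞ g U)
    (hl : ∀ z ∈ U, S'.chart (g z) = f (S.chart z)) :
    hf.tmap (S.tmk x v) = S'.tmk (g x) (mfderiv (𝓡 S.atlas.dim) (𝓡 S'.atlas.dim) g x v) :=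
  hf.tmapAux_eq ⟨x, v⟩ hU hx hg hl

theorem Smooth.exists_tmap {f : S → S'} (hf : S.Smooth S' f) (x : S.atlas) :
    ∃ (U : Set S.atlas) (g : S.atlas → S'.atlas), IsOpen U ∧ x ∈ U ∧
      ContMDiffOn (𝓡 S.atlas.dim) (𝓡 S'.atlas.dim) ∞ g U ∧ (∀ z ∈ U, S'.chart (g z) = f (S.chart z)) ∧
      ∀ v : S.atlas.T x, hf.tmap (S.tmk x v) =
        S'.tmk (g x) (mfderiv (𝓡 S.atlas.dim) (𝓡 S'.atlas.dim) g x v) := by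
  obtain ⟨y, hy⟩ := S'.surjective (f (S.chart x))
  obtain ⟨U, g, hU, hxU, hg, -, hl⟩ := hf.lift x y hy.symm
  exact ⟨U, g, hU, hxU, hg, hl, fun v => hf.tmap_tmk v hU hxU hg hl⟩

@[simp] theorem Smooth.tproj_tmap {f : S → S'} (hf : S.Smooth S' f) (w : S.TS) :
    S'.tproj (hf.tmap w) = f (S.tproj w) := by
  induction w using S.tind with
  | h x v =>
    obtain ⟨U, g, hU, hxU, hg, hl, h⟩ := hf.exists_tmap x
    rw [h, tproj_tmk, tproj_tmk, hl x hxU]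

theorem Smooth.tmap_comp {f : S → S'} {f' : S' → S''} (hf' : S'.Smooth S'' f')
    (hf : S.Smooth S' f) (hc : S.Smooth S'' (fun s => f' (f s))) (w : S.TS) :
    hc.tmap w = hf'.tmap (hf.tmap w) := by
  induction w using S.tind with
  | h x v =>
    obtain ⟨U, g, hU, hxU, hg, hl, h⟩ := hf.exists_tmap x
    obtain ⟨V, k, hV, hyV, hk, hl', h'⟩ := hf'.exists_tmap (g x)
    rw [h, h', hc.tmap_tmk v (g := k ∘ g) (hg.continuousOn.isOpen_inter_preimage hU hV) ⟨hxU, hyV⟩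
      (hk.comp (hg.mono inter_subset_left) (fun z hz => hz.2))
      (fun z hz => by simp only [comp_apply]; rw [hl' _ hz.2, hl _ hz.1])]
    have e : mfderiv (𝓡 S.atlas.dim) (𝓡 S''.atlas.dim) (k ∘ g) x = _ :=
      mfderiv_comp x ((hk.contMDiffAt (hV.mem_nhds hyV)).mdifferentiableAt (by simp))
        ((hg.contMDiffAt (hU.mem_nhds hxU)).mdifferentiableAt (by simp))
    rw [e]
    rfl

theorem Smooth.tmap_congr {f f' : S → S'} (hf : S.Smooth S' f) (hf' : S.Smooth S' f')
    (h : f = f') (w : S.TS) : hf.tmap w = hf'.tmap w := by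
  subst h; rfl

theorem Smooth.tmap_id (hf : S.Smooth S (fun s => s)) (w : S.TS) : hf.tmap w = w := by
  induction w using S.tind with
  | h x v =>
    rw [hf.tmap_tmk v (g := id) isOpen_univ (mem_univ _) contMDiffOn_id (fun _ _ => rfl), mfderiv_id]
    rfl

end QManifold

section

variable {E₁ H₁ E₂ H₂ E₃ H₃ : Type}
  [NormedAddCommGroup E₁] [NormedSpace ℝ E₁] [TopologicalSpace H₁]
  [NormedAddCommGroup E₂] [NormedSpace ℝ E₂] [TopologicalSpace H₂]
  [NormedAddCommGroup E₃] [NormedSpace ℝ E₃] [TopologicalSpace H₃]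
  {M₁ M₂ M₃ S₁ S₂ S₃ : Type u}
  [TopologicalSpace M₁] [ChartedSpace H₁ M₁]
  [TopologicalSpace M₂] [ChartedSpace H₂ M₂]
  [TopologicalSpace M₃] [ChartedSpace H₃ M₃]
  {I₁ : ModelWithCorners ℝ E₁ H₁} {I₂ : ModelWithCorners ℝ E₂ H₂} {I₃ : ModelWithCorners ℝ E₃ H₃}
  {q₁ : M₁ → S₁} {q₂ : M₂ → S₂} {q₃ : M₃ → S₃} {f : S₁ × S₂ → S₃}

theorem QSmooth.partial_left (hf : QSmooth (I₁.prod I₂) I₃ (Prod.map q₁ q₂) q₃ f)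
    (h₂ : Surjective q₂) (s₂ : S₂) : QSmooth I₁ I₃ q₁ q₃ (fun s => f (s, s₂)) := by
  refine QSmooth.of_lift fun x z hxz => ?_
  obtain ⟨y, rfl⟩ := h₂ s₂
  obtain ⟨U, g, hU, hxU, hg, hgx, hl⟩ := hf.lift (x, y) z hxz
  have hi : ContMDiff I₁ (I₁.prod I₂) ∞ (fun w : M₁ => (w, y)) := contMDiff_id.prodMk contMDiff_const
  exact ⟨(fun w => (w, y)) ⁻¹' U, fun w => g (w, y), hU.preimage hi.continuous, hxU,
    hg.comp hi.contMDiffOn (fun w hw => hw), hgx, fun w hw => hl _ hw⟩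

theorem QSmooth.partial_right (hf : QSmooth (I₁.prod I₂) I₃ (Prod.map q₁ q₂) q₃ f)
    (h₁ : Surjective q₁) (s₁ : S₁) : QSmooth I₂ I₃ q₂ q₃ (fun s => f (s₁, s)) := by
  refine QSmooth.of_lift fun x z hxz => ?_
  obtain ⟨y, rfl⟩ := h₁ s₁
  obtain ⟨U, g, hU, hxU, hg, hgx, hl⟩ := hf.lift (y, x) z hxz
  have hi : ContMDiff I₂ (I₁.prod I₂) ∞ (fun w : M₂ => (y, w)) := contMDiff_const.prodMk contMDiff_id
  exact ⟨(fun w => (y, w)) ⁻¹' U, fun w => g (y, w), hU.preimage hi.continuous, hxU,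
    hg.comp hi.contMDiffOn (fun w hw => hw), hgx, fun w hw => hl _ hw⟩

end

/-! ### Q-groups -/

/-- A Q-group: a Q-manifold with a group structure whose operations are Q-smooth. -/
structure QGroup : Type (u + 1) extends QManifold.{u} where
  [group : Group carrier]
  smooth_mul : QSmooth ((𝓡 atlas.dim).prod (𝓡 atlas.dim)) (𝓡 atlas.dim) (Prod.map chart chart) chart
    (fun x : carrier × carrier => x.1 * x.2)
  smooth_inv : QSmooth (𝓡 atlas.dim) (𝓡 atlas.dim) chart chart (fun x : carrier => x⁻¹)

instance : CoeSort QGroup.{u} (Type u) := ⟨fun G => G.carrier⟩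

attribute [instance] QGroup.group

namespace QGroup

variable (G : QGroup.{u})

theorem smooth_mul_right (g : G) : G.Smooth G.toQManifold (fun x => x * g) :=
  G.smooth_mul.partial_left G.surjective g

theorem smooth_mul_left (g : G) : G.Smooth G.toQManifold (fun x => g * x) :=
  G.smooth_mul.partial_right G.surjective g

theorem smooth_conj (g : G) : G.Smooth G.toQManifold (fun x => g * x * g⁻¹) :=
  (G.smooth_mul_right g⁻¹).comp (G.smooth_mul_left g) G.surjective

/-- The Lie algebra `𝔤 = T₁G`. -/
def LieAlg : Type u := {w : G.TS // G.tproj w = 1}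

variable {G}

/-- The adjoint action: `Ad g` is the tangent map at `1` of conjugation by `g`. -/
noncomputable def Ad (g : G) (w : G.LieAlg) : G.LieAlg :=
  ⟨(G.smooth_conj g).tmap w.1, by rw [QManifold.Smooth.tproj_tmap, w.2]; simp⟩

/-- The element of `T₁G` represented by a tangent vector of the atlas at a point over `1`. -/
def lieMk {e : G.atlas} (he : G.chart e = 1) (v : G.atlas.T e) : G.LieAlg := ⟨G.tmk e v, he⟩

/-- The right-invariant vector field `g ↦ w g` of `w ∈ T₁G`, lifted to the atlas of `G`. -/
noncomputable def rightField (w : G.LieAlg) (m : G.atlas) : G.atlas.T m :=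
  (G.exists_tmk_eq ((G.smooth_mul_right (G.chart m)).tmap w.1) m
    (by rw [QManifold.Smooth.tproj_tmap, w.2, one_mul])).choose

theorem tmk_rightField (w : G.LieAlg) (m : G.atlas) :
    G.tmk m (rightField w m) = (G.smooth_mul_right (G.chart m)).tmap w.1 :=
  (G.exists_tmk_eq ((G.smooth_mul_right (G.chart m)).tmap w.1) m
    (by rw [QManifold.Smooth.tproj_tmap, w.2, one_mul])).choose_spec

/-- The Lie bracket of `𝔤 = T₁G`, given by the bracket of right-invariant vector fields. -/
noncomputable def lieBracket (w v : G.LieAlg) : G.LieAlg :=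
  lieMk (G.surjective 1).choose_spec
    (VectorField.mlieBracket (𝓡 G.atlas.dim) (rightField w) (rightField v) (G.surjective 1).choose)

end QGroup

/-! ### Q-principal bundles -/

/-- A Q-principal bundle over a smooth manifold, whose structure group is a Q-group. -/
structure QPrincipalBundle : Type (u + 1) where
  base : SmoothMfd.{u}
  group : QGroup.{u}
  total : QManifold.{u}
  /-- The right action `(p, g) ↦ pg`. -/
  act : total → group → total
  act_one : ∀ p, act p 1 = p
  act_mul : ∀ p g h, act p (g * h) = act (act p g) h
  act_free : ∀ p g, act p g = p → g = 1
  act_smooth : QSmooth ((𝓡 total.atlas.dim).prod (𝓡 group.atlas.dim)) (𝓡 total.atlas.dim)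
    (Prod.map total.chart group.chart) total.chart (fun x : total × group => act x.1 x.2)
  /-- The bundle projection `β`. -/
  proj : total → base
  proj_smooth : QSmooth (𝓡 total.atlas.dim) (𝓡 base.dim) total.chart (fun n : base => n) proj
  fiber_eq_orbit : ∀ p q, proj q = proj p ↔ ∃ g, q = act p g
  locally_trivial : ∀ n : base, ∃ U : Set base, IsOpen U ∧ n ∈ U ∧
    ∃ (ψ : total → base × group) (ψ' : base × group → total),
      MapsTo ψ (proj ⁻¹' U) (U ×ˢ univ) ∧ MapsTo ψ' (U ×ˢ univ) (proj ⁻¹' U) ∧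
      InvOn ψ' ψ (proj ⁻¹' U) (U ×ˢ univ) ∧
      QSmoothOn (𝓡 total.atlas.dim) ((𝓡 base.dim).prod (𝓡 group.atlas.dim))
        total.chart (Prod.map (fun n : base => n) group.chart) ψ (proj ⁻¹' U) ∧
      QSmoothOn ((𝓡 base.dim).prod (𝓡 group.atlas.dim)) (𝓡 total.atlas.dim)
        (Prod.map (fun n : base => n) group.chart) total.chart ψ' (U ×ˢ univ) ∧
      (∀ p ∈ proj ⁻¹' U, (ψ p).1 = proj p) ∧
      (∀ p ∈ proj ⁻¹' U, ∀ g, ψ (act p g) = ((ψ p).1, (ψ p).2 * g))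

namespace QPrincipalBundle

/-- A morphism of Q-principal bundles: a Q-smooth map `F`, over a smooth map `f` of the bases,
equivariant with respect to a morphism `Θ` of Q-groups. -/
structure Hom (P Q : QPrincipalBundle.{u}) : Type u where
  base : P.base → Q.base
  base_smooth : ContMDiff (𝓡 P.base.dim) (𝓡 Q.base.dim) ∞ base
  group : P.group →* Q.group
  group_smooth : P.group.Smooth Q.group.toQManifold group
  map : P.total → Q.total
  map_smooth : P.total.Smooth Q.total map
  proj_map : ∀ p, Q.proj (map p) = base (P.proj p)
  map_act : ∀ p g, map (P.act p g) = Q.act (map p) (group g)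

@[ext] theorem Hom.ext' {P Q : QPrincipalBundle.{u}} {F F' : Hom P Q} (h₁ : F.base = F'.base)
    (h₂ : F.group = F'.group) (h₃ : F.map = F'.map) : F = F' := by
  cases F; cases F'; cases h₁; cases h₂; cases h₃; rfl

/-- The category of Q-principal bundles. -/
instance : Category QPrincipalBundle.{u} where
  Hom := Hom
  id P :=
    { base := fun n => n
      base_smooth := contMDiff_id
      group := MonoidHom.id _
      group_smooth := P.group.smooth_id
      map := fun p => p
      map_smooth := P.total.smooth_id
      proj_map := fun _ => rfl
      map_act := fun _ _ => rfl }
  comp {P Q R} F F' :=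
    { base := fun n => F'.base (F.base n)
      base_smooth := F'.base_smooth.comp F.base_smooth
      group := F'.group.comp F.group
      group_smooth := F'.group_smooth.comp F.group_smooth Q.group.surjective
      map := fun p => F'.map (F.map p)
      map_smooth := F'.map_smooth.comp F.map_smooth Q.total.surjective
      proj_map := fun p => by rw [F'.proj_map, F.proj_map]
      map_act := fun p g => by rw [F.map_act, F'.map_act]; rfl }
  id_comp _ := rfl
  comp_id _ := rfl
  assoc _ _ _ := rfl

/-! ### The Atiyah construction -/

variable (P Q : QPrincipalBundle.{u})

theorem act_smooth_left (g : P.group) : P.total.Smooth P.total (fun p => P.act p g) :=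
  P.act_smooth.partial_left P.group.surjective g

theorem act_smooth_right (p : P.total) : P.group.Smooth P.total (fun g => P.act p g) :=
  P.act_smooth.partial_right P.total.surjective p

/-- The right action of `G` on `TP`, by the tangent maps of the right translations. -/
noncomputable def tact (v : P.total.TS) (g : P.group) : P.total.TS := (P.act_smooth_left g).tmap v

theorem proj_act (p : P.total) (g : P.group) : P.proj (P.act p g) = P.proj p :=
  (P.fiber_eq_orbit p _).2 ⟨g, rfl⟩

/-- The quotient `(TP)/G`. -/
def Atiyah : Type u := Quot fun v w : P.total.TS => ∃ g : P.group, w = P.tact v g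

/-- The quotient map `TP → (TP)/G`. -/
def quotTP (v : P.total.TS) : P.Atiyah := Quot.mk _ v

/-- The projection `(TP)/G → N`. -/
def atiyahProj : P.Atiyah → P.base :=
  Quot.lift (fun v => P.proj (P.total.tproj v)) (by
    rintro v _ ⟨g, rfl⟩
    simp only [tact, QManifold.Smooth.tproj_tmap, proj_act])

/-- `P ×_Ad 𝔤`, the quotient of `P × 𝔤` by the action `(p, w)g = (pg, Ad(g⁻¹)w)`. -/
def AdBundle : Type u := Quot fun x y : P.total × P.group.LieAlg =>
  ∃ g : P.group, y = (P.act x.1 g, QGroup.Ad g⁻¹ x.2)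

def adMk (p : P.total) (w : P.group.LieAlg) : P.AdBundle := Quot.mk _ (p, w)

/-- The projection `P ×_Ad 𝔤 → N`. -/
def adProj : P.AdBundle → P.base :=
  Quot.lift (fun x => P.proj x.1) (by
    rintro x _ ⟨g, rfl⟩
    exact (P.proj_act x.1 g).symm)

/-- The map `ι_P : P ×_Ad 𝔤 → (TP)/G`, which sends the class of `(p, w)` to the class of the image of
`w ∈ T₁G` under the tangent map of `g ↦ pg`. -/
noncomputable def iota : P.AdBundle → P.Atiyah :=
  Quot.lift (fun x => P.quotTP ((P.act_smooth_right x.1).tmap x.2.1)) (by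
    rintro ⟨p, w⟩ _ ⟨g, rfl⟩
    refine Quot.sound ⟨g, ?_⟩
    have h1 : P.group.Smooth P.total (fun x => P.act (P.act p x) g) :=
      (P.act_smooth_left g).comp (P.act_smooth_right p) P.total.surjective
    have h2 : P.group.Smooth P.total (fun x => P.act (P.act p g) (g⁻¹ * x * g⁻¹⁻¹)) :=
      (P.act_smooth_right (P.act p g)).comp (P.group.smooth_conj g⁻¹) P.group.surjective
    simp only [tact, QGroup.Ad]
    rw [← (P.act_smooth_left g).tmap_comp (P.act_smooth_right p) h1,
      ← (P.act_smooth_right (P.act p g)).tmap_comp (P.group.smooth_conj g⁻¹) h2]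
    refine QManifold.Smooth.tmap_congr _ _ (funext fun x => ?_) _
    rw [← P.act_mul, ← P.act_mul]
    congr 1
    group)

theorem atiyahProj_iota (l : P.AdBundle) : P.atiyahProj (P.iota l) = P.adProj l := by
  induction l using Quot.inductionOn with
  | h x =>
    change P.proj (P.total.tproj ((P.act_smooth_right x.1).tmap x.2.1)) = P.proj x.1
    rw [QManifold.Smooth.tproj_tmap, proj_act]

variable {P Q}

/-- The map `(TP₁)/G₁ → (TP₂)/G₂` induced by the tangent map of a morphism `F : P₁ → P₂`. -/
noncomputable def Hom.atiyah (F : Hom P Q) : P.Atiyah → Q.Atiyah :=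
  Quot.lift (fun v => Q.quotTP (F.map_smooth.tmap v)) (by
    rintro v _ ⟨g, rfl⟩
    refine Quot.sound ⟨F.group g, ?_⟩
    have h1 : P.total.Smooth Q.total (fun p => F.map (P.act p g)) :=
      F.map_smooth.comp (P.act_smooth_left g) P.total.surjective
    have h2 : P.total.Smooth Q.total (fun p => Q.act (F.map p) (F.group g)) :=
      (Q.act_smooth_left (F.group g)).comp F.map_smooth Q.total.surjective
    simp only [tact]
    rw [← F.map_smooth.tmap_comp (P.act_smooth_left g) h1,
      ← (Q.act_smooth_left (F.group g)).tmap_comp F.map_smooth h2]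
    exact QManifold.Smooth.tmap_congr _ _ (funext fun p => F.map_act p g) _)

/-- The map of Lie algebras `T₁Θ : 𝔤₁ → 𝔤₂`. -/
noncomputable def Hom.lie (F : Hom P Q) (w : P.group.LieAlg) : Q.group.LieAlg :=
  ⟨F.group_smooth.tmap w.1, by rw [QManifold.Smooth.tproj_tmap, w.2, map_one]⟩

/-- The map `P₁ ×_Ad 𝔤₁ → P₂ ×_Ad 𝔤₂`, `[(p, w)] ↦ [(F(p), T₁Θ(w))]`, induced by a morphism `F`. -/
noncomputable def Hom.ad (F : Hom P Q) : P.AdBundle → Q.AdBundle :=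
  Quot.lift (fun x => Q.adMk (F.map x.1) (F.lie x.2)) (by
    rintro ⟨p, w⟩ _ ⟨g, rfl⟩
    refine Quot.sound ⟨F.group g, ?_⟩
    refine Prod.ext (F.map_act p g) (Subtype.ext ?_)
    have h1 : P.group.Smooth Q.group.toQManifold (fun x => F.group (g⁻¹ * x * g⁻¹⁻¹)) :=
      F.group_smooth.comp (P.group.smooth_conj g⁻¹) P.group.surjective
    have h2 : P.group.Smooth Q.group.toQManifold
        (fun x => (F.group g)⁻¹ * F.group x * (F.group g)⁻¹⁻¹) :=
      (Q.group.smooth_conj (F.group g)⁻¹).comp F.group_smooth Q.group.surjective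
    simp only [Hom.lie, QGroup.Ad]
    rw [← F.group_smooth.tmap_comp (P.group.smooth_conj g⁻¹) h1,
      ← (Q.group.smooth_conj (F.group g)⁻¹).tmap_comp F.group_smooth h2]
    exact QManifold.Smooth.tmap_congr _ _ (funext fun x => by simp) _)

end QPrincipalBundle

/-! ### Lie algebroids -/

/-- The derivative `X(h)` of a function `h` in the direction of a tangent vector `X` at `n`. -/
noncomputable def dirDeriv {N : SmoothMfd.{u}} {n : N} (X : N.T n) (h : N → ℝ) : ℝ :=
  mfderiv (𝓡 N.dim) 𝓘(ℝ, ℝ) h n X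

/-- A Lie algebroid over `N`: a smooth vector bundle, a smooth vector bundle morphism to `TN` (the
anchor), and a Lie bracket on the space of smooth sections that satisfies the Leibniz rule. -/
structure LieAlgebroid (N : SmoothMfd.{u}) : Type (u + 1) where
  rank : ℕ
  fiber : N → Type u
  [acg : ∀ n, AddCommGroup (fiber n)]
  [mod : ∀ n, Module ℝ (fiber n)]
  [topFiber : ∀ n, TopologicalSpace (fiber n)]
  [topTotal : TopologicalSpace (Bundle.TotalSpace (EuclideanSpace ℝ (Fin rank)) fiber)]
  [fiberBundle : FiberBundle (EuclideanSpace ℝ (Fin rank)) fiber]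
  [vectorBundle : VectorBundle ℝ (EuclideanSpace ℝ (Fin rank)) fiber]
  [smoothBundle : ContMDiffVectorBundle ∞ (EuclideanSpace ℝ (Fin rank)) fiber (𝓡 N.dim)]
  anchor : ∀ n, fiber n →ₗ[ℝ] N.T n
  anchor_smooth : ContMDiff ((𝓡 N.dim).prod (𝓡 rank)) (𝓡 N.dim).tangent ∞
    (fun x : Bundle.TotalSpace (EuclideanSpace ℝ (Fin rank)) fiber =>
      (⟨x.proj, anchor x.proj x.2⟩ : TangentBundle (𝓡 N.dim) N))
  bracket : ContMDiffSection (𝓡 N.dim) (EuclideanSpace ℝ (Fin rank)) ∞ fiber →ₗ[ℝ]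
    ContMDiffSection (𝓡 N.dim) (EuclideanSpace ℝ (Fin rank)) ∞ fiber →ₗ[ℝ]
    ContMDiffSection (𝓡 N.dim) (EuclideanSpace ℝ (Fin rank)) ∞ fiber
  bracket_self : ∀ σ, bracket σ σ = 0
  jacobi : ∀ σ τ υ, bracket σ (bracket τ υ) = bracket (bracket σ τ) υ + bracket τ (bracket σ υ)
  leibniz : ∀ (σ τ τ' : ContMDiffSection (𝓡 N.dim) (EuclideanSpace ℝ (Fin rank)) ∞ fiber)
    (f : N → ℝ), ContMDiff (𝓡 N.dim) 𝓘(ℝ, ℝ) ∞ f → (∀ n, τ' n = f n • τ n) →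
    ∀ n, bracket σ τ' n = f n • bracket σ τ n +
      dirDeriv (anchor n (σ n)) f • τ n

namespace LieAlgebroid

attribute [instance] acg mod topFiber topTotal fiberBundle vectorBundle smoothBundle

/-- The total space of the underlying vector bundle. -/
abbrev Total {N : SmoothMfd.{u}} (A : LieAlgebroid N) : Type u :=
  Bundle.TotalSpace (EuclideanSpace ℝ (Fin A.rank)) A.fiber

/-- The space `Γ(A)` of smooth sections. -/
abbrev Sec {N : SmoothMfd.{u}} (A : LieAlgebroid N) : Type u :=
  ContMDiffSection (𝓡 N.dim) (EuclideanSpace ℝ (Fin A.rank)) ∞ A.fiber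

/-- A Lie algebroid is transitive if its anchor is surjective. -/
def Transitive {N : SmoothMfd.{u}} (A : LieAlgebroid N) : Prop := ∀ n, Surjective (A.anchor n)

end LieAlgebroid

/-- The map of total spaces given by a family of maps of the fibres over `f`. -/
def LieAlgebroid.totalMap {N N' : SmoothMfd.{u}} (A : LieAlgebroid N) (B : LieAlgebroid N')
    (f : N → N') (φ : ∀ n, A.fiber n →ₗ[ℝ] B.fiber (f n)) (x : A.Total) : B.Total :=
  ⟨f x.proj, φ x.proj x.2⟩

/-- A morphism of Lie algebroids over a smooth map `f : N → N'`: a smooth morphism of vector bundles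
`φ` over `f` that is compatible with the anchors and whose induced morphism `A → f^{!!}B`,
`a ↦ (anchor a, φ a)`, preserves brackets. The bracket of `f^{!!}B = TN ×_{TN'} B` is computed as usual
from local decompositions of `φ ∘ σ` in terms of pulled back sections of `B`:
`[X₁ ⊕ ∑ u₁ᵢ τᵢ, X₂ ⊕ ∑ u₂ⱼ τⱼ] = [X₁, X₂] ⊕ (∑ u₁ᵢ u₂ⱼ [τᵢ, τⱼ] + ∑ (X₁(u₂ᵢ) - X₂(u₁ᵢ)) τᵢ)`. -/
structure IsLieAlgebroidMorphism {N N' : SmoothMfd.{u}} (A : LieAlgebroid N) (B : LieAlgebroid N')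
    (f : N → N') (φ : ∀ n, A.fiber n →ₗ[ℝ] B.fiber (f n)) : Prop where
  base_smooth : ContMDiff (𝓡 N.dim) (𝓡 N'.dim) ∞ f
  smooth : ContMDiff ((𝓡 N.dim).prod (𝓡 A.rank)) ((𝓡 N'.dim).prod (𝓡 B.rank)) ∞ (A.totalMap B f φ)
  anchor : ∀ n a, B.anchor (f n) (φ n a) = mfderiv (𝓡 N.dim) (𝓡 N'.dim) f n (A.anchor n a)
  bracket : ∀ (σ₁ σ₂ : A.Sec) (n : N) (k : ℕ) (τ : Fin k → B.Sec) (u₁ u₂ : Fin k → N → ℝ),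
    (∀ i, ContMDiff (𝓡 N.dim) 𝓘(ℝ, ℝ) ∞ (u₁ i)) → (∀ i, ContMDiff (𝓡 N.dim) 𝓘(ℝ, ℝ) ∞ (u₂ i)) →
    (∀ᶠ x in 𝓝 n, φ x (σ₁ x) = ∑ i, u₁ i x • τ i (f x)) →
    (∀ᶠ x in 𝓝 n, φ x (σ₂ x) = ∑ i, u₂ i x • τ i (f x)) →
    φ n (A.bracket σ₁ σ₂ n) =
      ∑ i, ∑ j, (u₁ i n * u₂ j n) • B.bracket (τ i) (τ j) (f n) +
      ∑ i, (dirDeriv (A.anchor n (σ₁ n)) (u₂ i) - dirDeriv (A.anchor n (σ₂ n)) (u₁ i)) • τ i (f n)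

/-! Composition of morphisms of Lie algebroids. -/

namespace LieAlgebroid

variable {N N' N'' : SmoothMfd.{u}}

theorem dirDeriv_sum_mul {n : N} (X : N.T n) {k : ℕ} {u g : Fin k → N → ℝ} {h : N → ℝ}
    (hu : ∀ i, ContMDiff (𝓡 N.dim) 𝓘(ℝ, ℝ) ∞ (u i))
    (hg : ∀ i, ContMDiff (𝓡 N.dim) 𝓘(ℝ, ℝ) ∞ (g i))
    (hh : ∀ᶠ x in 𝓝 n, h x = ∑ i, u i x * g i x) :
    dirDeriv X h = ∑ i, (dirDeriv X (u i) * g i n + u i n * dirDeriv X (g i)) := by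
  have e : h =ᶠ[𝓝 n] (fun x => ∑ i, u i x * g i x) := hh
  have hud : ∀ i, HasMFDerivAt (𝓡 N.dim) 𝓘(ℝ, ℝ) (u i) n (mfderiv (𝓡 N.dim) 𝓘(ℝ, ℝ) (u i) n) :=
    fun i => ((hu i).mdifferentiableAt (by simp)).hasMFDerivAt
  have hgd : ∀ i, HasMFDerivAt (𝓡 N.dim) 𝓘(ℝ, ℝ) (g i) n (mfderiv (𝓡 N.dim) 𝓘(ℝ, ℝ) (g i) n) :=
    fun i => ((hg i).mdifferentiableAt (by simp)).hasMFDerivAt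
  have key := HasMFDerivAt.sum (t := Finset.univ) (f := fun i => u i * g i)
    (fun i _ => (hud i).mul (hgd i))
  have e2 : (fun x => ∑ i, u i x * g i x) = ∑ i, u i * g i := by
    ext x; simp
  unfold dirDeriv
  rw [e.mfderiv_eq, e2, key.mfderiv]
  have hlin : ∀ (a b : Fin k → ℝ) (L M : Fin k → (EuclideanSpace ℝ (Fin N.dim) →L[ℝ] ℝ))
      (Y : EuclideanSpace ℝ (Fin N.dim)),
      (∑ i, (a i • L i + b i • M i)) Y = ∑ i, (M i Y * b i + a i * L i Y) := by
    intro a b L M Y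
    rw [sum_apply]
    exact Finset.sum_congr rfl fun i _ => by simp; ring
  exact hlin (fun i => u i n) (fun i => g i n) _ _ X

/-- A smooth 1-form: a smooth fibrewise linear function on the total space. -/
structure Form (A : LieAlgebroid N) where
  toFun : ∀ n, A.fiber n →ₗ[ℝ] ℝ
  smooth : ContMDiff ((𝓡 N.dim).prod (𝓡 A.rank)) 𝓘(ℝ, ℝ) ∞ (fun x : A.Total => toFun x.proj x.2)

variable {A : LieAlgebroid N} {B : LieAlgebroid N'} {C : LieAlgebroid N''}

theorem Form.smooth_apply (θ : A.Form) (σ : A.Sec) :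
    ContMDiff (𝓡 N.dim) 𝓘(ℝ, ℝ) ∞ (fun n => θ.toFun n (σ n)) :=
  θ.smooth.comp σ.contMDiff

/-- The exterior derivative of a 1-form, evaluated on two sections at a point. -/
noncomputable def Form.d (θ : A.Form) (σ τ : A.Sec) (n : N) : ℝ :=
  dirDeriv (A.anchor n (σ n)) (fun x => θ.toFun x (τ x)) -
  dirDeriv (A.anchor n (τ n)) (fun x => θ.toFun x (σ x)) - θ.toFun n (A.bracket σ τ n)

/-- The value at `n` of the right-hand side of the bracket condition. -/
noncomputable def rhs (A : LieAlgebroid N) (B : LieAlgebroid N') (f : N → N') (σ₁ σ₂ : A.Sec) (n : N) (k : ℕ)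
    (τ : Fin k → B.Sec) (u₁ u₂ : Fin k → N → ℝ) : B.fiber (f n) :=
  ∑ i, ∑ j, (u₁ i n * u₂ j n) • B.bracket (τ i) (τ j) (f n) +
      ∑ i, (dirDeriv (A.anchor n (σ₁ n)) (u₂ i) - dirDeriv (A.anchor n (σ₂ n)) (u₁ i)) • τ i (f n)

theorem Sec.sum_apply {k : ℕ} (s : Fin k → A.Sec) (n : N) : (∑ i, s i) n = ∑ i, s i n := by
  have := map_sum (ContMDiffSection.coeAddHom (𝓡 N.dim) (EuclideanSpace ℝ (Fin A.rank)) ∞ A.fiber) s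
    Finset.univ
  have h2 := congrFun this n
  rw [Finset.sum_apply] at h2
  exact h2

theorem dirDeriv_comp {n : N} (X : N.T n) {f : N → N'} (hf : ContMDiff (𝓡 N.dim) (𝓡 N'.dim) ∞ f)
    {g : N' → ℝ} (hg : ContMDiff (𝓡 N'.dim) 𝓘(ℝ, ℝ) ∞ g) :
    dirDeriv X (fun x => g (f x)) =
      dirDeriv (n := f n) (mfderiv (𝓡 N.dim) (𝓡 N'.dim) f n X) g := by
  have : mfderiv (𝓡 N.dim) 𝓘(ℝ, ℝ) (g ∘ f) n = _ :=
    mfderiv_comp n (hg.mdifferentiableAt (by simp)) (hf.mdifferentiableAt (by simp))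
  unfold dirDeriv
  exact congrArg (fun L => L X) this

theorem dirDeriv_const {n : N} (X : N.T n) (c : ℝ) : dirDeriv X (fun _ => c) = 0 := by
  unfold dirDeriv
  rw [mfderiv_const]
  rfl

theorem dirDeriv_add_left {n : N} (X Y : N.T n) (h : N → ℝ) :
    dirDeriv (X + Y) h = dirDeriv X h + dirDeriv Y h := map_add _ _ _

theorem key {f : N → N'} {φ : ∀ n, A.fiber n →ₗ[ℝ] B.fiber (f n)}
    (hf : ContMDiff (𝓡 N.dim) (𝓡 N'.dim) ∞ f)
    (ha : ∀ n a, B.anchor (f n) (φ n a) = mfderiv (𝓡 N.dim) (𝓡 N'.dim) f n (A.anchor n a))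
    (θ : B.Form) (σ₁ σ₂ : A.Sec) (n : N) (k : ℕ) (τ : Fin k → B.Sec) (u₁ u₂ : Fin k → N → ℝ)
    (hu₁ : ∀ i, ContMDiff (𝓡 N.dim) 𝓘(ℝ, ℝ) ∞ (u₁ i))
    (hu₂ : ∀ i, ContMDiff (𝓡 N.dim) 𝓘(ℝ, ℝ) ∞ (u₂ i))
    (h₁ : ∀ᶠ x in 𝓝 n, φ x (σ₁ x) = ∑ i, u₁ i x • τ i (f x))
    (h₂ : ∀ᶠ x in 𝓝 n, φ x (σ₂ x) = ∑ i, u₂ i x • τ i (f x)) :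
    dirDeriv (A.anchor n (σ₁ n)) (fun x => θ.toFun (f x) (φ x (σ₂ x))) -
    dirDeriv (A.anchor n (σ₂ n)) (fun x => θ.toFun (f x) (φ x (σ₁ x))) -
      θ.toFun (f n) (rhs A B f σ₁ σ₂ n k τ u₁ u₂) =
    θ.d (∑ i, u₁ i n • τ i) (∑ i, u₂ i n • τ i) (f n) := by
  have hθ := fun i => θ.smooth_apply (τ i)
  have hcomp : ∀ i, ContMDiff (𝓡 N.dim) 𝓘(ℝ, ℝ) ∞ (fun x => θ.toFun (f x) (τ i (f x))) :=
    fun i => (hθ i).comp hf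
  -- first-order part along `f`
  have hA : ∀ (X : N.T n) (u : Fin k → N → ℝ) (hu : ∀ i, ContMDiff (𝓡 N.dim) 𝓘(ℝ, ℝ) ∞ (u i))
      (σ : A.Sec) (h : ∀ᶠ x in 𝓝 n, φ x (σ x) = ∑ i, u i x • τ i (f x)),
      dirDeriv X (fun x => θ.toFun (f x) (φ x (σ x))) =
      ∑ i, (dirDeriv X (u i) * θ.toFun (f n) (τ i (f n)) + u i n *
        dirDeriv (n := f n) (mfderiv (𝓡 N.dim) (𝓡 N'.dim) f n X)
          (fun y => θ.toFun y (τ i y))) := by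
    intro X u hu σ h
    rw [dirDeriv_sum_mul X hu hcomp (h.mono fun x hx => by rw [hx]; simp)]
    refine Finset.sum_congr rfl fun i _ => ?_
    rw [dirDeriv_comp X hf (hθ i)]
  have hS : ∀ (u : Fin k → N → ℝ), (∑ i, u i n • τ i : B.Sec) (f n) = ∑ i, u i n • τ i (f n) := by
    intro u
    rw [Sec.sum_apply]; rfl
  have hB : ∀ (Y : N'.T (f n)) (u : Fin k → N → ℝ),
      dirDeriv Y (fun y => θ.toFun y ((∑ i, u i n • τ i : B.Sec) y)) =
      ∑ i, u i n * dirDeriv Y (fun y => θ.toFun y (τ i y)) := by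
    intro Y u
    rw [dirDeriv_sum_mul Y (u := fun i _ => u i n) (fun i => contMDiff_const) hθ
      (Filter.Eventually.of_forall fun y => by rw [Sec.sum_apply]; simp)]
    refine Finset.sum_congr rfl fun i _ => ?_
    rw [dirDeriv_const, zero_mul, zero_add]
  have hX : ∀ (u : Fin k → N → ℝ) (σ : A.Sec) (h : ∀ᶠ x in 𝓝 n, φ x (σ x) = ∑ i, u i x • τ i (f x)),
      mfderiv (𝓡 N.dim) (𝓡 N'.dim) f n (A.anchor n (σ n)) =
        B.anchor (f n) ((∑ i, u i n • τ i : B.Sec) (f n)) := by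
    intro u σ h
    rw [← ha, h.self_of_nhds, hS]
  rw [hA _ u₂ hu₂ σ₂ h₂, hA _ u₁ hu₁ σ₁ h₁, Form.d, hB, hB, hX u₁ σ₁ h₁, hX u₂ σ₂ h₂]
  have hbr : B.bracket (∑ i, u₁ i n • τ i) (∑ i, u₂ i n • τ i) (f n) =
      ∑ i, ∑ j, (u₁ i n * u₂ j n) • B.bracket (τ i) (τ j) (f n) := by
    simp only [map_sum, LinearMap.sum_apply, map_smul, LinearMap.smul_apply, Sec.sum_apply]
    rw [Finset.sum_comm]
    refine Finset.sum_congr rfl fun j _ => ?_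
    rw [ContMDiffSection.coe_smul, Pi.smul_apply, Sec.sum_apply, Finset.smul_sum]
    refine Finset.sum_congr rfl fun i _ => ?_
    rw [ContMDiffSection.coe_smul, Pi.smul_apply, smul_smul, mul_comm]
  rw [hbr, rhs]
  simp only [map_add, map_sum, map_smul, smul_eq_mul, Finset.sum_add_distrib, sub_mul,
    Finset.sum_sub_distrib]
  ring

end LieAlgebroid

namespace LieAlgebroid

variable {N N' N'' : SmoothMfd.{u}} {A : LieAlgebroid N} {B : LieAlgebroid N'} {C : LieAlgebroid N''}

/-- A smooth function which is `1` near `n` and has support in a given neighbourhood. -/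
theorem exists_bump {n : N} {U : Set N} (hU : U ∈ 𝓝 n) :
    ∃ χ : N → ℝ, ContMDiff (𝓡 N.dim) 𝓘(ℝ, ℝ) ∞ χ ∧ tsupport χ ⊆ U ∧ ∀ᶠ x in 𝓝 n, χ x = 1 := by
  obtain ⟨χ, -, hχ⟩ := (SmoothBumpFunction.nhds_basis_tsupport (I := 𝓡 N.dim) n).mem_iff.1 hU
  exact ⟨χ, χ.contMDiff, hχ, χ.eventuallyEq_one⟩

/-- Global sections which form a frame near a point, with the coordinate 1-forms. -/
theorem exists_frame (B : LieAlgebroid N') (y : N') :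
    ∃ (e : Fin B.rank → B.Sec) (c : Fin B.rank → B.Form),
      ∀ᶠ x in 𝓝 y, ∀ v : B.fiber x, v = ∑ i, (c i).toFun x v • e i x := by
  let F := EuclideanSpace ℝ (Fin B.rank)
  let t := trivializationAt F B.fiber y
  have hy : y ∈ t.baseSet := FiberBundle.mem_baseSet_trivializationAt F B.fiber y
  have htn : t.baseSet ∈ 𝓝 y := t.open_baseSet.mem_nhds hy
  let b : Module.Basis (Fin B.rank) ℝ F := (EuclideanSpace.basisFun (Fin B.rank) ℝ).toBasis
  obtain ⟨χ, hχ, hsupp, hone⟩ := exists_bump htn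
  refine ⟨fun i => ⟨χ • t.localFrame b i, ?_⟩, fun i => ⟨fun x => χ x •
    ((b.coord i).comp (t.linearMapAt ℝ x)), ?_⟩, ?_⟩
  · exact ContMDiffOn.smul_section_of_tsupport hχ.contMDiffOn t.open_baseSet hsupp
      (t.contMDiffOn_localFrame_baseSet ∞ b i)
  · refine contMDiff_of_contMDiffOn_union_of_isOpen (s := t.source)
      (t := Bundle.TotalSpace.proj ⁻¹' (tsupport χ)ᶜ) ?_ ?_ ?_ t.open_source
      ((isClosed_tsupport χ).isOpen_compl.preimage
        (FiberBundle.continuous_proj F B.fiber))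
    · have h1 : ContMDiffOn ((𝓡 N'.dim).prod (𝓡 B.rank)) 𝓘(ℝ, ℝ) ∞
          (fun x : B.Total => χ x.proj • b.coord i (t x).2) t.source := by
        have h2 := contMDiff_snd.comp_contMDiffOn (t.contMDiffOn (IB := 𝓡 N'.dim) (n := ∞))
        have h3 : ContMDiff 𝓘(ℝ, F) 𝓘(ℝ, ℝ) ∞ (b.coord i) :=
          (LinearMap.toContinuousLinearMap (b.coord i)).contMDiff
        exact ((hχ.comp (Bundle.contMDiff_proj B.fiber)).contMDiffOn).smul (h3.comp_contMDiffOn h2)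
      refine h1.congr fun x hx => ?_
      have hx' : x.proj ∈ t.baseSet := t.mem_source.1 hx
      obtain ⟨y, v⟩ := x
      simp [t.coe_linearMapAt_of_mem (R := ℝ) hx']
    · refine (contMDiffOn_const (c := (0 : ℝ))).congr fun x hx => ?_
      simp [image_eq_zero_of_notMem_tsupport hx]
    · refine eq_univ_of_forall fun x => ?_
      by_cases hx : x.proj ∈ tsupport χ
      · exact Or.inl (t.mem_source.2 (hsupp hx))
      · exact Or.inr hx
  · filter_upwards [hone, htn] with x hx hxt v
    have h1 := (t.basisAt b hxt).sum_repr v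
    conv_lhs => rw [← h1]
    refine Finset.sum_congr rfl fun i _ => ?_
    simp [hx, t.localFrame_apply_of_mem_baseSet b hxt, Bundle.Trivialization.basisAt,
      t.coe_linearMapAt_of_mem (R := ℝ) hxt]

end LieAlgebroid

namespace LieAlgebroid

variable {N N' N'' : SmoothMfd.{u}} {A : LieAlgebroid N} {B : LieAlgebroid N'} {C : LieAlgebroid N''}

theorem dirDeriv_add {n : N} (X : N.T n) {g h : N → ℝ}
    (hg : ContMDiff (𝓡 N.dim) 𝓘(ℝ, ℝ) ∞ g) (hh : ContMDiff (𝓡 N.dim) 𝓘(ℝ, ℝ) ∞ h) :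
    dirDeriv X (fun x => g x + h x) = dirDeriv X g + dirDeriv X h := by
  have := dirDeriv_sum_mul X (k := 2) (u := fun _ _ => 1) (g := ![g, h])
    (h := fun x => g x + h x) (fun _ => contMDiff_const) (by intro i; fin_cases i <;> simpa)
    (Filter.Eventually.of_forall fun x => by simp)
  simpa [dirDeriv_const] using this

theorem dirDeriv_mul {n : N} (X : N.T n) {g h : N → ℝ}
    (hg : ContMDiff (𝓡 N.dim) 𝓘(ℝ, ℝ) ∞ g) (hh : ContMDiff (𝓡 N.dim) 𝓘(ℝ, ℝ) ∞ h) :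
    dirDeriv X (fun x => g x * h x) = dirDeriv X g * h n + g n * dirDeriv X h := by
  have := dirDeriv_sum_mul X (k := 1) (u := fun _ => g) (g := fun _ => h)
    (h := fun x => g x * h x) (fun _ => hg) (fun _ => hh)
    (Filter.Eventually.of_forall fun x => by simp)
  simpa using this

/-- The product of a smooth function and a smooth section. -/
noncomputable def smulSec (f : N → ℝ) (hf : ContMDiff (𝓡 N.dim) 𝓘(ℝ, ℝ) ∞ f) (σ : A.Sec) : A.Sec :=
  ⟨f • ⇑σ, hf.smul_section σ.contMDiff⟩

theorem bracket_swap (σ τ : A.Sec) : A.bracket σ τ = - A.bracket τ σ := by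
  have h := A.bracket_self (σ + τ)
  simp only [map_add, LinearMap.add_apply, A.bracket_self, zero_add, add_zero] at h
  exact eq_neg_of_add_eq_zero_right h

theorem Form.d_swap (θ : A.Form) (σ τ : A.Sec) (n : N) : θ.d σ τ n = - θ.d τ σ n := by
  rw [Form.d, Form.d, bracket_swap σ τ, ContMDiffSection.coe_neg, Pi.neg_apply, map_neg]
  ring

theorem Form.d_add (θ : A.Form) (σ τ τ' : A.Sec) (n : N) :
    θ.d σ (τ + τ') n = θ.d σ τ n + θ.d σ τ' n := by
  have h := dirDeriv_add (A.anchor n (σ n)) (θ.smooth_apply τ) (θ.smooth_apply τ')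
  simp only [Form.d, ContMDiffSection.coe_add, Pi.add_apply, map_add]
  rw [h, dirDeriv_add_left]
  ring

theorem dirDeriv_smul_left {n : N} (c : ℝ) (X : N.T n) (h : N → ℝ) :
    dirDeriv (c • X) h = c * dirDeriv X h := map_smul _ _ _

theorem Form.d_smul (θ : A.Form) (σ τ : A.Sec) (f : N → ℝ)
    (hf : ContMDiff (𝓡 N.dim) 𝓘(ℝ, ℝ) ∞ f) (n : N) :
    θ.d σ (smulSec f hf τ) n = f n * θ.d σ τ n := by
  have hv : ∀ x, smulSec f hf τ x = f x • τ x := fun _ => rfl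
  have h := dirDeriv_mul (A.anchor n (σ n)) hf (θ.smooth_apply τ)
  simp only [Form.d, A.leibniz σ τ (smulSec f hf τ) f hf hv n, hv, map_add, map_smul, smul_eq_mul]
  rw [h, dirDeriv_smul_left]
  ring

theorem Form.d_zero (θ : A.Form) (σ : A.Sec) (n : N) : θ.d σ 0 n = 0 := by
  have h := θ.d_add σ 0 0 n
  rw [add_zero] at h
  linarith

theorem Form.d_sum (θ : A.Form) (σ : A.Sec) {k : ℕ} (τ : Fin k → A.Sec) (n : N) :
    θ.d σ (∑ i, τ i) n = ∑ i, θ.d σ (τ i) n := by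
  let L : A.Sec →+ ℝ := ⟨⟨fun τ => θ.d σ τ n, θ.d_zero σ n⟩, fun τ τ' => θ.d_add σ τ τ' n⟩
  exact map_sum L τ Finset.univ

theorem Form.d_eq_zero_of_eventually (θ : A.Form) (σ τ : A.Sec) (n : N)
    (h : ∀ᶠ x in 𝓝 n, τ x = 0) : θ.d σ τ n = 0 := by
  obtain ⟨χ, hχ, hs, h1⟩ := exists_bump h
  have hf : ContMDiff (𝓡 N.dim) 𝓘(ℝ, ℝ) ∞ (fun x => 1 + (-1) * χ x) :=
    contMDiff_const.add (contMDiff_const.mul hχ)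
  have e : τ = smulSec _ hf τ := by
    ext x
    change τ x = (1 + (-1) * χ x) • τ x
    by_cases hx : χ x = 0
    · simp [hx]
    · have : τ x = 0 := hs (subset_tsupport _ hx)
      simp [this]
  rw [e, θ.d_smul, h1.self_of_nhds]
  ring

/-- The exterior derivative of a 1-form is tensorial. -/
theorem Form.d_eq_zero (θ : A.Form) (σ τ : A.Sec) (n : N) (h : τ n = 0) : θ.d σ τ n = 0 := by
  obtain ⟨e, c, hec⟩ := A.exists_frame n
  let s : Fin A.rank → A.Sec := fun i => smulSec _ ((c i).smooth_apply τ) (e i)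
  have h1 : θ.d σ (τ + (-1 : ℝ) • ∑ i, s i) n = 0 := by
    refine θ.d_eq_zero_of_eventually σ _ n (hec.mono fun x hx => ?_)
    rw [ContMDiffSection.coe_add, Pi.add_apply, ContMDiffSection.coe_smul, Pi.smul_apply,
      Sec.sum_apply, hx (τ x), neg_smul, one_smul, ← sub_eq_add_neg]
    conv_lhs => rw [← hx (τ x)]
    exact sub_eq_zero.2 (hx (τ x))
  have h2 : τ = (τ + (-1 : ℝ) • ∑ i, s i) + ∑ i, s i := by
    rw [neg_smul, one_smul, neg_add_cancel_right]
  rw [h2, θ.d_add, h1, zero_add, θ.d_sum]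
  refine Finset.sum_eq_zero fun i _ => ?_
  rw [θ.d_smul, h, map_zero, zero_mul]

theorem Form.d_congr (θ : A.Form) (σ τ σ' τ' : A.Sec) (n : N) (hσ : σ n = σ' n) (hτ : τ n = τ' n) :
    θ.d σ τ n = θ.d σ' τ' n := by
  have key : ∀ (σ τ τ' : A.Sec), τ n = τ' n → θ.d σ τ n = θ.d σ τ' n := by
    intro σ τ τ' h
    have h2 : τ = τ' + (τ + (-1 : ℝ) • τ') := by
      rw [neg_smul, one_smul]; abel
    rw [h2, θ.d_add, θ.d_eq_zero σ (τ + (-1 : ℝ) • τ') n, add_zero]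
    rw [ContMDiffSection.coe_add, Pi.add_apply, ContMDiffSection.coe_smul, Pi.smul_apply, h]
    simp
  rw [key σ τ τ' hτ, θ.d_swap, key τ' σ σ' hσ, ← θ.d_swap]

/-- The bracket condition for a morphism, through the pullback of 1-forms. -/
def FormCond (A : LieAlgebroid N) (B : LieAlgebroid N') (f : N → N')
    (φ : ∀ n, A.fiber n →ₗ[ℝ] B.fiber (f n)) : Prop :=
  ∀ (θ : B.Form) (σ₁ σ₂ : A.Sec) (n : N), ∃ τ₁ τ₂ : B.Sec,
    τ₁ (f n) = φ n (σ₁ n) ∧ τ₂ (f n) = φ n (σ₂ n) ∧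
    dirDeriv (A.anchor n (σ₁ n)) (fun x => θ.toFun (f x) (φ x (σ₂ x))) -
    dirDeriv (A.anchor n (σ₂ n)) (fun x => θ.toFun (f x) (φ x (σ₁ x))) -
      θ.toFun (f n) (φ n (A.bracket σ₁ σ₂ n)) = θ.d τ₁ τ₂ (f n)

theorem Form.separates (y : N') (v w : B.fiber y) (h : ∀ θ : B.Form, θ.toFun y v = θ.toFun y w) :
    v = w := by
  obtain ⟨e, c, hec⟩ := B.exists_frame y
  rw [hec.self_of_nhds v, hec.self_of_nhds w]
  simp only [h]

end LieAlgebroid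

section

open LieAlgebroid

variable {N N' N'' : SmoothMfd.{u}} {A : LieAlgebroid N} {B : LieAlgebroid N'} {C : LieAlgebroid N''}

theorem IsLieAlgebroidMorphism.formCond {f : N → N'} {φ : ∀ n, A.fiber n →ₗ[ℝ] B.fiber (f n)}
    (h : IsLieAlgebroidMorphism A B f φ) : FormCond A B f φ := by
  intro θ σ₁ σ₂ n
  obtain ⟨e, c, hec⟩ := B.exists_frame (f n)
  have hev : ∀ σ : A.Sec, ∀ᶠ x in 𝓝 n,
      φ x (σ x) = ∑ i, (c i).toFun (f x) (φ x (σ x)) • e i (f x) := fun σ =>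
    (h.base_smooth.continuous.continuousAt.eventually hec).mono fun x hx => hx _
  have hu : ∀ (σ : A.Sec) i, ContMDiff (𝓡 N.dim) 𝓘(ℝ, ℝ) ∞
      (fun x => (c i).toFun (f x) (φ x (σ x))) := fun σ i =>
    (c i).smooth.comp (h.smooth.comp σ.contMDiff)
  refine ⟨∑ i, (c i).toFun (f n) (φ n (σ₁ n)) • e i, ∑ i, (c i).toFun (f n) (φ n (σ₂ n)) • e i,
    ?_, ?_, ?_ ⟩
  rotate_left 2
  · rw [← key h.base_smooth h.anchor θ σ₁ σ₂ n _ e _ _ (hu σ₁) (hu σ₂) (hev σ₁) (hev σ₂),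
      h.bracket σ₁ σ₂ n _ e _ _ (hu σ₁) (hu σ₂) (hev σ₁) (hev σ₂)]
    rfl
  · rw [Sec.sum_apply]; exact (hev σ₁).self_of_nhds.symm
  · rw [Sec.sum_apply]; exact (hev σ₂).self_of_nhds.symm

theorem IsLieAlgebroidMorphism.of_formCond {f : N → N'} {φ : ∀ n, A.fiber n →ₗ[ℝ] B.fiber (f n)}
    (hf : ContMDiff (𝓡 N.dim) (𝓡 N'.dim) ∞ f)
    (hs : ContMDiff ((𝓡 N.dim).prod (𝓡 A.rank)) ((𝓡 N'.dim).prod (𝓡 B.rank)) ∞ (A.totalMap B f φ))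
    (ha : ∀ n a, B.anchor (f n) (φ n a) = mfderiv (𝓡 N.dim) (𝓡 N'.dim) f n (A.anchor n a))
    (h : FormCond A B f φ) : IsLieAlgebroidMorphism A B f φ where
  base_smooth := hf
  smooth := hs
  anchor := ha
  bracket := by
    intro σ₁ σ₂ n k τ u₁ u₂ hu₁ hu₂ h₁ h₂
    refine Form.separates (f n) _ _ fun θ => ?_
    obtain ⟨τ₁, τ₂, e₁, e₂, h3⟩ := h θ σ₁ σ₂ n
    have h4 := key hf ha θ σ₁ σ₂ n k τ u₁ u₂ hu₁ hu₂ h₁ h₂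
    rw [θ.d_congr _ _ τ₁ τ₂ (f n) (by rw [e₁, h₁.self_of_nhds, Sec.sum_apply]; rfl)
      (by rw [e₂, h₂.self_of_nhds, Sec.sum_apply]; rfl), ← h3] at h4
    have h5 := sub_right_injective h4
    exact h5.symm

theorem IsLieAlgebroidMorphism.id (A : LieAlgebroid N) :
    IsLieAlgebroidMorphism A A (fun n => n) (fun _ => LinearMap.id) := by
  refine .of_formCond contMDiff_id contMDiff_id (fun n a => ?_) (fun θ σ₁ σ₂ n =>
    ⟨σ₁, σ₂, rfl, rfl, rfl⟩)
  have : mfderiv (𝓡 N.dim) (𝓡 N.dim) (fun n : N => n) n = _ := mfderiv_id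
  rw [this]
  rfl

theorem IsLieAlgebroidMorphism.comp {f : N → N'} {φ : ∀ n, A.fiber n →ₗ[ℝ] B.fiber (f n)}
    {f' : N' → N''} {φ' : ∀ n, B.fiber n →ₗ[ℝ] C.fiber (f' n)}
    (h' : IsLieAlgebroidMorphism B C f' φ') (h : IsLieAlgebroidMorphism A B f φ) :
    IsLieAlgebroidMorphism A C (fun n => f' (f n)) (fun n => (φ' (f n)).comp (φ n)) := by
  refine .of_formCond (h'.base_smooth.comp h.base_smooth) (h'.smooth.comp h.smooth)
    (fun n a => ?_) (fun θ σ₁ σ₂ n => ?_)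
  · have e : mfderiv (𝓡 N.dim) (𝓡 N''.dim) (f' ∘ f) n = _ := mfderiv_comp n
      (h'.base_smooth.mdifferentiableAt (by simp)) (h.base_smooth.mdifferentiableAt (by simp))
    rw [LinearMap.comp_apply, h'.anchor, h.anchor]
    exact (congrArg (fun L => L (A.anchor n a)) e).symm
  · let θ' : B.Form := ⟨fun y => (θ.toFun (f' y)).comp (φ' y), θ.smooth.comp h'.smooth⟩
    obtain ⟨τ₁, τ₂, e₁, e₂, h3⟩ := h.formCond θ' σ₁ σ₂ n
    obtain ⟨υ₁, υ₂, e₁', e₂', h4⟩ := h'.formCond θ τ₁ τ₂ (f n)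
    refine ⟨υ₁, υ₂, by rw [e₁', e₁]; rfl, by rw [e₂', e₂]; rfl, ?_⟩
    rw [← h4]
    exact h3

end

/-! ### Abstract Atiyah sequences -/

/-- A Lie algebra bundle, i.e. a locally trivial bundle of Lie algebras, regarded as a Lie algebroid
whose anchor is zero. -/
structure LieAlgebraBundle (N : SmoothMfd.{u}) : Type (u + 1) extends LieAlgebroid N where
  anchor_zero : ∀ n a, toLieAlgebroid.anchor n a = 0
  /-- There are a Lie bracket on the typical fibre and smooth local trivializations that are
  fibrewise isomorphisms of Lie algebras. -/
  locally_trivial : ∃ br : EuclideanSpace ℝ (Fin rank) →ₗ[ℝ] EuclideanSpace ℝ (Fin rank) →ₗ[ℝ]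
      EuclideanSpace ℝ (Fin rank),
    (∀ x, br x x = 0) ∧ (∀ x y z, br x (br y z) = br (br x y) z + br y (br x z)) ∧
    ∀ n₀ : N, ∃ U : Set N, IsOpen U ∧ n₀ ∈ U ∧
      ∃ φ : ∀ n, fiber n ≃ₗ[ℝ] EuclideanSpace ℝ (Fin rank),
        ContMDiffOn ((𝓡 N.dim).prod (𝓡 rank)) (𝓡 rank) ∞
          (fun x : toLieAlgebroid.Total => φ x.proj x.2) {x | x.proj ∈ U} ∧
        ∀ (σ τ : toLieAlgebroid.Sec), ∀ n ∈ U,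
          φ n (toLieAlgebroid.bracket σ τ n) = br (φ n (σ n)) (φ n (τ n))

/-- An abstract Atiyah sequence over `N`: a short exact sequence of Lie algebroids
`L → A → TN`, where `A` is a transitive Lie algebroid with its anchor `A → TN` and `L` is a Lie
algebra bundle. -/
structure AbstractAtiyahSequence (N : SmoothMfd.{u}) : Type (u + 1) where
  L : LieAlgebraBundle N
  A : LieAlgebroid N
  transitive : A.Transitive
  j : ∀ n, L.fiber n →ₗ[ℝ] A.fiber n
  j_hom : IsLieAlgebroidMorphism L.toLieAlgebroid A (fun n => n) j
  j_injective : ∀ n, Injective (j n)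
  exact : ∀ n a, A.anchor n a = 0 ↔ ∃ l, j n l = a

/-- An abstract Atiyah sequence over some smooth manifold. -/
structure AB : Type (u + 1) where
  base : SmoothMfd.{u}
  seq : AbstractAtiyahSequence base

namespace AB

/-- A morphism of abstract Atiyah sequences over a smooth map of the bases: two morphisms of Lie
algebroids, which form a commutative square with the inclusions. -/
structure Hom (S T : AB.{u}) : Type u where
  base : S.base → T.base
  A : ∀ n, S.seq.A.fiber n →ₗ[ℝ] T.seq.A.fiber (base n)
  L : ∀ n, S.seq.L.fiber n →ₗ[ℝ] T.seq.L.fiber (base n)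
  A_hom : IsLieAlgebroidMorphism S.seq.A T.seq.A base A
  L_hom : IsLieAlgebroidMorphism S.seq.L.toLieAlgebroid T.seq.L.toLieAlgebroid base L
  comm : ∀ n l, A n (S.seq.j n l) = T.seq.j (base n) (L n l)

/-- The category of abstract Atiyah sequences. -/
instance : Category AB.{u} where
  Hom := Hom
  id S :=
    { base := fun n => n
      A := fun _ => LinearMap.id
      L := fun _ => LinearMap.id
      A_hom := .id _
      L_hom := .id _
      comm := fun _ _ => rfl }
  comp {S T R} Φ Ψ :=
    { base := fun n => Ψ.base (Φ.base n)
      A := fun n => (Ψ.A (Φ.base n)).comp (Φ.A n)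
      L := fun n => (Ψ.L (Φ.base n)).comp (Φ.L n)
      A_hom := Ψ.A_hom.comp Φ.A_hom
      L_hom := Ψ.L_hom.comp Φ.L_hom
      comm := fun n l => by
        simp only [LinearMap.comp_apply]
        rw [Φ.comm, Ψ.comm] }
  id_comp _ := rfl
  comp_id _ := rfl
  assoc _ _ _ := rfl

end AB

/-! ### The Atiyah sequence of a Q-principal bundle -/

namespace QPrincipalBundle

/-- The class in the fibre of `(TP)/G` of a tangent vector `v` at a point `m` of the atlas of `P`. -/
def cls (P : QPrincipalBundle.{u}) (m : P.total.atlas) (v : P.total.atlas.T m) :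
    {a : P.Atiyah // P.atiyahProj a = P.proj (P.total.chart m)} :=
  ⟨P.quotTP (P.total.tmk m v), rfl⟩

/-- The class `[(p, v)]` in the fibre of `P ×_Ad 𝔤` of a point `p` and of the element of `T₁G` that is
represented by a tangent vector `v` at a point `e` of the atlas of `G` over `1`. -/
def adCls (P : QPrincipalBundle.{u}) (p : P.total) {e : P.group.atlas} (he : P.group.chart e = 1)
    (v : P.group.atlas.T e) : {l : P.AdBundle // P.adProj l = P.proj p} :=
  ⟨P.adMk p (QGroup.lieMk he v), rfl⟩

/-- The Atiyah sequence `P ×_Ad 𝔤 → (TP)/G → TN` of a Q-principal bundle `P` as an abstract Atiyah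
sequence. The bundles `A` and `L` of `seq` are identified with the sets `(TP)/G` and `P ×_Ad 𝔤`, and the
remaining fields say that the vector space structures of the fibres, the smooth structures,
the anchor, the inclusion and the brackets are those induced from `P`. These fields determine
the structure on the two sets uniquely. -/
structure AtiyahSequenceOf (P : QPrincipalBundle.{u}) : Type (u + 1) where
  seq : AbstractAtiyahSequence P.base
  eA : ∀ n, {a : P.Atiyah // P.atiyahProj a = n} ≃ seq.A.fiber n
  eL : ∀ n, {l : P.AdBundle // P.adProj l = n} ≃ seq.L.fiber n
  /-- The quotient map `TP → (TP)/G` is fibrewise linear. -/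
  eA_linear : ∀ m, IsLinearMap ℝ (fun v => eA _ (P.cls m v))
  /-- The quotient map `TP → (TP)/G` is smooth. -/
  eA_smooth : ContMDiff (𝓡 P.total.atlas.dim).tangent ((𝓡 P.base.dim).prod (𝓡 seq.A.rank)) ∞
    (fun x : TangentBundle (𝓡 P.total.atlas.dim) P.total.atlas =>
      (⟨P.proj (P.total.chart x.proj), eA _ (P.cls x.proj x.2)⟩ : seq.A.Total))
  /-- The quotient map `TP → (TP)/G` is a submersion. -/
  eA_submersion : ∀ x, Surjective (mfderiv (𝓡 P.total.atlas.dim).tangent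
    ((𝓡 P.base.dim).prod (𝓡 seq.A.rank))
    (fun x : TangentBundle (𝓡 P.total.atlas.dim) P.total.atlas =>
      (⟨P.proj (P.total.chart x.proj), eA _ (P.cls x.proj x.2)⟩ : seq.A.Total)) x)
  /-- The anchor is induced by the tangent map of the bundle projection `β : P → N`. -/
  anchor_eA : ∀ m v, seq.A.anchor (P.proj (P.total.chart m)) (eA _ (P.cls m v)) =
    mfderiv (𝓡 P.total.atlas.dim) (𝓡 P.base.dim) (fun m => P.proj (P.total.chart m)) m v
  /-- The bracket of sections of `(TP)/G` is the bracket of the corresponding `G`-invariant vector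
  fields on `P`, which are regarded as vector fields on the atlas. -/
  bracket_eA : ∀ (σ τ : seq.A.Sec) (X Y : ∀ m, P.total.atlas.T m),
    (∀ m, eA _ (P.cls m (X m)) = σ (P.proj (P.total.chart m))) →
    (∀ m, eA _ (P.cls m (Y m)) = τ (P.proj (P.total.chart m))) →
    ∀ m, seq.A.bracket σ τ (P.proj (P.total.chart m)) =
      eA _ (P.cls m (VectorField.mlieBracket (𝓡 P.total.atlas.dim) X Y m))
  /-- The quotient map `P × 𝔤 → P ×_Ad 𝔤` is fibrewise linear. -/
  eL_linear : ∀ p e (he : P.group.chart e = 1), IsLinearMap ℝ (fun v => eL _ (P.adCls p he v))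
  /-- The quotient map `P × 𝔤 → P ×_Ad 𝔤` is smooth. -/
  eL_smooth : ∀ e (he : P.group.chart e = 1),
    ContMDiff ((𝓡 P.total.atlas.dim).prod (𝓡 P.group.atlas.dim))
      ((𝓡 P.base.dim).prod (𝓡 seq.L.rank)) ∞
      (fun x : P.total.atlas × EuclideanSpace ℝ (Fin P.group.atlas.dim) =>
        (⟨P.proj (P.total.chart x.1), eL _ (P.adCls (P.total.chart x.1) he x.2)⟩ :
          seq.L.toLieAlgebroid.Total))
  /-- The bracket of `P ×_Ad 𝔤` is given fibrewise by the bracket of `𝔤`. -/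
  bracket_eL : ∀ (σ τ : seq.L.toLieAlgebroid.Sec) (p : P.total) (w v : P.group.LieAlg),
    σ (P.proj p) = eL _ ⟨P.adMk p w, rfl⟩ → τ (P.proj p) = eL _ ⟨P.adMk p v, rfl⟩ →
    seq.L.bracket σ τ (P.proj p) = eL _ ⟨P.adMk p (QGroup.lieBracket w v), rfl⟩
  /-- The inclusion is the map `ι_P`. -/
  j_eL : ∀ n (l : {l : P.AdBundle // P.adProj l = n}),
    seq.j n (eL n l) = eA n ⟨P.iota l.1, (P.atiyahProj_iota l.1).trans l.2⟩

namespace AtiyahSequenceOf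

variable {P Q : QPrincipalBundle.{u}}

/-- The Atiyah sequence as an object of the category of abstract Atiyah sequences. -/
def toAB (𝔖 : AtiyahSequenceOf P) : AB.{u} := ⟨P.base, 𝔖.seq⟩

/-- The identification of `(TP)/G` with the total space of the Lie algebroid. -/
def totA (𝔖 : AtiyahSequenceOf P) (a : P.Atiyah) : 𝔖.seq.A.Total := ⟨P.atiyahProj a, 𝔖.eA _ ⟨a, rfl⟩⟩

/-- The identification of `P ×_Ad 𝔤` with the total space of the Lie algebra bundle. -/
def totL (𝔖 : AtiyahSequenceOf P) (l : P.AdBundle) : 𝔖.seq.L.toLieAlgebroid.Total :=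
  ⟨P.adProj l, 𝔖.eL _ ⟨l, rfl⟩⟩

/-- A morphism of abstract Atiyah sequences between the Atiyah sequences of `P` and `Q` is induced by
a morphism `F : P ⟶ Q` if it consists of the base map of `F`, of the map `(TP)/G → (TQ)/H` induced by
the tangent map of `F`, and of the map `P ×_Ad 𝔤 → Q ×_Ad 𝔥` induced by `F`. -/
structure IsInducedBy (𝔖 : AtiyahSequenceOf P) (𝔗 : AtiyahSequenceOf Q)
    (Ψ : 𝔖.toAB ⟶ 𝔗.toAB) (F : P ⟶ Q) : Prop where
  base : AB.Hom.base Ψ = QPrincipalBundle.Hom.base F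
  A : ∀ a, 𝔖.seq.A.totalMap 𝔗.seq.A (AB.Hom.base Ψ) (AB.Hom.A Ψ) (𝔖.totA a) =
    𝔗.totA (QPrincipalBundle.Hom.atiyah F a)
  L : ∀ l, 𝔖.seq.L.totalMap 𝔗.seq.L.toLieAlgebroid (AB.Hom.base Ψ) (AB.Hom.L Ψ) (𝔖.totL l) =
    𝔗.totL (QPrincipalBundle.Hom.ad F l)

end AtiyahSequenceOf

end QPrincipalBundle

/-! Let `q : M → P` be the atlas of the total space. The proof moves every question from `P`, which
is only a Q-manifold, to the manifold `M`. Two facts make this possible. Lifts are rigid: two local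
lifts of one map that agree at a point agree near it (`eventuallyEq_of_chart_eq`). And the action is
free. Together they show that the tangent space of `M` at `m` maps bijectively onto the fibre of
`(TP)/G` below `m` (`eq_of_bcls_eq`, `exists_bcls_eq`). The fibre thus inherits a vector space
structure. It does not depend on `m`, because two points of `M` over the same point of `N` are
joined by a local lift of a right translation, whose derivative is linear. In the same way `w ↦ [(p,
w)]` identifies `𝔤` with a fibre of `P ×_Ad 𝔤`, and a change of `p` in its orbit acts by some `Ad
g`.

Local triviality enters through two consequences. There are smooth local sections `N → M` through
every point of `M` (`exists_section`). There is smooth division (`exists_division`): if two smooth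
maps `a`, `b` into `M` have the same image in `N`, then locally `b = a γ` over `P` with `γ` smooth
into the atlas of `G`. Hence a smooth family of tangent vectors can be moved to other base points
without changing its classes in `(TP)/G` (`contMDiffAt_of_bcls_eq`). Coordinates along local
sections therefore change smoothly and define the two vector bundles.

Sections of `(TP)/G` correspond to vector fields on `M` that are invariant under the local
translations. Brackets of related vector fields are related, so invariance passes to the bracket,
and the axioms of a Lie algebroid are inherited from the vector fields on `M`. The fibrewise bracket
of `P ×_Ad 𝔤` is well defined because each `Ad g` is an automorphism, and its structure constants do
not vary along a local section. Exactness in the middle means that vertical vectors are tangent to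
orbits; this follows by differentiating `z = s(β z) γ(z)`, where `s` is a local section and `γ`
comes from division. The inclusion respects brackets because orbit maps carry right-invariant fields
on `G` to invariant fields on `P`.

For a morphism `F`, let `g` be a local lift to the atlases. A decomposition of `𝔄(F) ∘ σ` as `∑ uᵢ
(τᵢ ∘ f)` says that `Tg` carries the field of `σ` to the combination of the fields of the `τᵢ` with
coefficients `uᵢ ∘ β`. The bracket formula for such vector fields (`mfderiv_mlieBracket_of_sum`) is
then exactly the bracket condition for a morphism of Lie algebroids. On adjoint bundles the anchors
vanish, and the condition says that `T₁Θ` is a homomorphism of Lie algebras. Functoriality is the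
chain rule for the tangent map, since a morphism of sequences is determined by its maps of total
spaces.

Parts 2 and 3 concern any structure as in part 1. The arguments about morphisms therefore use only
the properties recorded in `AtiyahSequenceOf`, in part through the structures `AtiyahBundle` and
`AdLieBundle`, and no particular construction. -/

namespace VectorField

/-! ### Lie brackets of vector fields and tangent maps -/

section

variable {E H F : Type*} [NormedAddCommGroup E] [NormedSpace ℝ E]
  [TopologicalSpace H] {I : ModelWithCorners ℝ E H}
  {M : Type*} [TopologicalSpace M] [ChartedSpace H M]
  [NormedAddCommGroup F] [NormedSpace ℝ F]

theorem mvfderiv_congr {f g : M → F} {m : M} (h : f =ᶠ[𝓝 m] g) (v : TangentSpace I m) :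
    mvfderiv I f m v = mvfderiv I g m v :=
  congrArg (fun L : E →L[ℝ] F => L v) (h.mfderiv_eq (I := I) (I' := 𝓘(ℝ, F)))

theorem mvfderiv_fun_comp_apply {E' H' : Type*} [NormedAddCommGroup E'] [NormedSpace ℝ E']
    [TopologicalSpace H'] {I' : ModelWithCorners ℝ E' H'}
    {M' : Type*} [TopologicalSpace M'] [ChartedSpace H' M'] {f : M → M'} {g : M' → F} {m : M}
    (hg : MDifferentiableAt I' 𝓘(ℝ, F) g (f m)) (hf : MDifferentiableAt I I' f m)
    (v : TangentSpace I m) :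
    mvfderiv I (fun z => g (f z)) m v = mvfderiv I' g (f m) (mfderiv I I' f m v) :=
  congrArg (fun L : E →L[ℝ] F => L v) (mfderiv_comp m hg hf)

theorem mvfderiv_sum_smul {ι : Type*} (s : Finset ι) {u : ι → M → ℝ} {a : ι → M → F} {m : M}
    (hu : ∀ i, MDifferentiableAt I 𝓘(ℝ, ℝ) (u i) m) (ha : ∀ i, MDifferentiableAt I 𝓘(ℝ, F) (a i) m)
    (v : TangentSpace I m) :
    mvfderiv I (fun z => ∑ i ∈ s, u i z • a i z) m v =
      ∑ i ∈ s, (u i m • mvfderiv I (a i) m v + mvfderiv I (u i) m v • a i m) := by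
  classical
  induction s using Finset.induction_on with
  | empty => simp [mvfderiv_const]
  | insert i s hi ih =>
    have hs : MDifferentiableAt I 𝓘(ℝ, F) (fun z => ∑ i ∈ s, u i z • a i z) m := by
      clear ih hi
      induction s using Finset.induction_on with
      | empty => simpa using! mdifferentiableAt_const (c := (0 : F))
      | insert j s hj ih =>
        simp only [Finset.sum_insert hj]
        exact ((hu j).smul (ha j)).add ih
    simp only [Finset.sum_insert hi]
    have hi' : MDifferentiableAt I 𝓘(ℝ, F) (fun z => u i z • a i z) m := (hu i).smul (ha i)
    rw [mvfderiv_fun_add hi' hs, add_apply, ih, mvfderiv_fun_smul (hu i) (ha i)]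
    simp

variable [CompleteSpace E] [I.Boundaryless] [IsManifold I ∞ M]

/-- The Lie bracket of vector fields acts on vector-valued functions as the commutator, and the
derivative of a smooth function along a differentiable vector field is differentiable. -/
theorem mvfderiv_mlieBracket_aux {h : M → F} {X Y : ∀ x : M, TangentSpace I x} {m : M}
    (hh : ContMDiffAt I 𝓘(ℝ, F) ∞ h m)
    (hX : MDifferentiableAt I I.tangent (fun x => (⟨x, X x⟩ : TangentBundle I M)) m)
    (hY : MDifferentiableAt I I.tangent (fun x => (⟨x, Y x⟩ : TangentBundle I M)) m) :
    MDifferentiableAt I 𝓘(ℝ, F) (fun z => mvfderiv I h z (X z)) m ∧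
    mvfderiv I h m (mlieBracket I X Y m) =
      mvfderiv I (fun z => mvfderiv I h z (Y z)) m (X m) -
      mvfderiv I (fun z => mvfderiv I h z (X z)) m (Y m) := by
  have : IsManifold I 2 M := IsManifold.of_le (n := ∞) (by norm_cast)
  have : IsManifold I (minSmoothness ℝ 2) M := by
    rw [minSmoothness_of_isRCLikeNormedField]; infer_instance
  set φ := extChartAt I m with hφ
  set y₀ := φ m with hy₀
  -- The coordinate expression of a vector field: its pullback under the inverse of the chart at
  -- `m`.
  let hat : (∀ x : M, TangentSpace I x) → E → E := fun Z y =>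
    (mfderiv 𝓘(ℝ, E) I φ.symm y).inverse (Z (φ.symm y))
  have hsymm : φ.symm y₀ = m := extChartAt_to_inv m
  have htgt : φ.target ∈ 𝓝 y₀ := extChartAt_target_mem_nhds m
  have hsm : ContMDiffAt 𝓘(ℝ, E) I ∞ φ.symm y₀ :=
    (contMDiffOn_extChartAt_symm m).contMDiffAt htgt
  have hinv : ∀ y ∈ φ.target, (mfderiv 𝓘(ℝ, E) I φ.symm y).IsInvertible := by
    intro y hy
    have := isInvertible_mfderivWithin_extChartAt_symm (I := I) (x := m) hy
    rwa [I.range_eq_univ, mfderivWithin_univ] at this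
  have hd : ∀ Z : ∀ x : M, TangentSpace I x,
      MDifferentiableAt I I.tangent (fun x => (⟨x, Z x⟩ : TangentBundle I M)) m →
      DifferentiableAt ℝ (hat Z) y₀ := by
    intro Z hZ
    have h1 := (hZ.mdifferentiableWithinAt (s := univ)).differentiableWithinAt_mpullbackWithin_vectorField
    rw [I.range_eq_univ, VectorField.mpullbackWithin_univ, preimage_univ, inter_univ] at h1
    exact (differentiableWithinAt_univ (f := hat Z)).1 h1
  have hhat : ∀ Z, ∀ y ∈ φ.target, mfderiv 𝓘(ℝ, E) I φ.symm y (hat Z y) = Z (φ.symm y) := by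
    intro Z y hy
    exact (hinv y hy).self_apply_inverse (Z (φ.symm y))
  -- Brackets commute with pullback, so the bracket at `m` is the image of the bracket of the
  -- coordinate expressions, for which the formula in a vector space is available.
  have hA : mlieBracket I X Y m = mfderiv 𝓘(ℝ, E) I φ.symm y₀
      (fderiv ℝ (hat Y) y₀ (hat X y₀) - fderiv ℝ (hat X) y₀ (hat Y y₀)) := by
    have h1 := mpullback_mlieBracket (I := 𝓘(ℝ, E)) (I' := I) (f := φ.symm) (x₀ := y₀) (V := X)
      (W := Y) (n := ∞) (by rwa [hsymm]) (by rwa [hsymm]) hsm (by simp; norm_cast)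
    rw [← mlieBracketWithin_univ (I := 𝓘(ℝ, E)), mlieBracketWithin_eq_lieBracketWithin] at h1
    have h2 : (mfderiv 𝓘(ℝ, E) I φ.symm y₀).inverse (mlieBracket I X Y (φ.symm y₀)) =
      (fderiv ℝ (hat Y) y₀ (hat X y₀) - fderiv ℝ (hat X) y₀ (hat Y y₀) : E) := by
      refine h1.trans ?_
      exact congrFun (lieBracketWithin_univ (𝕜 := ℝ) (V := hat X) (W := hat Y)) y₀
    rw [← h2]
    have := (hinv y₀ (mem_of_mem_nhds htgt)).self_apply_inverse (mlieBracket I X Y (φ.symm y₀))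
    rw [this, hsymm]
  let k : E → F := fun y => h (φ.symm y)
  have hk : ContDiffAt ℝ ∞ k y₀ := by
    refine ContMDiffAt.contDiffAt (ContMDiffAt.comp y₀ ?_ hsm)
    rwa [hsymm]
  let G : (∀ x : M, TangentSpace I x) → E → F := fun Z y => fderiv ℝ k y (hat Z y)
  have hk' : DifferentiableAt ℝ (fderiv ℝ k) y₀ :=
    (hk.fderiv_right (m := 1) (by norm_cast)).differentiableAt (by simp)
  have hG : ∀ Z, DifferentiableAt ℝ (hat Z) y₀ → ∀ w, fderiv ℝ (G Z) y₀ w =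
      fderiv ℝ (fderiv ℝ k) y₀ w (hat Z y₀) + fderiv ℝ k y₀ (fderiv ℝ (hat Z) y₀ w) := by
    intro Z hZ w
    have := (hk'.hasFDerivAt.clm_apply hZ.hasFDerivAt).fderiv
    rw [this]
    simp [add_comm]
  have hGd : ∀ Z, DifferentiableAt ℝ (hat Z) y₀ → DifferentiableAt ℝ (G Z) y₀ := fun Z hZ =>
    (hk'.hasFDerivAt.clm_apply hZ.hasFDerivAt).differentiableAt
  have hhev : ∀ᶠ x in 𝓝 m, ContMDiffAt I 𝓘(ℝ, F) 1 h x :=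
    (contMDiffAt_iff_contMDiffAt_nhds (by simp)).1 (hh.of_le (by norm_cast))
  have hval : ∀ x ∈ φ.source, ContMDiffAt I 𝓘(ℝ, F) 1 h x → ∀ v : E,
      fderiv ℝ k (φ x) v = mvfderiv I h (φ.symm (φ x)) (mfderiv 𝓘(ℝ, E) I φ.symm (φ x) v) := by
    intro x hx hhx v
    have h1 : MDifferentiableAt 𝓘(ℝ, E) I φ.symm (φ x) :=
      ((contMDiffOn_extChartAt_symm (n := ∞) m).contMDiffAt
        ((isOpen_extChartAt_target m).mem_nhds (φ.map_source hx))).mdifferentiableAt (by simp)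
    have h2 := mvfderiv_fun_comp_apply (g := h) (f := φ.symm) (m := φ x) (v := v)
      (by rw [φ.left_inv hx]; exact hhx.mdifferentiableAt (by simp)) h1
    rw [← h2]
    exact congrArg (fun L : E →L[ℝ] F => L v) (mfderiv_eq_fderiv (f := k) (x := φ x)).symm
  have hsrc : ∀ᶠ x in 𝓝 m, x ∈ φ.source := extChartAt_source_mem_nhds m
  have hg : ∀ Z : ∀ x : M, TangentSpace I x,
      (fun x => mvfderiv I h x (Z x)) =ᶠ[𝓝 m] fun x => G Z (φ x) := by
    intro Z
    filter_upwards [hsrc, hhev] with x hx hhx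
    change _ = fderiv ℝ k (φ x) (hat Z (φ x))
    rw [hval x hx hhx, hhat Z _ (φ.map_source hx), φ.left_inv hx]
  have hφ' : MDifferentiableAt I 𝓘(ℝ, E) φ m :=
    (contMDiffAt_extChartAt (n := 1)).mdifferentiableAt (by simp)
  have hφhat : ∀ W : ∀ x : M, TangentSpace I x, mfderiv I 𝓘(ℝ, E) φ m (W m) = hat W y₀ := by
    intro W
    have h1 := mfderivWithin_extChartAt_symm_comp_mfderiv_extChartAt (I := I) (x := m)
      (mem_extChartAt_target m)
    rw [I.range_eq_univ, mfderivWithin_univ] at h1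
    have h2 : mfderiv 𝓘(ℝ, E) I φ.symm y₀ (mfderiv I 𝓘(ℝ, E) φ (φ.symm y₀) (W (φ.symm y₀))) =
      W (φ.symm y₀) := congrArg (fun L : E →L[ℝ] E => L (W (φ.symm y₀))) h1
    apply (hinv y₀ (mem_of_mem_nhds htgt)).injective
    rw [hhat W y₀ (mem_of_mem_nhds htgt), ← h2, hsymm]
  have hder : ∀ Z W : ∀ x : M, TangentSpace I x, DifferentiableAt ℝ (hat Z) y₀ →
      mvfderiv I (fun z => mvfderiv I h z (Z z)) m (W m) = fderiv ℝ (G Z) y₀ (hat W y₀) := by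
    intro Z W hZ
    rw [mvfderiv_congr (hg Z), mvfderiv_fun_comp_apply (f := fun x => φ x) (g := G Z) (hGd Z hZ).mdifferentiableAt hφ', hφhat]
    exact congrArg (fun L : E →L[ℝ] F => L (hat W y₀)) mfderiv_eq_fderiv
  refine ⟨MDifferentiableAt.congr_of_eventuallyEq (f₁ := fun z => mvfderiv I h z (X z))
    (f := fun x => G X (φ x)) (MDifferentiableAt.comp m
    (DifferentiableAt.mdifferentiableAt (hGd X (hd X hX))) hφ') (hg X), ?_⟩
  -- The second derivative of `h` contributes the same term to both iterated derivatives and cancels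
  -- in the commutator.
  have hsym : fderiv ℝ (fderiv ℝ k) y₀ (hat X y₀) (hat Y y₀) =
      fderiv ℝ (fderiv ℝ k) y₀ (hat Y y₀) (hat X y₀) :=
    (hk.isSymmSndFDerivAt (by simp; norm_cast)) _ _
  rw [hder Y X (hd Y hY), hder X Y (hd X hX), hG Y (hd Y hY), hG X (hd X hX), hA, hsym,
    add_sub_add_left_eq_sub, ← map_sub, hval m (mem_extChartAt_source m) hhev.self_of_nhds]
  rw [← hy₀, hsymm]
theorem mvfderiv_mlieBracket {h : M → F} {X Y : ∀ x : M, TangentSpace I x} {m : M}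
    (hh : ContMDiffAt I 𝓘(ℝ, F) ∞ h m)
    (hX : MDifferentiableAt I I.tangent (fun x => (⟨x, X x⟩ : TangentBundle I M)) m)
    (hY : MDifferentiableAt I I.tangent (fun x => (⟨x, Y x⟩ : TangentBundle I M)) m) :
    mvfderiv I h m (mlieBracket I X Y m) =
      mvfderiv I (fun z => mvfderiv I h z (Y z)) m (X m) -
      mvfderiv I (fun z => mvfderiv I h z (X z)) m (Y m) :=
  (mvfderiv_mlieBracket_aux hh hX hY).2

theorem mdifferentiableAt_mvfderiv_apply {h : M → F} {X : ∀ x : M, TangentSpace I x} {m : M}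
    (hh : ContMDiffAt I 𝓘(ℝ, F) ∞ h m)
    (hX : MDifferentiableAt I I.tangent (fun x => (⟨x, X x⟩ : TangentBundle I M)) m) :
    MDifferentiableAt I 𝓘(ℝ, F) (fun z => mvfderiv I h z (X z)) m :=
  (mvfderiv_mlieBracket_aux hh hX hX).1

variable {E' H' : Type*} [NormedAddCommGroup E'] [NormedSpace ℝ E'] [CompleteSpace E']
  [TopologicalSpace H'] {I' : ModelWithCorners ℝ E' H'} [I'.Boundaryless]
  {M' : Type*} [TopologicalSpace M'] [ChartedSpace H' M'] [IsManifold I' ∞ M']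

/-- The chart at `f m`, taken as a vector-valued function `φ`, has injective derivative there, so
both sides may be compared after applying `dφ`. Then brackets become commutators of derivatives: on
the source for `φ ∘ f`, on the target for `φ`. The product rule applied to `∑ uᵢ dφ(Tᵢ)` produces
the terms with derivatives of the coefficients. This is the bracket condition for Lie algebroid
morphisms in the case of vector fields. -/
theorem mfderiv_mlieBracket_of_sum {f : M → M'} {m : M} (hf : ContMDiffAt I I' ∞ f m)
    {X₁ X₂ : ∀ x : M, TangentSpace I x}
    (hX₁ : MDifferentiableAt I I.tangent (fun x => (⟨x, X₁ x⟩ : TangentBundle I M)) m)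
    (hX₂ : MDifferentiableAt I I.tangent (fun x => (⟨x, X₂ x⟩ : TangentBundle I M)) m)
    {ι : Type*} [Fintype ι] {T : ι → ∀ x : M', TangentSpace I' x}
    (hT : ∀ i, MDifferentiableAt I' I'.tangent (fun x => (⟨x, T i x⟩ : TangentBundle I' M')) (f m))
    {u₁ u₂ : ι → M → ℝ}
    (hu₁ : ∀ i, MDifferentiableAt I 𝓘(ℝ, ℝ) (u₁ i) m)
    (hu₂ : ∀ i, MDifferentiableAt I 𝓘(ℝ, ℝ) (u₂ i) m)
    (h₁ : ∀ᶠ z in 𝓝 m, mfderiv I I' f z (X₁ z) = ∑ i, u₁ i z • T i (f z))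
    (h₂ : ∀ᶠ z in 𝓝 m, mfderiv I I' f z (X₂ z) = ∑ i, u₂ i z • T i (f z)) :
    mfderiv I I' f m (mlieBracket I X₁ X₂ m) =
      ∑ i, ∑ j, (u₁ i m * u₂ j m) • mlieBracket I' (T i) (T j) (f m) +
      ∑ i, (mvfderiv I (u₂ i) m (X₁ m) - mvfderiv I (u₁ i) m (X₂ m)) • T i (f m) := by
  set φ := extChartAt I' (f m) with hφ
  have hφs : ContMDiffAt I' 𝓘(ℝ, E') ∞ φ (f m) := contMDiffAt_extChartAt
  have hinj : Injective (mvfderiv I' φ (f m)) :=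
    (isInvertible_mfderiv_extChartAt (I := I') (mem_extChartAt_source (f m))).injective
  let a : ι → M' → E' := fun i w => mvfderiv I' φ w (T i w)
  have ha : ∀ i, MDifferentiableAt I' 𝓘(ℝ, E') (a i) (f m) := fun i =>
    mdifferentiableAt_mvfderiv_apply hφs (hT i)
  have hfd : MDifferentiableAt I I' f m := hf.mdifferentiableAt (by simp)
  have hev1 : ∀ᶠ z in 𝓝 m, ContMDiffAt I I' 1 f z :=
    have : IsManifold I 1 M := IsManifold.of_le (n := ∞) (by norm_cast)
    have : IsManifold I' 1 M' := IsManifold.of_le (n := ∞) (by norm_cast)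
    (contMDiffAt_iff_contMDiffAt_nhds (by simp)).1 (hf.of_le (by norm_cast))
  have hev2 : ∀ᶠ z in 𝓝 m, f z ∈ φ.source :=
    hfd.continuousAt.eventually (extChartAt_source_mem_nhds (I := I') (f m))
  have hexp : ∀ (X : ∀ x : M, TangentSpace I x) (u : ι → M → ℝ),
      (∀ᶠ z in 𝓝 m, mfderiv I I' f z (X z) = ∑ i, u i z • T i (f z)) →
      (fun z => mvfderiv I (fun z => φ (f z)) z (X z)) =ᶠ[𝓝 m]
        fun z => ∑ i, u i z • a i (f z) := by
    intro X u h
    filter_upwards [h, hev1, hev2] with z hz hfz hzs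
    rw [mvfderiv_fun_comp_apply (g := φ) (f := f)
      ((contMDiffAt_extChartAt' (n := 1) (by rwa [← extChartAt_source I'])).mdifferentiableAt (by simp))
      (hfz.mdifferentiableAt (by simp)), hz, map_sum]
    simp only [map_smul]
    rfl
  have hder : ∀ (X Y : ∀ x : M, TangentSpace I x) (u v : ι → M → ℝ),
      (∀ i, MDifferentiableAt I 𝓘(ℝ, ℝ) (u i) m) →
      (∀ᶠ z in 𝓝 m, mfderiv I I' f z (X z) = ∑ i, u i z • T i (f z)) →
      (∀ᶠ z in 𝓝 m, mfderiv I I' f z (Y z) = ∑ i, v i z • T i (f z)) →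
      mvfderiv I (fun z => mvfderiv I (fun z => φ (f z)) z (X z)) m (Y m) =
      ∑ i, (u i m • ∑ j, v j m • mvfderiv I' (a i) (f m) (T j (f m)) +
        mvfderiv I (u i) m (Y m) • a i (f m)) := by
    intro X Y u v hu hX hY
    rw [mvfderiv_congr (hexp X u hX),
      mvfderiv_sum_smul (a := fun i z => a i (f z)) _ hu (fun i => (ha i).comp m hfd)]
    refine Finset.sum_congr rfl fun i _ => ?_
    rw [mvfderiv_fun_comp_apply (ha i) hfd, hY.self_of_nhds, map_sum]
    simp only [map_smul]
  apply hinj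
  rw [← mvfderiv_fun_comp_apply (hφs.mdifferentiableAt (by simp)) hfd,
    mvfderiv_mlieBracket (h := fun z => φ (f z)) (hφs.comp m hf) hX₁ hX₂, hder X₂ X₁ u₂ u₁ hu₂ h₂ h₁,
    hder X₁ X₂ u₁ u₂ hu₁ h₁ h₂]
  simp only [map_add, map_sum, map_smul]
  have hb : ∀ i j, mvfderiv I' φ (f m) (mlieBracket I' (T i) (T j) (f m)) =
      mvfderiv I' (a j) (f m) (T i (f m)) - mvfderiv I' (a i) (f m) (T j (f m)) := fun i j =>
    mvfderiv_mlieBracket hφs (hT i) (hT j)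
  simp only [hb, smul_sub, sub_smul, Finset.sum_add_distrib, Finset.sum_sub_distrib, Finset.smul_sum,
    smul_smul]
  rw [Finset.sum_comm (f := fun i j => (u₁ i m * u₂ j m) • mvfderiv I' (a j) (f m) (T i (f m)))]
  have : ∀ i j, u₂ i m * u₁ j m = u₁ j m * u₂ i m := fun i j => mul_comm _ _
  simp only [this]
  change _ = _ + (∑ i, _ • a i (f m) - ∑ i, _ • a i (f m))
  abel

/-- The Lie brackets of related vector fields are related. -/
theorem mfderiv_mlieBracket_of_related {f : M → M'} {m : M} (hf : ContMDiffAt I I' ∞ f m)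
    {X₁ X₂ : ∀ x : M, TangentSpace I x} {Y₁ Y₂ : ∀ x : M', TangentSpace I' x}
    (hX₁ : MDifferentiableAt I I.tangent (fun x => (⟨x, X₁ x⟩ : TangentBundle I M)) m)
    (hX₂ : MDifferentiableAt I I.tangent (fun x => (⟨x, X₂ x⟩ : TangentBundle I M)) m)
    (hY₁ : MDifferentiableAt I' I'.tangent (fun x => (⟨x, Y₁ x⟩ : TangentBundle I' M')) (f m))
    (hY₂ : MDifferentiableAt I' I'.tangent (fun x => (⟨x, Y₂ x⟩ : TangentBundle I' M')) (f m))
    (h₁ : ∀ᶠ z in 𝓝 m, mfderiv I I' f z (X₁ z) = Y₁ (f z))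
    (h₂ : ∀ᶠ z in 𝓝 m, mfderiv I I' f z (X₂ z) = Y₂ (f z)) :
    mfderiv I I' f m (mlieBracket I X₁ X₂ m) = mlieBracket I' Y₁ Y₂ (f m) := by
  -- The family is `(Y₁, Y₂)` with constant coefficients `(1, 0)` and `(0, 1)`: the derivative terms
  -- vanish and only the bracket of `Y₁` with `Y₂` survives.
  have := mfderiv_mlieBracket_of_sum hf hX₁ hX₂ (T := ![Y₁, Y₂])
    (by intro i; fin_cases i <;> assumption) (u₁ := ![fun _ => 1, fun _ => 0])
    (u₂ := ![fun _ => 0, fun _ => 1])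
    (by intro i; fin_cases i <;> exact mdifferentiableAt_const)
    (by intro i; fin_cases i <;> exact mdifferentiableAt_const)
    (by simpa using! h₁) (by simpa using! h₂)
  rw [this]
  simp [mvfderiv_const]

end
end VectorField

/-! ### Germs of smooth maps, their tangent maps, and lifts as germs -/

section

variable {E₁ H₁ E₂ H₂ E₃ H₃ : Type*}
  [NormedAddCommGroup E₁] [NormedSpace ℝ E₁] [TopologicalSpace H₁]
  [NormedAddCommGroup E₂] [NormedSpace ℝ E₂] [TopologicalSpace H₂]
  [NormedAddCommGroup E₃] [NormedSpace ℝ E₃] [TopologicalSpace H₃]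
  {M₁ M₂ M₃ : Type*}
  [TopologicalSpace M₁] [ChartedSpace H₁ M₁]
  [TopologicalSpace M₂] [ChartedSpace H₂ M₂]
  [TopologicalSpace M₃] [ChartedSpace H₃ M₃]
  {I₁ : ModelWithCorners ℝ E₁ H₁} {I₂ : ModelWithCorners ℝ E₂ H₂} {I₃ : ModelWithCorners ℝ E₃ H₃}

variable (I₁ I₂) in
/-- Smoothness in a neighbourhood of a point. -/
def SmoothNear (f : M₁ → M₂) (x : M₁) : Prop := ∀ᶠ z in 𝓝 x, ContMDiffAt I₁ I₂ ∞ f z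

theorem SmoothNear.contMDiffAt {f : M₁ → M₂} {x : M₁} (h : SmoothNear I₁ I₂ f x) :
    ContMDiffAt I₁ I₂ ∞ f x := h.self_of_nhds

theorem SmoothNear.mdifferentiableAt {f : M₁ → M₂} {x : M₁} (h : SmoothNear I₁ I₂ f x) :
    MDifferentiableAt I₁ I₂ f x := h.contMDiffAt.mdifferentiableAt (by simp)

theorem SmoothNear.continuousAt {f : M₁ → M₂} {x : M₁} (h : SmoothNear I₁ I₂ f x) :
    ContinuousAt f x := h.contMDiffAt.continuousAt

theorem SmoothNear.eventually {f : M₁ → M₂} {x : M₁} (h : SmoothNear I₁ I₂ f x) :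
    ∀ᶠ z in 𝓝 x, SmoothNear I₁ I₂ f z := eventually_eventually_nhds.2 h

theorem SmoothNear.comp {g : M₂ → M₃} {f : M₁ → M₂} {x : M₁} (hg : SmoothNear I₂ I₃ g (f x))
    (hf : SmoothNear I₁ I₂ f x) : SmoothNear I₁ I₃ (fun z => g (f z)) x := by
  filter_upwards [hf, hf.continuousAt.eventually hg] with z h1 h2 using h2.comp z h1

theorem SmoothNear.comp_of_eq {g : M₂ → M₃} {f : M₁ → M₂} {x : M₁} {y : M₂}
    (hg : SmoothNear I₂ I₃ g y) (hf : SmoothNear I₁ I₂ f x) (h : f x = y) :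
    SmoothNear I₁ I₃ (fun z => g (f z)) x := by
  subst h; exact hg.comp hf

theorem SmoothNear.prodMk {f : M₁ → M₂} {g : M₁ → M₃} {x : M₁} (hf : SmoothNear I₁ I₂ f x)
    (hg : SmoothNear I₁ I₃ g x) : SmoothNear I₁ (I₂.prod I₃) (fun z => (f z, g z)) x := by
  filter_upwards [hf, hg] with z h1 h2 using h1.prodMk h2

theorem ContMDiff.smoothNear {f : M₁ → M₂} (h : ContMDiff I₁ I₂ ∞ f) (x : M₁) :
    SmoothNear I₁ I₂ f x := Filter.Eventually.of_forall h

theorem ContMDiffOn.smoothNear {f : M₁ → M₂} {U : Set M₁} (h : ContMDiffOn I₁ I₂ ∞ f U)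
    (hU : IsOpen U) {x : M₁} (hx : x ∈ U) : SmoothNear I₁ I₂ f x := by
  filter_upwards [hU.mem_nhds hx] with z hz using h.contMDiffAt (hU.mem_nhds hz)

theorem smoothNear_const (c : M₂) (x : M₁) : SmoothNear I₁ I₂ (fun _ => c) x :=
  contMDiff_const.smoothNear x

theorem smoothNear_id (x : M₁) : SmoothNear I₁ I₁ (fun z => z) x := contMDiff_id.smoothNear x

theorem SmoothNear.snd {f : M₁ → M₂ × M₃} {x : M₁} (h : SmoothNear I₁ (I₂.prod I₃) f x) :
    SmoothNear I₁ I₃ (fun z => (f z).2) x := (contMDiff_snd.smoothNear _).comp h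

theorem tangentMap_congr_of_eventuallyEq {f g : M₁ → M₂} {a : TangentBundle I₁ M₁}
    (h : f =ᶠ[𝓝 a.proj] g) : tangentMap I₁ I₂ f a = tangentMap I₁ I₂ g a := by
  obtain ⟨x, v⟩ := a
  have h1 : f x = g x := h.self_of_nhds
  have h2 : mfderiv I₁ I₂ f x = mfderiv I₁ I₂ g x := h.mfderiv_eq
  simp only [tangentMap]
  exact Bundle.TotalSpace.ext h1 (heq_of_eq (congrArg (fun L : E₁ →L[ℝ] E₂ => L v) h2))

theorem tangentMap_fun_comp {f : M₁ → M₂} {g : M₂ → M₃} (a : TangentBundle I₁ M₁)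
    (hg : MDifferentiableAt I₂ I₃ g (f a.proj)) (hf : MDifferentiableAt I₁ I₂ f a.proj) :
    tangentMap I₁ I₃ (fun z => g (f z)) a = tangentMap I₂ I₃ g (tangentMap I₁ I₂ f a) :=
  tangentMap_comp_at a hg hf

/-- The derivative of a smooth family of maps, applied to a smooth family of tangent vectors. -/
theorem contMDiffAt_tangentMap_param [IsManifold I₁ ∞ M₁] [IsManifold I₃ ∞ M₃]
    {E H : Type*} [NormedAddCommGroup E] [NormedSpace ℝ E] [TopologicalSpace H]
    {J : ModelWithCorners ℝ E H} {T : Type*} [TopologicalSpace T] [ChartedSpace H T]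
    [IsManifold J ∞ T]
    {g : M₁ × M₂ → M₃} {V : T → TangentBundle I₁ M₁} {c : T → M₂} {t₀ : T}
    (hg : ContMDiffAt (I₁.prod I₂) I₃ ∞ g ((V t₀).proj, c t₀))
    (hV : ContMDiffAt J I₁.tangent ∞ V t₀) (hc : ContMDiffAt J I₂ ∞ c t₀) :
    ContMDiffAt J I₃.tangent ∞ (fun t => tangentMap I₁ I₃ (fun z => g (z, c t)) (V t)) t₀ := by
  have hb₁ : ContMDiffAt J I₁ ∞ (fun t => (V t).proj) t₀ :=
    (Bundle.contMDiff_proj (TangentSpace I₁)).contMDiffAt.comp t₀ hV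
  have hb₂ : ContMDiffAt J I₃ ∞ (fun t => g ((V t).proj, c t)) t₀ :=
    hg.comp t₀ (hb₁.prodMk hc)
  have hf : ContMDiffAt (J.prod I₁) I₃ ∞ (uncurry (fun (t : T) (z : M₁) => g (z, c t)))
      (t₀, (V t₀).proj) := by
    have h1 : ContMDiffAt (J.prod I₁) (I₁.prod I₂) ∞ (fun p : T × M₁ => (p.2, c p.1))
        (t₀, (V t₀).proj) := contMDiffAt_snd.prodMk
      (ContMDiffAt.comp (t₀, (V t₀).proj) (g := c) (f := Prod.fst) hc contMDiffAt_fst)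
    exact ContMDiffAt.comp (t₀, (V t₀).proj) (g := g) hg h1
  -- The derivative in the first variable, taken at the moving point `(V t).proj`, is a smooth
  -- family of linear maps when read in trivializations; it is then applied to the vector parts of
  -- `V`.
  have hϕ := ContMDiffAt.mfderiv (m := ∞) (n := ∞) (fun (t : T) (z : M₁) => g (z, c t))
    (fun t => (V t).proj) hf hb₁ (by norm_cast)
  exact ContMDiffAt.clm_apply_of_inCoordinates (b₁ := fun t => (V t).proj)
    (b₂ := fun t => g ((V t).proj, c t)) (v := fun t => (V t).2)
    (ϕ := fun t => mfderiv I₁ I₃ (fun z => g (z, c t)) (V t).proj) hϕ hV hb₂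

end

section

variable {E₁ H₁ E₂ H₂ : Type}
  [NormedAddCommGroup E₁] [NormedSpace ℝ E₁] [TopologicalSpace H₁]
  [NormedAddCommGroup E₂] [NormedSpace ℝ E₂] [TopologicalSpace H₂]
  {M₁ M₂ S₁ S₂ : Type u}
  [TopologicalSpace M₁] [ChartedSpace H₁ M₁]
  [TopologicalSpace M₂] [ChartedSpace H₂ M₂]
  {I₁ : ModelWithCorners ℝ E₁ H₁} {I₂ : ModelWithCorners ℝ E₂ H₂}
  {q₁ : M₁ → S₁} {q₂ : M₂ → S₂} {f : S₁ → S₂}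

theorem QSmoothOn.exists_lift {s : Set S₁} (hf : QSmoothOn I₁ I₂ q₁ q₂ f s) {x : M₁} {y : M₂}
    (hx : q₁ x ∈ s) (h : f (q₁ x) = q₂ y) :
    ∃ g : M₁ → M₂, g x = y ∧ SmoothNear I₁ I₂ g x ∧ ∀ᶠ z in 𝓝 x, q₁ z ∈ s ∧ q₂ (g z) = f (q₁ z) := by
  obtain ⟨U, g, hU, hxU, hs, hg, hgx, hl⟩ := hf x y hx h
  refine ⟨g, hgx, hg.smoothNear hU hxU, ?_⟩
  filter_upwards [hU.mem_nhds hxU] with z hz using ⟨hs hz, hl z hz⟩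

theorem QSmooth.exists_lift (hf : QSmooth I₁ I₂ q₁ q₂ f) {x : M₁} {y : M₂} (h : f (q₁ x) = q₂ y) :
    ∃ g : M₁ → M₂, g x = y ∧ SmoothNear I₁ I₂ g x ∧ ∀ᶠ z in 𝓝 x, q₂ (g z) = f (q₁ z) := by
  obtain ⟨g, h1, h2, h3⟩ := QSmoothOn.exists_lift hf (mem_univ _) h
  exact ⟨g, h1, h2, h3.mono fun _ h => h.2⟩

end

/-! ### Rigidity of lifts and tangent vectors of a Q-manifold -/

namespace QManifold

section

variable {E H : Type} [NormedAddCommGroup E] [NormedSpace ℝ E] [FiniteDimensional ℝ E]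
  [TopologicalSpace H] {J : ModelWithCorners ℝ E H} [J.Boundaryless]
  {T : Type u} [TopologicalSpace T] [ChartedSpace H T] [IsManifold J ∞ T] [T2Space T]

/-- Condition (b) of a Q-chart in terms of germs. It replaces injectivity of the atlas, which fails:
equality in the quotient together with equality at one point gives equality nearby. -/
theorem eventuallyEq_of_chart_eq (S : QManifold.{u}) {f g : T → S.atlas} {t : T}
    (hf : SmoothNear J (𝓡 S.atlas.dim) f t) (hg : SmoothNear J (𝓡 S.atlas.dim) g t)
    (hfg : ∀ᶠ z in 𝓝 t, S.chart (f z) = S.chart (g z)) (h : f t = g t) : f =ᶠ[𝓝 t] g := by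
  obtain ⟨U, hUs, hU, htU⟩ := mem_nhds_iff.1 (hf.and (hg.and hfg))
  exact S.eventuallyEq_of_lift hU htU (fun z hz => (hUs hz).1.contMDiffWithinAt)
    (fun z hz => (hUs hz).2.1.contMDiffWithinAt) (fun z hz => (hUs hz).2.2) h

/-- The class in `TS` of a tangent vector of the atlas. -/
def tcls (S : QManifold.{u}) (a : TangentBundle (𝓡 S.atlas.dim) S.atlas) : S.TS := S.tmk a.proj a.2

end

theorem Smooth.tmap_tcls {S S' : QManifold.{u}} {f : S → S'} (hf : S.Smooth S' f)
    {g : S.atlas → S'.atlas} (a : TangentBundle (𝓡 S.atlas.dim) S.atlas)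
    (hg : SmoothNear (𝓡 S.atlas.dim) (𝓡 S'.atlas.dim) g a.proj)
    (hl : ∀ᶠ z in 𝓝 a.proj, S'.chart (g z) = f (S.chart z)) :
    hf.tmap (S.tcls a) = S'.tcls (tangentMap (𝓡 S.atlas.dim) (𝓡 S'.atlas.dim) g a) := by
  obtain ⟨U, hUs, hU, htU⟩ := mem_nhds_iff.1 (hg.and hl)
  exact hf.tmap_tmk a.2 hU htU (fun z hz => (hUs hz).1.contMDiffWithinAt) (fun z hz => (hUs hz).2)

theorem exists_tcls_eq (S : QManifold.{u}) (w : S.TS) : ∃ a, S.tcls a = w :=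
  S.tind (p := fun w => ∃ a, S.tcls a = w) (fun x v => ⟨⟨x, v⟩, rfl⟩) w

/-- A local transformation over `S` that fixes a point lifts the same map as the identity, so by
rigidity it is the identity near that point and acts trivially on the tangent space there. -/
theorem tcls_injective_of_proj_eq (S : QManifold.{u})
    {a b : TangentBundle (𝓡 S.atlas.dim) S.atlas} (h : S.tcls a = S.tcls b) (hp : a.proj = b.proj) :
    a = b := by
  obtain ⟨U, g, hU, haU, hg, hl, hb⟩ := (Quotient.exact h : S.TangentRel a b)
  replace hb : tangentMap (𝓡 S.atlas.dim) (𝓡 S.atlas.dim) g a = b := hb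
  have h1 : g =ᶠ[𝓝 a.proj] fun z => z := by
    refine S.eventuallyEq_of_chart_eq (hg.smoothNear hU haU) (smoothNear_id _) ?_ ?_
    · filter_upwards [hU.mem_nhds haU] with z hz using hl z hz
    · exact (congrArg (fun c : TangentBundle (𝓡 S.atlas.dim) S.atlas => c.proj) hb).trans hp.symm
  rw [← hb, tangentMap_congr_of_eventuallyEq h1]
  have := congrFun (tangentMap_id (I := 𝓡 S.atlas.dim) (M := S.atlas)) a
  exact this.symm

theorem tmk_injective (S : QManifold.{u}) {x : S.atlas} {v w : S.atlas.T x}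
    (h : S.tmk x v = S.tmk x w) : v = w := by
  have := S.tcls_injective_of_proj_eq (a := ⟨x, v⟩) (b := ⟨x, w⟩) h rfl
  exact Bundle.TotalSpace.mk_inj.1 this

theorem Smooth.tmap_injective {S S' : QManifold.{u}} {f : S → S'} {f' : S' → S}
    (hf : S.Smooth S' f) (hf' : S'.Smooth S f') (h : ∀ s, f' (f s) = s) : Injective hf.tmap := by
  intro v w hvw
  have hc : S.Smooth S (fun s => f' (f s)) := hf'.comp hf S'.surjective
  have key : ∀ v, hf'.tmap (hf.tmap v) = v := by
    intro v
    rw [← hf'.tmap_comp hf hc, hc.tmap_congr S.smooth_id (funext h), Smooth.tmap_id]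
  rw [← key v, ← key w, hvw]

end QManifold

section

variable {E₁ H₁ E₂ H₂ E₃ H₃ : Type*}
  [NormedAddCommGroup E₁] [NormedSpace ℝ E₁] [TopologicalSpace H₁]
  [NormedAddCommGroup E₂] [NormedSpace ℝ E₂] [TopologicalSpace H₂]
  [NormedAddCommGroup E₃] [NormedSpace ℝ E₃] [TopologicalSpace H₃]
  {M₁ M₂ M₃ : Type*}
  [TopologicalSpace M₁] [ChartedSpace H₁ M₁]
  [TopologicalSpace M₂] [ChartedSpace H₂ M₂]
  [TopologicalSpace M₃] [ChartedSpace H₃ M₃]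
  {I₁ : ModelWithCorners ℝ E₁ H₁} {I₂ : ModelWithCorners ℝ E₂ H₂} {I₃ : ModelWithCorners ℝ E₃ H₃}

theorem equivTangentBundleProd_tangentMap_prodMk {f : M₁ → M₂} {g : M₁ → M₃}
    (a : TangentBundle I₁ M₁) (hf : MDifferentiableAt I₁ I₂ f a.proj)
    (hg : MDifferentiableAt I₁ I₃ g a.proj) :
    equivTangentBundleProd I₂ M₂ I₃ M₃ (tangentMap I₁ (I₂.prod I₃) (fun z => (f z, g z)) a) =
      (tangentMap I₁ I₂ f a, tangentMap I₁ I₃ g a) := by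
  have h := congrArg (fun L : E₁ →L[ℝ] E₂ × E₃ => L a.2) (mfderiv_prodMk hf hg)
  refine Prod.ext ?_ ?_
  · exact Bundle.TotalSpace.ext rfl (heq_of_eq (congrArg Prod.fst h))
  · exact Bundle.TotalSpace.ext rfl (heq_of_eq (congrArg Prod.snd h))

end

/-! ### Local sections and smooth division in a Q-principal bundle -/

namespace QPrincipalBundle

variable (P : QPrincipalBundle.{u})

/-- The composition of the atlas of the total space with the bundle projection. -/
abbrev bp (m : P.total.atlas) : P.base := P.proj (P.total.chart m)

/-- The atlas of the base is the identity map, so a local lift of the projection is the composite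
itself. -/
theorem bp_smooth : ContMDiff (𝓡 P.total.atlas.dim) (𝓡 P.base.dim) ∞ P.bp := by
  intro m
  obtain ⟨g, -, hg, hl⟩ := P.proj_smooth.exists_lift (x := m) (y := P.bp m) rfl
  exact hg.contMDiffAt.congr_of_eventuallyEq (hl.mono fun z hz => hz.symm)

theorem exists_act_of_bp_eq {m m' : P.total.atlas} (h : P.bp m = P.bp m') :
    ∃ e : P.group.atlas, P.total.chart m' = P.act (P.total.chart m) (P.group.chart e) := by
  obtain ⟨g, hg⟩ := (P.fiber_eq_orbit (P.total.chart m) (P.total.chart m')).1 h.symm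
  obtain ⟨e, rfl⟩ := P.group.surjective g
  exact ⟨e, hg⟩

/-- Locally there is an equivariant Q-smooth map to the structure group. -/
theorem exists_equivariant (n : P.base) : ∃ U : Set P.base, IsOpen U ∧ n ∈ U ∧
    ∃ χ : P.total → P.group, (∀ p, P.proj p ∈ U → ∀ g, χ (P.act p g) = χ p * g) ∧
      ∀ m, P.bp m ∈ U → ∀ e, P.group.chart e = χ (P.total.chart m) →
        ∃ κ : P.total.atlas → P.group.atlas, κ m = e ∧
          SmoothNear (𝓡 P.total.atlas.dim) (𝓡 P.group.atlas.dim) κ m ∧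
          ∀ᶠ z in 𝓝 m, P.group.chart (κ z) = χ (P.total.chart z) := by
  obtain ⟨U, hU, hn, ψ, ψ', hψ, hψ', hinv, hs, hs', h1, h2⟩ := P.locally_trivial n
  refine ⟨U, hU, hn, fun p => (ψ p).2, fun p hp g => congrArg Prod.snd (h2 p hp g), fun m hm e he => ?_⟩
  obtain ⟨g, hg, hgs, hl⟩ := hs.exists_lift (x := m) (y := ((ψ (P.total.chart m)).1, e)) hm
    (Prod.ext rfl he.symm)
  refine ⟨fun z => (g z).2, congrArg Prod.snd hg, hgs.snd, hl.mono fun z hz => ?_⟩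
  exact congrArg Prod.snd hz.2

/-- There are local smooth sections of the bundle projection through every point of the atlas. -/
theorem exists_section (m : P.total.atlas) : ∃ s : P.base → P.total.atlas, s (P.bp m) = m ∧
    SmoothNear (𝓡 P.base.dim) (𝓡 P.total.atlas.dim) s (P.bp m) ∧
    ∀ᶠ n in 𝓝 (P.bp m), P.bp (s n) = n := by
  obtain ⟨U, hU, hn, ψ, ψ', hψ, hψ', hinv, hs, hs', h1, h2⟩ := P.locally_trivial (P.bp m)
  obtain ⟨e, he⟩ := P.group.surjective (ψ (P.total.chart m)).2
  have hm : (P.bp m, P.group.chart e) = ψ (P.total.chart m) := Prod.ext (h1 _ hn).symm he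
  -- The inverse trivialization sends the class of `(bp m, e)` to the class of `m`, so a lift can be
  -- made to pass through `m`. Its restriction to the slice with second component `e` is the
  -- section.
  obtain ⟨g, hg, hgs, hl⟩ := hs'.exists_lift (x := (P.bp m, e)) (y := m) ⟨hn, mem_univ _⟩
    ((congrArg ψ' hm).trans (hinv.1 hn))
  refine ⟨fun n => g (n, e), hg, SmoothNear.comp (f := fun n => (n, e)) hgs
    ((smoothNear_id _).prodMk (smoothNear_const _ _)), ?_⟩
  have hc : ContinuousAt (fun n : P.base => (n, e)) (P.bp m) := by fun_prop
  filter_upwards [hc.eventually hl] with n hn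
  rw [bp, hn.2]
  have h3 : Prod.map (fun n : P.base => n) P.group.chart (n, e) ∈ U ×ˢ univ := hn.1
  rw [← h1 _ (hψ' h3), hinv.2 h3]
  rfl

variable {P}

/-- The element of the group that carries one of two smooth maps over the base to the other one
depends smoothly on the parameter. -/
theorem exists_division {T : SmoothMfd.{u}} {a b : T → P.total.atlas} {t : T}
    (ha : SmoothNear (𝓡 T.dim) (𝓡 P.total.atlas.dim) a t)
    (hb : SmoothNear (𝓡 T.dim) (𝓡 P.total.atlas.dim) b t)
    (hab : ∀ᶠ z in 𝓝 t, P.bp (a z) = P.bp (b z)) {e : P.group.atlas}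
    (he : P.total.chart (b t) = P.act (P.total.chart (a t)) (P.group.chart e)) :
    ∃ γ : T → P.group.atlas, γ t = e ∧ SmoothNear (𝓡 T.dim) (𝓡 P.group.atlas.dim) γ t ∧
      ∀ᶠ z in 𝓝 t, P.total.chart (b z) = P.act (P.total.chart (a z)) (P.group.chart (γ z)) := by
  obtain ⟨U, hU, htU, χ, hχ, hlift⟩ := P.exists_equivariant (P.bp (a t))
  obtain ⟨ea, hea⟩ := P.group.surjective (χ (P.total.chart (a t)))
  obtain ⟨eb, heb⟩ := P.group.surjective (χ (P.total.chart (b t)))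
  obtain ⟨κa, ka1, ka2, ka3⟩ := hlift (a t) htU ea hea
  obtain ⟨κb, kb1, kb2, kb3⟩ := hlift (b t) (by rw [← hab.self_of_nhds]; exact htU) eb heb
  -- By equivariance of `χ` the dividing element is `χ(a)⁻¹ χ(b)`. Inversion and multiplication are
  -- lifted one after the other; the value of the last lift at the base point is free within its
  -- fibre and is taken to be `e`.
  obtain ⟨ia, hia⟩ := P.group.surjective (χ (P.total.chart (a t)))⁻¹
  obtain ⟨ι, i1, i2, i3⟩ := P.group.smooth_inv.exists_lift (x := ea) (y := ia) (by rw [hia, hea])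
  obtain ⟨μ, m1, m2, m3⟩ := P.group.smooth_mul.exists_lift (x := (ia, eb)) (y := e) (by
    simp only [Prod.map_apply, hia, heb, he]
    rw [hχ _ htU, inv_mul_cancel_left])
  have s1 : SmoothNear (𝓡 T.dim) (𝓡 P.group.atlas.dim) (fun z => κa (a z)) t := ka2.comp ha
  have s2 : SmoothNear (𝓡 T.dim) (𝓡 P.group.atlas.dim) (fun z => ι (κa (a z))) t :=
    i2.comp_of_eq s1 ka1
  have s3 := s2.prodMk (kb2.comp hb)
  refine ⟨fun z => μ (ι (κa (a z)), κb (b z)), by simp only [ka1, i1, kb1, m1],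
    m2.comp_of_eq s3 (by rw [ka1, i1, kb1]), ?_⟩
  have e1 : ∀ᶠ z in 𝓝 t, P.bp (a z) ∈ U :=
    (P.bp_smooth.continuous.continuousAt.comp ha.continuousAt).eventually (hU.mem_nhds htU)
  have e2 : Filter.Tendsto (fun z => κa (a z)) (𝓝 t) (𝓝 ea) := by
    have := s1.continuousAt; rwa [ContinuousAt, ka1] at this
  have e3 : Filter.Tendsto (fun z => (ι (κa (a z)), κb (b z))) (𝓝 t) (𝓝 (ia, eb)) := by
    have := s3.continuousAt; rwa [ContinuousAt, ka1, i1, kb1] at this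
  filter_upwards [e1, hab, ha.continuousAt.eventually ka3, hb.continuousAt.eventually kb3,
    e2.eventually i3, e3.eventually m3] with z h1 h2 h3 h4 h5 h6
  obtain ⟨g, hg⟩ := P.exists_act_of_bp_eq h2
  rw [h6]
  simp only [Prod.map_apply]
  rw [h5, h3, h4, hg, hχ _ h1, inv_mul_cancel_left]

/-- Two smooth maps over the base are related by a smooth family of local right translations. -/
theorem exists_transport {T : SmoothMfd.{u}} {a b : T → P.total.atlas} {t : T}
    (ha : SmoothNear (𝓡 T.dim) (𝓡 P.total.atlas.dim) a t)
    (hb : SmoothNear (𝓡 T.dim) (𝓡 P.total.atlas.dim) b t)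
    (hab : ∀ᶠ z in 𝓝 t, P.bp (a z) = P.bp (b z)) :
    ∃ (R : P.total.atlas × P.group.atlas → P.total.atlas) (γ : T → P.group.atlas),
      SmoothNear (𝓡 T.dim) (𝓡 P.group.atlas.dim) γ t ∧
      SmoothNear ((𝓡 P.total.atlas.dim).prod (𝓡 P.group.atlas.dim)) (𝓡 P.total.atlas.dim) R
        (a t, γ t) ∧
      (∀ᶠ x in 𝓝 (a t, γ t), P.total.chart (R x) = P.act (P.total.chart x.1) (P.group.chart x.2)) ∧
      ∀ᶠ z in 𝓝 t, R (a z, γ z) = b z := by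
  obtain ⟨e, he⟩ := P.exists_act_of_bp_eq hab.self_of_nhds
  obtain ⟨γ, rfl, hγ, hγl⟩ := exists_division ha hb hab he
  obtain ⟨R, r1, r2, r3⟩ := P.act_smooth.exists_lift (x := (a t, γ t)) (y := b t) he.symm
  refine ⟨R, γ, hγ, r2, r3, ?_⟩
  have hc := ha.prodMk hγ
  -- `R (a, γ)` and `b` lift the same map and agree at `t`, so rigidity turns equality in `P` into
  -- equality in the atlas.
  refine P.total.eventuallyEq_of_chart_eq (r2.comp_of_eq hc rfl) hb ?_ r1
  filter_upwards [hγl, hc.continuousAt.eventually r3] with z h1 h2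
  rw [h1, h2]
  rfl

/-! ### Tangent vectors modulo the group -/

variable (P) in
/-- The class in `(TP)/G` of a tangent vector of the atlas. -/
def bcls (a : TangentBundle (𝓡 P.total.atlas.dim) P.total.atlas) : P.Atiyah :=
  P.quotTP (P.total.tcls a)

theorem tact_one (v : P.total.TS) : P.tact v 1 = v := by
  rw [tact, (P.act_smooth_left 1).tmap_congr P.total.smooth_id (funext P.act_one),
    QManifold.Smooth.tmap_id]

theorem tact_mul (v : P.total.TS) (g h : P.group) : P.tact v (g * h) = P.tact (P.tact v g) h := by
  have hc : P.total.Smooth P.total (fun p => P.act (P.act p g) h) :=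
    (P.act_smooth_left h).comp (P.act_smooth_left g) P.total.surjective
  rw [tact, tact, tact, ← (P.act_smooth_left h).tmap_comp (P.act_smooth_left g) hc]
  exact QManifold.Smooth.tmap_congr _ _ (funext fun p => P.act_mul p g h) _

/-- The generating relation comes from a group action, so it is already an equivalence relation. -/
theorem quotTP_eq_iff {v w : P.total.TS} : P.quotTP v = P.quotTP w ↔ ∃ g, w = P.tact v g := by
  constructor
  · intro h
    have hr := Quot.eqvGen_exact h
    clear h
    induction hr with
    | rel _ _ h => exact h
    | refl x => exact ⟨1, (tact_one x).symm⟩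
    | symm x y _ ih =>
      obtain ⟨g, rfl⟩ := ih
      exact ⟨g⁻¹, by rw [← tact_mul, mul_inv_cancel, tact_one]⟩
    | trans x y z _ _ ih₁ ih₂ =>
      obtain ⟨g, rfl⟩ := ih₁
      obtain ⟨k, rfl⟩ := ih₂
      exact ⟨g * k, (tact_mul _ _ _).symm⟩
  · rintro ⟨g, rfl⟩
    exact Quot.sound ⟨g, rfl⟩

theorem bcls_tangentMap {h : P.total.atlas → P.total.atlas} {g : P.group}
    (a : TangentBundle (𝓡 P.total.atlas.dim) P.total.atlas)
    (hh : SmoothNear (𝓡 P.total.atlas.dim) (𝓡 P.total.atlas.dim) h a.proj)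
    (hl : ∀ᶠ z in 𝓝 a.proj, P.total.chart (h z) = P.act (P.total.chart z) g) :
    P.bcls (tangentMap (𝓡 P.total.atlas.dim) (𝓡 P.total.atlas.dim) h a) = P.bcls a :=
  (quotTP_eq_iff.2 ⟨g, ((P.act_smooth_left g).tmap_tcls a hh hl).symm⟩).symm

theorem exists_translation_of_bcls_eq {a b : TangentBundle (𝓡 P.total.atlas.dim) P.total.atlas}
    (hab : P.bcls a = P.bcls b) : ∃ (g : P.group) (h : P.total.atlas → P.total.atlas),
      SmoothNear (𝓡 P.total.atlas.dim) (𝓡 P.total.atlas.dim) h a.proj ∧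
      (∀ᶠ z in 𝓝 a.proj, P.total.chart (h z) = P.act (P.total.chart z) g) ∧
      tangentMap (𝓡 P.total.atlas.dim) (𝓡 P.total.atlas.dim) h a = b := by
  obtain ⟨g, hg⟩ := quotTP_eq_iff.1 hab
  have hp : P.act (P.total.chart a.proj) g = P.total.chart b.proj := by
    have := congrArg P.total.tproj hg
    rw [tact, QManifold.Smooth.tproj_tmap] at this
    exact this.symm
  obtain ⟨h, h1, h2, h3⟩ := (P.act_smooth_left g).exists_lift hp
  refine ⟨g, h, h2, h3, ?_⟩
  refine P.total.tcls_injective_of_proj_eq ?_ h1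
  rw [hg]
  exact ((P.act_smooth_left g).tmap_tcls a h2 h3).symm

/-- Freeness forces the translating element to be `1`, and then rigidity makes the two vectors
equal. Together with `exists_bcls_eq` this identifies each tangent space of the atlas with the fibre
of `(TP)/G` below it. -/
theorem eq_of_bcls_eq {a b : TangentBundle (𝓡 P.total.atlas.dim) P.total.atlas}
    (hab : P.bcls a = P.bcls b) (hp : a.proj = b.proj) : a = b := by
  obtain ⟨g, hg⟩ := quotTP_eq_iff.1 hab
  have hp' : P.act (P.total.chart a.proj) g = P.total.chart b.proj := by
    have := congrArg P.total.tproj hg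
    rw [tact, QManifold.Smooth.tproj_tmap] at this
    exact this.symm
  rw [← hp] at hp'
  rw [P.act_free _ _ hp', tact_one] at hg
  exact P.total.tcls_injective_of_proj_eq hg.symm hp

/-- Any point of the atlas over the same base point is reached by a local lift of a right
translation, and its derivative carries a representative along without changing the class. -/
theorem exists_bcls_eq (c : P.Atiyah) {m : P.total.atlas} (h : P.bp m = P.atiyahProj c) :
    ∃ v : P.total.atlas.T m, P.bcls ⟨m, v⟩ = c := by
  induction c using Quot.inductionOn with
  | h w =>
    obtain ⟨a, rfl⟩ := P.total.exists_tcls_eq w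
    obtain ⟨e, he⟩ := P.exists_act_of_bp_eq (m := a.proj) (m' := m) h.symm
    obtain ⟨k, rfl, h2, h3⟩ := (P.act_smooth_left (P.group.chart e)).exists_lift he.symm
    exact ⟨_, bcls_tangentMap a h2 h3⟩

/-- A family of tangent vectors is smooth if it represents the same classes in `(TP)/G` as a smooth
family and has a smooth family of base points. -/
theorem contMDiffAt_of_bcls_eq {T : SmoothMfd.{u}} {a b : T → P.total.atlas}
    {E H : Type*} [NormedAddCommGroup E] [NormedSpace ℝ E] [TopologicalSpace H]
    {J : ModelWithCorners ℝ E H} {T' : Type*} [TopologicalSpace T'] [ChartedSpace H T']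
    [IsManifold J ∞ T'] {k : T' → T} {V W : T' → TangentBundle (𝓡 P.total.atlas.dim) P.total.atlas}
    {t : T'}
    (ha : SmoothNear (𝓡 T.dim) (𝓡 P.total.atlas.dim) a (k t))
    (hb : SmoothNear (𝓡 T.dim) (𝓡 P.total.atlas.dim) b (k t))
    (hab : ∀ᶠ z in 𝓝 (k t), P.bp (a z) = P.bp (b z))
    (hk : ContMDiffAt J (𝓡 T.dim) ∞ k t)
    (hV : ContMDiffAt J (𝓡 P.total.atlas.dim).tangent ∞ V t)
    (hVa : ∀ᶠ z in 𝓝 t, (V z).proj = a (k z)) (hWb : ∀ᶠ z in 𝓝 t, (W z).proj = b (k z))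
    (hVW : ∀ᶠ z in 𝓝 t, P.bcls (W z) = P.bcls (V z)) :
    ContMDiffAt J (𝓡 P.total.atlas.dim).tangent ∞ W t := by
  obtain ⟨R, γ, hγ, hR, hRl, hRb⟩ := exists_transport ha hb hab
  have hVt : (V t).proj = a (k t) := hVa.self_of_nhds
  -- The family `V` is moved by the translation with parameter `γ (k z)`. The result is smooth, and
  -- it equals `W` because it has the same classes and the same base points.
  have key := contMDiffAt_tangentMap_param (g := R) (V := V) (c := fun z => γ (k z)) (t₀ := t)
    (by rw [hVt]; exact hR.contMDiffAt) hV (hγ.contMDiffAt.comp t hk)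
  refine key.congr_of_eventuallyEq ?_
  have hc : ContinuousAt (fun z => (a (k z), γ (k z))) t :=
    ((ha.prodMk hγ).continuousAt.comp_of_eq hk.continuousAt rfl)
  filter_upwards [hVa, hWb, hVW, hk.continuousAt.eventually hRb, hc.eventually hR.eventually,
    hc.eventually (eventually_eventually_nhds.2 hRl)] with z h1 h2 h3 h4 h5 h6
  have hi : ContinuousAt (fun y : P.total.atlas => (y, γ (k z))) (V z).proj := by fun_prop
  refine eq_of_bcls_eq ?_ ?_
  · rw [h3, bcls_tangentMap (g := P.group.chart (γ (k z)))]
    · exact h5.comp_of_eq ((smoothNear_id _).prodMk (smoothNear_const _ _)) (by rw [h1])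
    · rw [← h1] at h6
      exact hi.eventually h6
  · rw [h2, ← h4, ← h1]
    rfl

/-- The projection is unchanged by right translations. This makes the anchor well defined on
classes. -/
theorem tangentMap_bp_eq {a b : TangentBundle (𝓡 P.total.atlas.dim) P.total.atlas}
    (hab : P.bcls a = P.bcls b) :
    tangentMap (𝓡 P.total.atlas.dim) (𝓡 P.base.dim) P.bp a =
      tangentMap (𝓡 P.total.atlas.dim) (𝓡 P.base.dim) P.bp b := by
  obtain ⟨g, h, h1, h2, rfl⟩ := exists_translation_of_bcls_eq hab
  rw [← tangentMap_fun_comp a (P.bp_smooth.mdifferentiableAt (by simp)) h1.mdifferentiableAt]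
  refine tangentMap_congr_of_eventuallyEq (h2.mono fun z hz => ?_)
  change _ = P.proj (P.total.chart (h z))
  rw [hz, proj_act]

/-! ### Vertical tangent vectors -/

theorem exists_orbit_lift (m : P.total.atlas) {e : P.group.atlas} (he : P.group.chart e = 1) :
    ∃ O : P.group.atlas → P.total.atlas, O e = m ∧
      SmoothNear (𝓡 P.group.atlas.dim) (𝓡 P.total.atlas.dim) O e ∧
      ∀ᶠ k in 𝓝 e, P.total.chart (O k) = P.act (P.total.chart m) (P.group.chart k) :=
  (P.act_smooth_right (P.total.chart m)).exists_lift (by rw [he, P.act_one])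

/-- In a local trivialization the orbit map of `p` becomes left translation by `χ(p)`, which has a
Q-smooth inverse and hence an injective tangent map. -/
theorem tmap_orbit_injective (p : P.total) {v w : P.group.LieAlg}
    (h : (P.act_smooth_right p).tmap v.1 = (P.act_smooth_right p).tmap w.1) : v = w := by
  obtain ⟨m, rfl⟩ := P.total.surjective p
  obtain ⟨e, he⟩ := P.group.surjective 1
  obtain ⟨O, rfl, hO, hOl⟩ := exists_orbit_lift m he
  obtain ⟨U, hU, hmU, χ, hχ, hlift⟩ := P.exists_equivariant (P.bp (O e))
  obtain ⟨e', he'⟩ := P.group.surjective (χ (P.total.chart (O e)))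
  obtain ⟨κ, -, k2, k3⟩ := hlift (O e) hmU e' he'
  have hL := P.group.smooth_mul_left (χ (P.total.chart (O e)))
  have key : ∀ v : P.group.LieAlg, ∃ a : TangentBundle (𝓡 P.group.atlas.dim) P.group.atlas,
      a.proj = e ∧ P.group.tcls a = v.1 ∧ (P.act_smooth_right (P.total.chart (O e))).tmap v.1 =
        P.total.tcls (tangentMap (𝓡 P.group.atlas.dim) (𝓡 P.total.atlas.dim) O a) ∧
      hL.tmap v.1 = P.group.tcls (tangentMap (𝓡 P.total.atlas.dim) (𝓡 P.group.atlas.dim) κ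
        (tangentMap (𝓡 P.group.atlas.dim) (𝓡 P.total.atlas.dim) O a)) := by
    intro v
    obtain ⟨x, hx⟩ := P.group.exists_tmk_eq v.1 e (by rw [v.2, he])
    refine ⟨⟨e, x⟩, rfl, hx, ?_, ?_⟩
    · rw [← hx]
      exact (P.act_smooth_right (P.total.chart (O e))).tmap_tcls ⟨e, x⟩ hO hOl
    · rw [← hx, ← tangentMap_fun_comp _ k2.mdifferentiableAt hO.mdifferentiableAt]
      refine hL.tmap_tcls ⟨e, x⟩ (k2.comp hO) ?_
      filter_upwards [hOl, hO.continuousAt.eventually k3] with k h1 h2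
      rw [h2, h1, hχ _ hmU]
  obtain ⟨a, ha1, ha2, ha3, ha4⟩ := key v
  obtain ⟨b, hb1, hb2, hb3, hb4⟩ := key w
  rw [ha3, hb3] at h
  have h' := P.total.tcls_injective_of_proj_eq h (by
    change O a.proj = O b.proj
    rw [ha1, hb1])
  rw [h', ← hb4] at ha4
  have hL' := P.group.smooth_mul_left (χ (P.total.chart (O e)))⁻¹
  exact Subtype.ext (hL.tmap_injective hL' (fun s => inv_mul_cancel_left _ s) ha4)

/-- Near `m` every point is `z = R (s (bp z), γ z)`, with `s` a section through `m` and `γ` obtained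
by division. Differentiating along a vertical vector `v`, the first argument contributes nothing, so
`v` is the image of `Tγ(v)` under the orbit map of `m`. -/
theorem exists_orbit_of_mfderiv_bp_eq_zero {m : P.total.atlas} (v : P.total.atlas.T m)
    (hv : mfderiv (𝓡 P.total.atlas.dim) (𝓡 P.base.dim) P.bp m v = 0) :
    ∃ w : P.group.LieAlg, (P.act_smooth_right (P.total.chart m)).tmap w.1 = P.total.tmk m v := by
  obtain ⟨s, s1, s2, s3⟩ := P.exists_section m
  have hbs := P.bp_smooth.smoothNear m
  have ha : SmoothNear (𝓡 P.total.atlas.dim) (𝓡 P.total.atlas.dim) (fun z => s (P.bp z)) m :=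
    s2.comp hbs
  obtain ⟨e, he⟩ := P.group.surjective 1
  obtain ⟨γ, rfl, g2, g3⟩ := exists_division (T := P.total.atlas) ha (smoothNear_id m)
    (hbs.continuousAt.eventually s3) (e := e) (by rw [s1, he, P.act_one])
  -- The value of the lifted action at `(m, γ m)` is taken to be `m` itself; only then does rigidity
  -- identify `R (s (bp z), γ z)` with `z`.
  obtain ⟨R, r1, r2, r3⟩ := P.act_smooth.exists_lift (x := (m, γ m)) (y := m)
    (by simp [he, P.act_one])
  have hc := ha.prodMk g2
  have hpt : (s (P.bp m), γ m) = (m, γ m) := by rw [s1]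
  have hid : (fun z => R (s (P.bp z), γ z)) =ᶠ[𝓝 m] fun z => z := by
    refine P.total.eventuallyEq_of_chart_eq (r2.comp_of_eq hc hpt) (smoothNear_id m) ?_
      (by rw [s1, r1])
    have hc' : Filter.Tendsto (fun z => (s (P.bp z), γ z)) (𝓝 m) (𝓝 (m, γ m)) := by
      have := hc.continuousAt; rwa [ContinuousAt, hpt] at this
    filter_upwards [g3, hc'.eventually r3] with z h1 h2
    rw [h1, h2]
    rfl
  let a : TangentBundle (𝓡 P.group.atlas.dim) P.group.atlas :=
    tangentMap (𝓡 P.total.atlas.dim) (𝓡 P.group.atlas.dim) γ ⟨m, v⟩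
  refine ⟨⟨P.group.tcls a, he⟩, ?_⟩
  have hi : ContinuousAt (fun k : P.group.atlas => (m, k)) (γ m) := by fun_prop
  have hRm : SmoothNear (𝓡 P.group.atlas.dim) (𝓡 P.total.atlas.dim) (fun k => R (m, k)) (γ m) :=
    r2.comp ((smoothNear_const m _).prodMk (smoothNear_id _))
  refine ((P.act_smooth_right (P.total.chart m)).tmap_tcls a hRm (hi.eventually r3)).trans ?_
  change P.total.tcls _ = P.total.tcls ⟨m, v⟩
  congr 1
  have h0 := tangentMap_congr_of_eventuallyEq (I₁ := 𝓡 P.total.atlas.dim)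
    (I₂ := 𝓡 P.total.atlas.dim) (a := ⟨m, v⟩) hid
  have h1 : tangentMap (𝓡 P.total.atlas.dim) (𝓡 P.total.atlas.dim) (fun z => z)
      (⟨m, v⟩ : TangentBundle (𝓡 P.total.atlas.dim) P.total.atlas) = ⟨m, v⟩ :=
    congrFun (tangentMap_id (I := 𝓡 P.total.atlas.dim) (M := P.total.atlas)) _
  rw [h1] at h0
  rw [← h0]
  let F : P.total.atlas → P.total.atlas := fun z => s (P.bp z)
  -- On the vertical vector, `s ∘ bp` has the same tangent map as the constant map `m`.
  have hF : tangentMap (𝓡 P.total.atlas.dim) (𝓡 P.total.atlas.dim) F ⟨m, v⟩ =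
      tangentMap (𝓡 P.total.atlas.dim) (𝓡 P.total.atlas.dim) (fun _ => m) ⟨m, v⟩ := by
    have h2 := tangentMap_fun_comp (⟨m, v⟩ : TangentBundle (𝓡 P.total.atlas.dim) P.total.atlas)
      (g := s) (f := P.bp) s2.mdifferentiableAt hbs.mdifferentiableAt
    refine h2.trans ?_
    simp only [tangentMap, hv, mfderiv_const]
    exact Bundle.TotalSpace.ext s1 (heq_of_eq
      (map_zero (mfderiv (𝓡 P.base.dim) (𝓡 P.total.atlas.dim) s (P.bp m))))
  have hprod := (equivTangentBundleProd _ _ _ _).injective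
    ((equivTangentBundleProd_tangentMap_prodMk (⟨m, v⟩ : TangentBundle (𝓡 P.total.atlas.dim) _)
      ha.mdifferentiableAt g2.mdifferentiableAt).trans
    ((congrArg (fun x => (x, _)) hF).trans
      (equivTangentBundleProd_tangentMap_prodMk (⟨m, v⟩ : TangentBundle (𝓡 P.total.atlas.dim) _)
        (smoothNear_const m m).mdifferentiableAt g2.mdifferentiableAt).symm))
  rw [tangentMap_fun_comp (g := R) (f := fun z => (s (P.bp z), γ z)) _
    (by change MDifferentiableAt _ _ R (s (P.bp m), γ m); rw [hpt]; exact r2.mdifferentiableAt)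
    hc.mdifferentiableAt, hprod, ← tangentMap_fun_comp (g := R) (f := fun z => (m, γ z)) _
    r2.mdifferentiableAt ((smoothNear_const m m).prodMk g2).mdifferentiableAt]
  exact (tangentMap_fun_comp (⟨m, v⟩ : TangentBundle (𝓡 P.total.atlas.dim) P.total.atlas)
    (g := fun k => R (m, k)) (f := γ) hRm.mdifferentiableAt g2.mdifferentiableAt).symm

end QPrincipalBundle

/-! ### Coordinates with respect to a smooth frame -/

section

variable {N : SmoothMfd.{u}} {r d : ℕ} {E : N → Type*} [∀ n, AddCommGroup (E n)]
  [∀ n, Module ℝ (E n)] [∀ n, TopologicalSpace (E n)]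
  [TopologicalSpace (Bundle.TotalSpace (EuclideanSpace ℝ (Fin r)) E)]
  [FiberBundle (EuclideanSpace ℝ (Fin r)) E] [VectorBundle ℝ (EuclideanSpace ℝ (Fin r)) E]

/-- The coordinates with respect to a smooth family of linear isomorphisms from a fixed vector space
onto the fibres of a vector bundle are smooth. -/
theorem contMDiffAt_frame_coord {n₀ : N} {Φ : ∀ n, EuclideanSpace ℝ (Fin d) → E n}
    {c : ∀ n, E n → EuclideanSpace ℝ (Fin d)}
    (hlin : ∀ᶠ n in 𝓝 n₀, IsLinearMap ℝ (Φ n)) (hr : ∀ᶠ n in 𝓝 n₀, ∀ a, Φ n (c n a) = a)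
    (hl : ∀ᶠ n in 𝓝 n₀, ∀ x, c n (Φ n x) = x)
    (hs : ∀ x, ContMDiffAt (𝓡 N.dim) ((𝓡 N.dim).prod (𝓡 r)) ∞
      (fun n => (⟨n, Φ n x⟩ : Bundle.TotalSpace (EuclideanSpace ℝ (Fin r)) E)) n₀)
    (a₀ : Bundle.TotalSpace (EuclideanSpace ℝ (Fin r)) E) (h : a₀.proj = n₀) :
    ContMDiffAt ((𝓡 N.dim).prod (𝓡 r)) (𝓡 d) ∞
      (fun a : Bundle.TotalSpace (EuclideanSpace ℝ (Fin r)) E => c a.proj a.2) a₀ := by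
  subst h
  set n₀ := a₀.proj with hn₀
  set t := trivializationAt (EuclideanSpace ℝ (Fin r)) E n₀ with ht
  have htb : n₀ ∈ t.baseSet := FiberBundle.mem_baseSet_trivializationAt _ E n₀
  let b : Fin d → EuclideanSpace ℝ (Fin d) := fun i => EuclideanSpace.single i 1
  -- The matrix of `Φ n` in the trivialization `t`. Its columns are smooth in `n`, and it is
  -- invertible near `n₀`, so the inverse matrix, which computes `c`, is smooth too.
  let C : N → (EuclideanSpace ℝ (Fin d) →L[ℝ] EuclideanSpace ℝ (Fin r)) := fun n =>
    ∑ i, (EuclideanSpace.proj i : EuclideanSpace ℝ (Fin d) →L[ℝ] ℝ).smulRight (t ⟨n, Φ n (b i)⟩).2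
  have hev : ∀ᶠ n in 𝓝 n₀, ∃ e : EuclideanSpace ℝ (Fin d) ≃L[ℝ] EuclideanSpace ℝ (Fin r),
      C n = e ∧ ∀ a : E n, c n a = e.symm (t ⟨n, a⟩).2 := by
    filter_upwards [hlin, hr, hl, t.open_baseSet.mem_nhds htb] with n h1 h2 h3 hn
    let e₁ : EuclideanSpace ℝ (Fin d) ≃ₗ[ℝ] E n :=
      { h1.mk' (Φ n) with
        invFun := c n
        left_inv := h3
        right_inv := h2 }
    let e₂ := e₁.trans (t.continuousLinearEquivAt ℝ n hn).toLinearEquiv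
    refine ⟨e₂.toContinuousLinearEquiv, ?_, fun a => ?_⟩
    · ext1 x
      have hx : x = ∑ i, x i • b i := by
        ext j
        simp [b, Pi.single_apply]
      have h4 : ∀ y, e₂ y = (t ⟨n, Φ n y⟩).2 := fun y => rfl
      have h5 : e₂.toContinuousLinearEquiv x = e₂ x := rfl
      rw [ContinuousLinearEquiv.coe_coe, h5]
      conv_rhs => rw [hx, map_sum]
      simp only [map_smul]
      simp only [h4, C, sum_apply, ContinuousLinearMap.smulRight_apply]
      rfl
    · have h4 : ∀ y, e₂.toContinuousLinearEquiv y = (t ⟨n, Φ n y⟩).2 := fun y => rfl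
      rw [ContinuousLinearEquiv.eq_symm_apply, h4, h2]
  have hC : ContMDiffAt (𝓡 N.dim) 𝓘(ℝ, EuclideanSpace ℝ (Fin d) →L[ℝ] EuclideanSpace ℝ (Fin r)) ∞
      C n₀ := by
    refine ContMDiffAt.sum fun i _ => ?_
    have h1 : ContMDiffAt (𝓡 N.dim) (𝓡 r) ∞ (fun n => (t ⟨n, Φ n (b i)⟩).2) n₀ :=
      (Bundle.contMDiffAt_section n₀).1 (hs (b i))
    exact ((ContinuousLinearMap.smulRightL ℝ (EuclideanSpace ℝ (Fin d)) (EuclideanSpace ℝ (Fin r))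
      (EuclideanSpace.proj i)).contMDiff.contMDiffAt).comp n₀ h1
  obtain ⟨e₀, he₀, -⟩ := hev.self_of_nhds
  have hinv : ContMDiffAt (𝓡 N.dim)
      𝓘(ℝ, EuclideanSpace ℝ (Fin r) →L[ℝ] EuclideanSpace ℝ (Fin d)) ∞
      (fun n => (C n).inverse) n₀ := by
    have h1 : ContDiffAt ℝ ∞ ContinuousLinearMap.inverse (C n₀) := by
      rw [he₀]; exact contDiffAt_map_inverse e₀
    exact h1.contMDiffAt.comp n₀ hC
  have hp : ContMDiffAt ((𝓡 N.dim).prod (𝓡 r)) (𝓡 N.dim) ∞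
      (Bundle.TotalSpace.proj : Bundle.TotalSpace (EuclideanSpace ℝ (Fin r)) E → N) a₀ :=
    (Bundle.contMDiff_proj E).contMDiffAt
  have ht2 : ContMDiffAt ((𝓡 N.dim).prod (𝓡 r)) (𝓡 r) ∞
      (fun a : Bundle.TotalSpace (EuclideanSpace ℝ (Fin r)) E => (t a).2) a₀ :=
    (Bundle.contMDiffAt_totalSpace.1 contMDiffAt_id).2
  refine ((hinv.comp a₀ hp).clm_apply ht2).congr_of_eventuallyEq ?_
  filter_upwards [hp.continuousAt.eventually hev] with a ha
  obtain ⟨e, he, hc⟩ := ha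
  rw [hc a.2]
  simp only [Function.comp_apply, he, ContinuousLinearMap.inverse_equiv]
  rfl

end

/-! ### Representatives on the atlas and invariant vector fields -/

namespace QPrincipalBundle

variable {P : QPrincipalBundle.{u}}

theorem bp_surjective (P : QPrincipalBundle.{u}) (n : P.base) : ∃ m, P.bp m = n := by
  obtain ⟨U, hU, hn, ψ, ψ', hψ, hψ', hinv, hs, hs', h1, h2⟩ := P.locally_trivial n
  obtain ⟨m, hm⟩ := P.total.surjective (ψ' (n, 1))
  have h3 : (n, (1 : P.group)) ∈ U ×ˢ (univ : Set P.group) := ⟨hn, mem_univ _⟩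
  refine ⟨m, ?_⟩
  rw [bp, hm, ← h1 _ (hψ' h3), hinv.2 h3]

theorem exists_translation {m m' : P.total.atlas} (h : P.bp m = P.bp m') :
    ∃ (g : P.group) (k : P.total.atlas → P.total.atlas), k m = m' ∧
      SmoothNear (𝓡 P.total.atlas.dim) (𝓡 P.total.atlas.dim) k m ∧
      ∀ᶠ z in 𝓝 m, P.total.chart (k z) = P.act (P.total.chart z) g := by
  obtain ⟨e, he⟩ := P.exists_act_of_bp_eq h
  obtain ⟨k, h1, h2, h3⟩ := (P.act_smooth_left (P.group.chart e)).exists_lift he.symm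
  exact ⟨_, k, h1, h2, h3⟩

open Classical in
/-- The representative of an element of `(TP)/G` at a point of the atlas. -/
noncomputable def rep (c : P.Atiyah) (m : P.total.atlas) : P.total.atlas.T m :=
  if h : P.bp m = P.atiyahProj c then (exists_bcls_eq c h).choose else 0

theorem bcls_rep {c : P.Atiyah} {m : P.total.atlas} (h : P.bp m = P.atiyahProj c) :
    P.bcls ⟨m, rep c m⟩ = c := by
  rw [rep, dif_pos h]
  exact (exists_bcls_eq c h).choose_spec

theorem rep_bcls (m : P.total.atlas) (v : P.total.atlas.T m) : rep (P.bcls ⟨m, v⟩) m = v :=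
  Bundle.TotalSpace.mk_inj.1 (eq_of_bcls_eq (a := ⟨m, rep (P.bcls ⟨m, v⟩) m⟩) (b := ⟨m, v⟩)
    (bcls_rep rfl) rfl)

variable (P) in
/-- An identification of `(TP)/G` with the total space of a smooth vector bundle for which the
quotient map from the tangent bundle of the atlas is smooth and fibrewise linear. -/
structure AtiyahBundle (r : ℕ) (E : P.base → Type u) [∀ n, AddCommGroup (E n)]
    [∀ n, Module ℝ (E n)] [∀ n, TopologicalSpace (E n)]
    [TopologicalSpace (Bundle.TotalSpace (EuclideanSpace ℝ (Fin r)) E)]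
    [FiberBundle (EuclideanSpace ℝ (Fin r)) E] [VectorBundle ℝ (EuclideanSpace ℝ (Fin r)) E] where
  e : ∀ n, {a : P.Atiyah // P.atiyahProj a = n} ≃ E n
  linear : ∀ m, IsLinearMap ℝ (fun v => e _ (P.cls m v))
  smooth : ContMDiff (𝓡 P.total.atlas.dim).tangent ((𝓡 P.base.dim).prod (𝓡 r)) ∞
    (fun x : TangentBundle (𝓡 P.total.atlas.dim) P.total.atlas =>
      (⟨P.proj (P.total.chart x.proj), e _ (P.cls x.proj x.2)⟩ :
        Bundle.TotalSpace (EuclideanSpace ℝ (Fin r)) E))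

namespace AtiyahBundle

variable {r : ℕ} {E : P.base → Type u} [∀ n, AddCommGroup (E n)]
    [∀ n, Module ℝ (E n)] [∀ n, TopologicalSpace (E n)]
    [TopologicalSpace (Bundle.TotalSpace (EuclideanSpace ℝ (Fin r)) E)]
    [FiberBundle (EuclideanSpace ℝ (Fin r)) E] [VectorBundle ℝ (EuclideanSpace ℝ (Fin r)) E]
    (𝔢 : P.AtiyahBundle r E)

/-- The quotient map from the tangent bundle of the atlas to the vector bundle. -/
def quot (x : TangentBundle (𝓡 P.total.atlas.dim) P.total.atlas) :
    Bundle.TotalSpace (EuclideanSpace ℝ (Fin r)) E :=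
  ⟨P.bp x.proj, 𝔢.e _ (P.cls x.proj x.2)⟩

/-- The quotient map on the tangent space at one point of the atlas. -/
noncomputable def lin (m : P.total.atlas) : P.total.atlas.T m →ₗ[ℝ] E (P.bp m) :=
  (𝔢.linear m).mk' _

/-- The representative at a point of the atlas of an element of the vector bundle. -/
noncomputable def vec {n : P.base} (a : E n) (m : P.total.atlas) : P.total.atlas.T m :=
  rep ((𝔢.e n).symm a).1 m

theorem bcls_vec {n : P.base} (a : E n) {m : P.total.atlas} (h : P.bp m = n) :
    P.bcls ⟨m, 𝔢.vec a m⟩ = ((𝔢.e n).symm a).1 :=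
  bcls_rep (h.trans ((𝔢.e n).symm a).2.symm)

@[simp] theorem lin_vec (m : P.total.atlas) (a : E (P.bp m)) : 𝔢.lin m (𝔢.vec a m) = a := by
  have h : P.cls m (𝔢.vec a m) = (𝔢.e _).symm a := Subtype.ext (𝔢.bcls_vec a rfl)
  change 𝔢.e _ (P.cls m (𝔢.vec a m)) = a
  rw [h, Equiv.apply_symm_apply]

@[simp] theorem vec_lin (m : P.total.atlas) (v : P.total.atlas.T m) : 𝔢.vec (𝔢.lin m v) m = v := by
  have h : (𝔢.e _).symm (𝔢.lin m v) = P.cls m v := Equiv.symm_apply_apply _ _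
  rw [vec, h]
  exact rep_bcls m v

/-- The quotient map is an isomorphism on every tangent space of the atlas. -/
noncomputable def linEquiv (m : P.total.atlas) : P.total.atlas.T m ≃ₗ[ℝ] E (P.bp m) :=
  { 𝔢.lin m with
    invFun := fun a => 𝔢.vec a m
    left_inv := 𝔢.vec_lin m
    right_inv := 𝔢.lin_vec m }

theorem lin_eq_iff {m : P.total.atlas} (v : P.total.atlas.T m) (a : E (P.bp m)) :
    𝔢.lin m v = a ↔ v = 𝔢.vec a m := by
  constructor
  · rintro rfl; simp
  · rintro rfl; simp

/-- The vector field on the atlas that corresponds to a section. -/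
noncomputable def field (σ : ∀ n, E n) (m : P.total.atlas) : P.total.atlas.T m :=
  𝔢.vec (σ (P.bp m)) m

@[simp] theorem lin_field (σ : ∀ n, E n) (m : P.total.atlas) :
    𝔢.lin m (𝔢.field σ m) = σ (P.bp m) := 𝔢.lin_vec m _

theorem field_eq {σ : ∀ n, E n} {X : ∀ m, P.total.atlas.T m}
    (h : ∀ m, 𝔢.lin m (X m) = σ (P.bp m)) : X = 𝔢.field σ :=
  funext fun m => (𝔢.lin_eq_iff _ _).1 (h m)

/-- Over a local section `s`, a trivialization of the tangent bundle of the atlas yields a smooth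
frame of `E`. The coordinates of an element in this frame are the coordinates of its representative
at `s`, so they are smooth. This gives a smooth local right inverse of the quotient map. -/
theorem contMDiffAt_vec {s : P.base → P.total.atlas}
    (a₀ : Bundle.TotalSpace (EuclideanSpace ℝ (Fin r)) E)
    (hs : SmoothNear (𝓡 P.base.dim) (𝓡 P.total.atlas.dim) s a₀.proj)
    (hbs : ∀ᶠ n in 𝓝 a₀.proj, P.bp (s n) = n) :
    ContMDiffAt ((𝓡 P.base.dim).prod (𝓡 r)) (𝓡 P.total.atlas.dim).tangent ∞
      (fun a : Bundle.TotalSpace (EuclideanSpace ℝ (Fin r)) E =>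
        (⟨s a.proj, 𝔢.vec a.2 (s a.proj)⟩ : TangentBundle (𝓡 P.total.atlas.dim) P.total.atlas))
      a₀ := by
  classical
  let t := trivializationAt (EuclideanSpace ℝ (Fin P.total.atlas.dim))
    (TangentSpace (𝓡 P.total.atlas.dim) (M := P.total.atlas)) (s a₀.proj)
  have htb : s a₀.proj ∈ t.baseSet := FiberBundle.mem_baseSet_trivializationAt _ _ _
  let F : ∀ n, EuclideanSpace ℝ (Fin P.total.atlas.dim) → E n := fun n x =>
    if h : P.bp (s n) = n then 𝔢.e n ⟨P.bcls ⟨s n, t.symm (s n) x⟩, h⟩ else 0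
  let c : ∀ n, E n → EuclideanSpace ℝ (Fin P.total.atlas.dim) := fun n a =>
    (t ⟨s n, 𝔢.vec a (s n)⟩).2
  have hb : ∀ᶠ n in 𝓝 a₀.proj, s n ∈ t.baseSet :=
    hs.continuousAt.eventually (t.open_baseSet.mem_nhds htb)
  have hF : ∀ n, P.bp (s n) = n → ∀ x,
      (⟨n, F n x⟩ : Bundle.TotalSpace (EuclideanSpace ℝ (Fin r)) E) =
        𝔢.quot ⟨s n, t.symm (s n) x⟩ := by
    intro n hn x
    have key : ∀ n' (hn : P.bp (s n) = n'), (⟨n', 𝔢.e n' ⟨P.bcls ⟨s n, t.symm (s n) x⟩, hn⟩⟩ :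
        Bundle.TotalSpace (EuclideanSpace ℝ (Fin r)) E) = 𝔢.quot ⟨s n, t.symm (s n) x⟩ := by
      rintro _ rfl; rfl
    rw [← key n hn]
    simp only [F, dif_pos hn]
  have key := contMDiffAt_frame_coord (N := P.base) (E := E) (n₀ := a₀.proj) (Φ := F) (c := c)
    ?_ ?_ ?_ ?_ a₀ rfl
  · rw [Bundle.contMDiffAt_totalSpace]
    refine ⟨hs.contMDiffAt.comp a₀ (Bundle.contMDiff_proj E).contMDiffAt, key⟩
  · filter_upwards [hb, hbs] with n h1 h2
    have h4 : ∀ n' (hn : P.bp (s n) = n'), IsLinearMap ℝ fun x =>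
        𝔢.e n' ⟨P.bcls ⟨s n, t.symm (s n) x⟩, hn⟩ := by
      rintro _ rfl
      have h5 : ∀ x y, t.symm (s n) (x + y) = t.symm (s n) x + t.symm (s n) y :=
        map_add (t.continuousLinearEquivAt ℝ (s n) h1).symm
      have h6 : ∀ (c : ℝ) x, t.symm (s n) (c • x) = c • t.symm (s n) x :=
        map_smul (t.continuousLinearEquivAt ℝ (s n) h1).symm
      refine ⟨fun x y => ?_, fun c x => ?_⟩
      · rw [h5]; exact map_add (𝔢.lin (s n)) _ _
      · rw [h6]; exact map_smul (𝔢.lin (s n)) _ _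
    have h5 : F n = fun x => 𝔢.e n ⟨P.bcls ⟨s n, t.symm (s n) x⟩, h2⟩ := by
      funext x
      simp only [F, dif_pos h2]
    rw [h5]
    exact h4 n h2
  · filter_upwards [hb, hbs] with n h1 h2 a
    simp only [F, c, dif_pos h2]
    rw [← Equiv.eq_symm_apply]
    refine Subtype.ext ?_
    rw [← 𝔢.bcls_vec a h2]
    change P.bcls _ = _
    rw [t.symm_apply_apply_mk h1]
  · filter_upwards [hb, hbs] with n h1 h2 x
    simp only [F, c, dif_pos h2, vec, Equiv.symm_apply_apply, rep_bcls]
    rw [t.apply_mk_symm h1]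
  · intro x
    have h1 : ContMDiffAt (𝓡 P.base.dim) (𝓡 P.total.atlas.dim).tangent ∞
        (fun n => (⟨s n, t.symm (s n) x⟩ : TangentBundle (𝓡 P.total.atlas.dim) P.total.atlas))
        a₀.proj := by
      rw [Bundle.contMDiffAt_totalSpace]
      refine ⟨hs.contMDiffAt, (contMDiffAt_const (c := x)).congr_of_eventuallyEq ?_⟩
      filter_upwards [hb] with n hn
      change (t _).2 = _
      rw [t.apply_mk_symm hn]
    refine ((𝔢.smooth _).comp a₀.proj h1).congr_of_eventuallyEq ?_
    filter_upwards [hbs] with n hn using hF n hn x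

/-- At `z` the field has the same class as the representative at `s (bp z)`, which is smooth by
`contMDiffAt_vec`; `contMDiffAt_of_bcls_eq` moves it back to `z`. -/
theorem contMDiff_field {σ : ∀ n, E n} (hσ : ContMDiff (𝓡 P.base.dim) ((𝓡 P.base.dim).prod (𝓡 r)) ∞
    (fun n => (⟨n, σ n⟩ : Bundle.TotalSpace (EuclideanSpace ℝ (Fin r)) E))) :
    ContMDiff (𝓡 P.total.atlas.dim) (𝓡 P.total.atlas.dim).tangent ∞
      (fun m => (⟨m, 𝔢.field σ m⟩ : TangentBundle (𝓡 P.total.atlas.dim) P.total.atlas)) := by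
  intro m
  obtain ⟨s, s1, s2, s3⟩ := P.exists_section m
  have hbs := P.bp_smooth.smoothNear m
  have h1 := hbs.continuousAt.eventually s3
  refine contMDiffAt_of_bcls_eq (T := P.total.atlas) (k := fun z => z) (a := fun z => s (P.bp z))
    (b := fun z => z) (V := fun z => ⟨s (P.bp z), 𝔢.vec (σ (P.bp z)) (s (P.bp z))⟩)
    (s2.comp hbs) (smoothNear_id m) h1 contMDiffAt_id ?_ (Filter.Eventually.of_forall fun _ => rfl)
    (Filter.Eventually.of_forall fun _ => rfl) ?_
  · exact (𝔢.contMDiffAt_vec ⟨P.bp m, σ (P.bp m)⟩ s2 s3).comp m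
      ((hσ (P.bp m)).comp m (P.bp_smooth m))
  · filter_upwards [h1] with z hz
    rw [𝔢.bcls_vec _ hz, field, 𝔢.bcls_vec _ rfl]

end AtiyahBundle

end QPrincipalBundle

/-! ### Smooth vector fields -/

namespace SmoothMfd

variable {M : SmoothMfd.{u}} {X Y Z : ∀ m : M, M.T m}

instance : IsManifold (𝓡 M.dim) 2 M := IsManifold.of_le (n := ∞) (by norm_cast)

instance : IsManifold (𝓡 M.dim) (minSmoothness ℝ 3) M := by
  rw [minSmoothness_of_isRCLikeNormedField]
  exact IsManifold.of_le (n := ∞) (by norm_cast)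

variable (X) in
/-- Smoothness of a vector field. -/
def IsSmooth : Prop := ContMDiff (𝓡 M.dim) (𝓡 M.dim).tangent ∞
  (fun m => (⟨m, X m⟩ : TangentBundle (𝓡 M.dim) M))

namespace IsSmooth

theorem mdifferentiableAt (hX : IsSmooth X) (m : M) : MDifferentiableAt (𝓡 M.dim)
    (𝓡 M.dim).tangent (fun m => (⟨m, X m⟩ : TangentBundle (𝓡 M.dim) M)) m :=
  (hX m).mdifferentiableAt (by simp)

theorem mlieBracket (hX : IsSmooth X) (hY : IsSmooth Y) :
    IsSmooth (VectorField.mlieBracket (𝓡 M.dim) X Y) := fun m => by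
  have : IsManifold (𝓡 M.dim) (((⊤ : ℕ∞) : WithTop ℕ∞) + 1) M :=
    (inferInstance : IsManifold (𝓡 M.dim) ∞ M)
  exact ContMDiffAt.mlieBracket_vectorField (m := ⊤) (n := ⊤) (hX m) (hY m)
    (by rw [minSmoothness_of_isRCLikeNormedField]; rfl)

theorem mlieBracket_add_left (hX : IsSmooth X) (hY : IsSmooth Y) :
    VectorField.mlieBracket (𝓡 M.dim) (X + Y) Z =
      VectorField.mlieBracket (𝓡 M.dim) X Z + VectorField.mlieBracket (𝓡 M.dim) Y Z :=
  funext fun m => VectorField.mlieBracket_add_left (hX.mdifferentiableAt m) (hY.mdifferentiableAt m)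

theorem mlieBracket_add_right (hX : IsSmooth X) (hY : IsSmooth Y) :
    VectorField.mlieBracket (𝓡 M.dim) Z (X + Y) =
      VectorField.mlieBracket (𝓡 M.dim) Z X + VectorField.mlieBracket (𝓡 M.dim) Z Y :=
  funext fun m => VectorField.mlieBracket_add_right (hX.mdifferentiableAt m) (hY.mdifferentiableAt m)

theorem mlieBracket_smul_left (c : ℝ) (hX : IsSmooth X) :
    VectorField.mlieBracket (𝓡 M.dim) (c • X) Z = c • VectorField.mlieBracket (𝓡 M.dim) X Z :=
  funext fun m => VectorField.mlieBracket_const_smul_left (hX.mdifferentiableAt m)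

theorem mlieBracket_smul_right (c : ℝ) (hX : IsSmooth X) :
    VectorField.mlieBracket (𝓡 M.dim) Z (c • X) = c • VectorField.mlieBracket (𝓡 M.dim) Z X :=
  funext fun m => VectorField.mlieBracket_const_smul_right (hX.mdifferentiableAt m)

theorem leibniz {f : M → ℝ} (hf : ContMDiff (𝓡 M.dim) 𝓘(ℝ, ℝ) ∞ f) (hX : IsSmooth X) (m : M) :
    VectorField.mlieBracket (𝓡 M.dim) Z (f • X) m =
      dirDeriv (Z m) f • X m + f m • VectorField.mlieBracket (𝓡 M.dim) Z X m :=
  VectorField.mlieBracket_smul_right (hf.mdifferentiableAt (by simp)) (hX.mdifferentiableAt m)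

theorem jacobi (hX : IsSmooth X) (hY : IsSmooth Y) (hZ : IsSmooth Z) :
    VectorField.mlieBracket (𝓡 M.dim) X (VectorField.mlieBracket (𝓡 M.dim) Y Z) =
      VectorField.mlieBracket (𝓡 M.dim) (VectorField.mlieBracket (𝓡 M.dim) X Y) Z +
      VectorField.mlieBracket (𝓡 M.dim) Y (VectorField.mlieBracket (𝓡 M.dim) X Z) := by
  have h : (minSmoothness ℝ 2 : WithTop ℕ∞) ≤ ∞ := by
    rw [minSmoothness_of_isRCLikeNormedField]; norm_cast
  exact VectorField.leibniz_identity_mlieBracket (hX.of_le h) (hY.of_le h) (hZ.of_le h)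

end IsSmooth

end SmoothMfd

/-! ### The Lie algebroid of invariant vector fields -/

namespace QPrincipalBundle

variable {P : QPrincipalBundle.{u}}

/-- The bracket of invariant vector fields is invariant. -/
theorem bcls_mlieBracket_eq {X Y : ∀ m, P.total.atlas.T m} (hX : SmoothMfd.IsSmooth X)
    (hY : SmoothMfd.IsSmooth Y)
    (hXi : ∀ m m', P.bp m = P.bp m' → P.bcls ⟨m, X m⟩ = P.bcls ⟨m', X m'⟩)
    (hYi : ∀ m m', P.bp m = P.bp m' → P.bcls ⟨m, Y m⟩ = P.bcls ⟨m', Y m'⟩)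
    {m m' : P.total.atlas} (h : P.bp m = P.bp m') :
    P.bcls ⟨m, VectorField.mlieBracket (𝓡 P.total.atlas.dim) X Y m⟩ =
      P.bcls ⟨m', VectorField.mlieBracket (𝓡 P.total.atlas.dim) X Y m'⟩ := by
  obtain ⟨g, k, rfl, hk, hkl⟩ := exists_translation h
  -- An invariant field is related to itself by a local lift of a translation: both vectors lie at
  -- `k z` and have the same class.
  have hrel : ∀ Z : ∀ m, P.total.atlas.T m,
      (∀ m m', P.bp m = P.bp m' → P.bcls ⟨m, Z m⟩ = P.bcls ⟨m', Z m'⟩) →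
      ∀ᶠ z in 𝓝 m, mfderiv (𝓡 P.total.atlas.dim) (𝓡 P.total.atlas.dim) k z (Z z) = Z (k z) := by
    intro Z hZ
    filter_upwards [hk.eventually, eventually_eventually_nhds.2 hkl] with z h1 h2
    have h3 : P.bp z = P.bp (k z) := by rw [bp, bp, h2.self_of_nhds, proj_act]
    refine Bundle.TotalSpace.mk_inj.1 (eq_of_bcls_eq (P := P)
      (a := tangentMap (𝓡 P.total.atlas.dim) (𝓡 P.total.atlas.dim) k ⟨z, Z z⟩)
      (b := ⟨k z, Z (k z)⟩) ?_ rfl)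
    rw [bcls_tangentMap (g := g) _ h1 h2, hZ _ _ h3]
  have key := VectorField.mfderiv_mlieBracket_of_related hk.contMDiffAt (hX.mdifferentiableAt m)
    (hY.mdifferentiableAt m) (hX.mdifferentiableAt _) (hY.mdifferentiableAt _) (hrel X hXi)
    (hrel Y hYi)
  rw [← key]
  exact (bcls_tangentMap (g := g) ⟨m, _⟩ hk hkl).symm

variable (P) in
/-- A point of the atlas over a point of the base. -/
noncomputable def pt (n : P.base) : P.total.atlas := (P.bp_surjective n).choose

@[simp] theorem bp_pt (n : P.base) : P.bp (P.pt n) = n := (P.bp_surjective n).choose_spec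

namespace AtiyahBundle

variable {r : ℕ} {E : P.base → Type u} [∀ n, AddCommGroup (E n)]
    [∀ n, Module ℝ (E n)] [∀ n, TopologicalSpace (E n)]
    [TopologicalSpace (Bundle.TotalSpace (EuclideanSpace ℝ (Fin r)) E)]
    [FiberBundle (EuclideanSpace ℝ (Fin r)) E] [VectorBundle ℝ (EuclideanSpace ℝ (Fin r)) E]
    (𝔢 : P.AtiyahBundle r E)

theorem contMDiff_quot : ContMDiff (𝓡 P.total.atlas.dim).tangent ((𝓡 P.base.dim).prod (𝓡 r)) ∞
    𝔢.quot := 𝔢.smooth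

theorem quot_vec {n : P.base} (a : E n) {m : P.total.atlas} (h : P.bp m = n) :
    𝔢.quot ⟨m, 𝔢.vec a m⟩ = ⟨n, a⟩ := by
  subst h
  exact congrArg (fun b : E (P.bp m) => (⟨P.bp m, b⟩ : Bundle.TotalSpace _ E)) (𝔢.lin_vec m a)

/-- The isomorphism from the tangent space at a point of the atlas to the fibre below it. -/
noncomputable def linAt {n : P.base} {m : P.total.atlas} (h : P.bp m = n) :
    P.total.atlas.T m ≃ₗ[ℝ] E n :=
  { toFun := fun v => 𝔢.e n ⟨P.bcls ⟨m, v⟩, h⟩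
    map_add' := by subst h; exact map_add (𝔢.lin m)
    map_smul' := by subst h; exact map_smul (𝔢.lin m)
    invFun := fun a => 𝔢.vec a m
    left_inv := by subst h; exact 𝔢.vec_lin m
    right_inv := by subst h; exact 𝔢.lin_vec m }

/-- Comparing elements of the total space avoids transport along the equality `P.bp m = n`, which
rarely holds by definition. -/
theorem mk_linAt {n : P.base} {m : P.total.atlas} (h : P.bp m = n) (v : P.total.atlas.T m) :
    (⟨n, 𝔢.linAt h v⟩ : Bundle.TotalSpace (EuclideanSpace ℝ (Fin r)) E) = 𝔢.quot ⟨m, v⟩ := by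
  subst h; rfl

theorem linAt_eq_iff {n : P.base} {m m' : P.total.atlas} (h : P.bp m = n) (h' : P.bp m' = n)
    (v : P.total.atlas.T m) (v' : P.total.atlas.T m') :
    𝔢.linAt h v = 𝔢.linAt h' v' ↔ P.bcls ⟨m, v⟩ = P.bcls ⟨m', v'⟩ :=
  (𝔢.e n).apply_eq_iff_eq.trans Subtype.ext_iff

theorem field_add (σ τ : ∀ n, E n) : 𝔢.field (σ + τ) = 𝔢.field σ + 𝔢.field τ :=
  funext fun m => map_add (𝔢.linEquiv m).symm _ _

theorem field_smul (f : P.base → ℝ) (σ : ∀ n, E n) :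
    𝔢.field (f • σ) = (fun m => f (P.bp m)) • 𝔢.field σ :=
  funext fun m => map_smul (𝔢.linEquiv m).symm _ _

theorem field_const_smul (c : ℝ) (σ : ∀ n, E n) : 𝔢.field (c • σ) = c • 𝔢.field σ :=
  funext fun m => map_smul (𝔢.linEquiv m).symm _ _

theorem field_injective {σ τ : ∀ n, E n} (h : 𝔢.field σ = 𝔢.field τ) : σ = τ := by
  funext n
  obtain ⟨m, rfl⟩ := P.bp_surjective n
  rw [← 𝔢.lin_field σ, h, 𝔢.lin_field]

theorem bcls_field (σ : ∀ n, E n) {m m' : P.total.atlas} (h : P.bp m = P.bp m') :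
    P.bcls ⟨m, 𝔢.field σ m⟩ = P.bcls ⟨m', 𝔢.field σ m'⟩ := by
  rw [field, field, 𝔢.bcls_vec _ rfl, 𝔢.bcls_vec _ rfl, h]

/-- Along a local section `s` the section is `quot ∘ field σ ∘ s`. This is the converse of
`contMDiff_field`, so smoothness of a bracket can be read off on the atlas. -/
theorem contMDiff_of_field {σ : ∀ n, E n} (h : SmoothMfd.IsSmooth (𝔢.field σ)) :
    ContMDiff (𝓡 P.base.dim) ((𝓡 P.base.dim).prod (𝓡 r)) ∞
      (fun n => (⟨n, σ n⟩ : Bundle.TotalSpace (EuclideanSpace ℝ (Fin r)) E)) := by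
  intro n
  obtain ⟨m, rfl⟩ := P.bp_surjective n
  obtain ⟨s, s1, s2, s3⟩ := P.exists_section m
  refine ((𝔢.contMDiff_quot _).comp _ ((h _).comp _ s2.contMDiffAt)).congr_of_eventuallyEq ?_
  filter_upwards [s3] with n hn
  simp only [Function.comp_apply, field]
  rw [𝔢.quot_vec _ rfl, hn]

/-- The values of the bracket of two sections. -/
noncomputable def bracketFun (σ τ : ∀ n, E n) (n : P.base) : E n :=
  𝔢.linAt (bp_pt n) (VectorField.mlieBracket (𝓡 P.total.atlas.dim) (𝔢.field σ) (𝔢.field τ) (P.pt n))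

variable {𝔢}

/-- The bracket is computed only at the chosen point over each `n`. Since the bracket of invariant
fields is invariant, its values at all other points of the atlas follow. -/
theorem field_bracketFun {σ τ : ∀ n, E n} (hσ : SmoothMfd.IsSmooth (𝔢.field σ))
    (hτ : SmoothMfd.IsSmooth (𝔢.field τ)) : 𝔢.field (𝔢.bracketFun σ τ) =
      VectorField.mlieBracket (𝓡 P.total.atlas.dim) (𝔢.field σ) (𝔢.field τ) := by
  refine (𝔢.field_eq fun m => ?_).symm
  exact (𝔢.linAt_eq_iff rfl (bp_pt _) _ _).2 (bcls_mlieBracket_eq hσ hτ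
    (fun _ _ h => 𝔢.bcls_field σ h) (fun _ _ h => 𝔢.bcls_field τ h) (bp_pt _).symm)

variable (𝔢)

theorem isSmooth_field (σ : ContMDiffSection (𝓡 P.base.dim) (EuclideanSpace ℝ (Fin r)) ∞ E) :
    SmoothMfd.IsSmooth (𝔢.field σ) := 𝔢.contMDiff_field σ.contMDiff

/-- The section whose values are given by the bracket of invariant vector fields. -/
noncomputable def bracketSec
    (σ τ : ContMDiffSection (𝓡 P.base.dim) (EuclideanSpace ℝ (Fin r)) ∞ E) :
    ContMDiffSection (𝓡 P.base.dim) (EuclideanSpace ℝ (Fin r)) ∞ E :=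
  ⟨𝔢.bracketFun σ τ, 𝔢.contMDiff_of_field (by
    rw [field_bracketFun (𝔢.isSmooth_field σ) (𝔢.isSmooth_field τ)]
    exact (𝔢.isSmooth_field σ).mlieBracket (𝔢.isSmooth_field τ))⟩

theorem field_bracketSec
    (σ τ : ContMDiffSection (𝓡 P.base.dim) (EuclideanSpace ℝ (Fin r)) ∞ E) :
    𝔢.field (𝔢.bracketSec σ τ) =
      VectorField.mlieBracket (𝓡 P.total.atlas.dim) (𝔢.field σ) (𝔢.field τ) :=
  field_bracketFun (𝔢.isSmooth_field σ) (𝔢.isSmooth_field τ)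

/-- The map of tangent spaces that is induced by the bundle projection. -/
noncomputable def anchor (n : P.base) : E n →ₗ[ℝ] P.base.T n :=
  (mfderiv (𝓡 P.total.atlas.dim) (𝓡 P.base.dim) P.bp (P.pt n) :
    EuclideanSpace ℝ (Fin P.total.atlas.dim) →L[ℝ] EuclideanSpace ℝ (Fin P.base.dim)).toLinearMap.comp
      (𝔢.linAt (bp_pt n)).symm.toLinearMap

/-- The anchor is defined with the chosen point over `n`; `tangentMap_bp_eq` shows that any other
representative gives the same vector. -/
theorem mk_anchor {n : P.base} {m : P.total.atlas} (h : P.bp m = n) (v : P.total.atlas.T m) :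
    (⟨n, 𝔢.anchor n (𝔢.linAt h v)⟩ : TangentBundle (𝓡 P.base.dim) P.base) =
      tangentMap (𝓡 P.total.atlas.dim) (𝓡 P.base.dim) P.bp ⟨m, v⟩ := by
  have h1 : P.bcls ⟨P.pt n, (𝔢.linAt (bp_pt n)).symm (𝔢.linAt h v)⟩ = P.bcls ⟨m, v⟩ := by
    rw [← 𝔢.linAt_eq_iff (bp_pt n) h, LinearEquiv.apply_symm_apply]
  rw [← tangentMap_bp_eq h1]
  exact Bundle.TotalSpace.ext (bp_pt n).symm HEq.rfl

theorem anchor_lin {m : P.total.atlas} (v : P.total.atlas.T m) :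
    𝔢.anchor (P.bp m) (𝔢.lin m v) = mfderiv (𝓡 P.total.atlas.dim) (𝓡 P.base.dim) P.bp m v :=
  Bundle.TotalSpace.mk_inj.1 (𝔢.mk_anchor rfl v)

/-- Near a given point the anchor is the tangent map of the projection applied to the smooth
representatives along a local section. -/
theorem anchor_smooth : ContMDiff ((𝓡 P.base.dim).prod (𝓡 r)) (𝓡 P.base.dim).tangent ∞
    (fun x : Bundle.TotalSpace (EuclideanSpace ℝ (Fin r)) E =>
      (⟨x.proj, 𝔢.anchor x.proj x.2⟩ : TangentBundle (𝓡 P.base.dim) P.base)) := by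
  intro a₀
  obtain ⟨m, hm⟩ := P.bp_surjective a₀.proj
  obtain ⟨s, s1, s2, s3⟩ := P.exists_section m
  rw [hm] at s1 s2 s3
  have hbp : ContMDiff (𝓡 P.total.atlas.dim).tangent (𝓡 P.base.dim).tangent ∞
      (tangentMap (𝓡 P.total.atlas.dim) (𝓡 P.base.dim) P.bp) :=
    P.bp_smooth.contMDiff_tangentMap (by norm_cast)
  refine ((hbp _).comp a₀ (𝔢.contMDiffAt_vec a₀ s2 s3)).congr_of_eventuallyEq ?_
  have hp : ContinuousAt (Bundle.TotalSpace.proj :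
      Bundle.TotalSpace (EuclideanSpace ℝ (Fin r)) E → P.base) a₀ :=
    (Bundle.contMDiff_proj (IB := 𝓡 P.base.dim) (n := ∞) E).contMDiffAt.continuousAt
  filter_upwards [hp.eventually s3] with a ha
  rw [Function.comp_apply, ← 𝔢.mk_anchor ha]
  exact congrArg (fun b => (⟨a.proj, 𝔢.anchor _ b⟩ : TangentBundle (𝓡 P.base.dim) P.base))
    ((𝔢.linAt ha).apply_symm_apply a.2).symm

variable [ContMDiffVectorBundle ∞ (EuclideanSpace ℝ (Fin r)) E (𝓡 P.base.dim)]

/-- The Lie algebroid of invariant vector fields. -/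
noncomputable def algebroid : LieAlgebroid P.base where
  rank := r
  fiber := E
  anchor := 𝔢.anchor
  anchor_smooth := 𝔢.anchor_smooth
  -- The passage from sections to vector fields on the atlas is injective, linear and compatible
  -- with brackets, so each identity is checked for vector fields.
  bracket := LinearMap.mk₂ ℝ 𝔢.bracketSec
    (fun σ σ' τ => ContMDiffSection.ext fun n => congrFun (𝔢.field_injective (by
      rw [field_bracketSec, ContMDiffSection.coe_add, ContMDiffSection.coe_add, field_add, field_add,
        field_bracketSec, field_bracketSec,
        (𝔢.isSmooth_field σ).mlieBracket_add_left (𝔢.isSmooth_field σ')])) n)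
    (fun c σ τ => ContMDiffSection.ext fun n => congrFun (𝔢.field_injective (by
      rw [field_bracketSec, ContMDiffSection.coe_smul, ContMDiffSection.coe_smul,
        field_const_smul, field_const_smul, field_bracketSec,
        (𝔢.isSmooth_field σ).mlieBracket_smul_left])) n)
    (fun σ τ τ' => ContMDiffSection.ext fun n => congrFun (𝔢.field_injective (by
      rw [field_bracketSec, ContMDiffSection.coe_add, ContMDiffSection.coe_add, field_add, field_add,
        field_bracketSec, field_bracketSec,
        (𝔢.isSmooth_field τ).mlieBracket_add_right (𝔢.isSmooth_field τ')])) n)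
    (fun c σ τ => ContMDiffSection.ext fun n => congrFun (𝔢.field_injective (by
      rw [field_bracketSec, ContMDiffSection.coe_smul, ContMDiffSection.coe_smul,
        field_const_smul, field_const_smul, field_bracketSec,
        (𝔢.isSmooth_field τ).mlieBracket_smul_right])) n)
  bracket_self σ := ContMDiffSection.ext fun n => congrFun (𝔢.field_injective (σ := 𝔢.bracketSec σ σ)
    (τ := (0 : ContMDiffSection (𝓡 P.base.dim) (EuclideanSpace ℝ (Fin r)) ∞ E)) (by
      rw [field_bracketSec, VectorField.mlieBracket_self]
      exact (funext fun m => map_zero (𝔢.linEquiv m).symm).symm)) n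
  jacobi σ τ υ := ContMDiffSection.ext fun n => congrFun (𝔢.field_injective
    (σ := 𝔢.bracketSec σ (𝔢.bracketSec τ υ)) (τ := ⇑(𝔢.bracketSec (𝔢.bracketSec σ τ) υ +
      𝔢.bracketSec τ (𝔢.bracketSec σ υ))) (by
      rw [ContMDiffSection.coe_add, field_add]
      simp only [field_bracketSec]
      exact (𝔢.isSmooth_field σ).jacobi (𝔢.isSmooth_field τ) (𝔢.isSmooth_field υ))) n
  leibniz σ τ τ' f hf h n := by
    have hτ : (τ' : ∀ n, E n) = f • (τ : ∀ n, E n) := funext h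
    -- The field of `f • τ` is `(f ∘ bp) • field τ`, and the field of `σ` differentiates `f ∘ bp` as
    -- the anchor of `σ` differentiates `f`.
    have key : 𝔢.field (𝔢.bracketSec σ τ') = 𝔢.field (fun n => f n • 𝔢.bracketSec σ τ n +
        dirDeriv (𝔢.anchor n (σ n)) f • τ n) := by
      rw [field_bracketSec, hτ, field_smul]
      refine 𝔢.field_eq fun m => ?_
      rw [SmoothMfd.IsSmooth.leibniz (f := fun m => f (P.bp m)) (hf.comp P.bp_smooth) (𝔢.isSmooth_field τ) m, map_add, map_smul,
        map_smul, lin_field, ← field_bracketSec, lin_field, add_comm]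
      congr 2
      refine (LieAlgebroid.dirDeriv_comp _ P.bp_smooth hf).trans ?_
      rw [← 𝔢.anchor_lin, lin_field]
    exact congrFun (𝔢.field_injective key) n

end AtiyahBundle

end QPrincipalBundle

/-! ### Pairs and projections of Q-smooth maps -/

section

variable {E₁ H₁ E₂ H₂ E₃ H₃ : Type}
  [NormedAddCommGroup E₁] [NormedSpace ℝ E₁] [TopologicalSpace H₁]
  [NormedAddCommGroup E₂] [NormedSpace ℝ E₂] [TopologicalSpace H₂]
  [NormedAddCommGroup E₃] [NormedSpace ℝ E₃] [TopologicalSpace H₃]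
  {M₁ M₂ M₃ S₁ S₂ S₃ : Type u}
  [TopologicalSpace M₁] [ChartedSpace H₁ M₁]
  [TopologicalSpace M₂] [ChartedSpace H₂ M₂]
  [TopologicalSpace M₃] [ChartedSpace H₃ M₃]
  {I₁ : ModelWithCorners ℝ E₁ H₁} {I₂ : ModelWithCorners ℝ E₂ H₂} {I₃ : ModelWithCorners ℝ E₃ H₃}
  {q₁ : M₁ → S₁} {q₂ : M₂ → S₂} {q₃ : M₃ → S₃}

theorem QSmooth.of_exists_lift {f : S₁ → S₂} (h : ∀ x y, f (q₁ x) = q₂ y → ∃ g : M₁ → M₂,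
    g x = y ∧ SmoothNear I₁ I₂ g x ∧ ∀ᶠ z in 𝓝 x, q₂ (g z) = f (q₁ z)) :
    QSmooth I₁ I₂ q₁ q₂ f := by
  refine QSmooth.of_lift fun x y hxy => ?_
  obtain ⟨g, h1, h2, h3⟩ := h x y hxy
  obtain ⟨U, hUs, hU, hxU⟩ := mem_nhds_iff.1 (h2.and h3)
  exact ⟨U, g, hU, hxU, fun z hz => (hUs hz).1.contMDiffWithinAt, h1, fun z hz => (hUs hz).2⟩

theorem QSmooth.prodMk {f : S₁ → S₂} {f' : S₁ → S₃} (hf : QSmooth I₁ I₂ q₁ q₂ f)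
    (hf' : QSmooth I₁ I₃ q₁ q₃ f') :
    QSmooth I₁ (I₂.prod I₃) q₁ (Prod.map q₂ q₃) (fun s => (f s, f' s)) := by
  refine QSmooth.of_exists_lift fun x y hxy => ?_
  obtain ⟨g, g1, g2, g3⟩ := hf.exists_lift (x := x) (y := y.1) (congrArg Prod.fst hxy)
  obtain ⟨g', g1', g2', g3'⟩ := hf'.exists_lift (x := x) (y := y.2) (congrArg Prod.snd hxy)
  refine ⟨fun z => (g z, g' z), Prod.ext g1 g1', g2.prodMk g2', ?_⟩
  filter_upwards [g3, g3'] with z h h' using Prod.ext h h'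

theorem QSmooth.comp_fst {f : S₁ → S₃} (hf : QSmooth I₁ I₃ q₁ q₃ f) :
    QSmooth (I₁.prod I₂) I₃ (Prod.map q₁ q₂) q₃ (fun s : S₁ × S₂ => f s.1) := by
  refine QSmooth.of_exists_lift fun x y hxy => ?_
  obtain ⟨g, g1, g2, g3⟩ := hf.exists_lift hxy
  exact ⟨fun z => g z.1, g1, g2.comp_of_eq (contMDiff_fst.smoothNear x) rfl,
    continuousAt_fst.eventually g3⟩

theorem QSmooth.comp_snd {f : S₂ → S₃} (hf : QSmooth I₂ I₃ q₂ q₃ f) :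
    QSmooth (I₁.prod I₂) I₃ (Prod.map q₁ q₂) q₃ (fun s : S₁ × S₂ => f s.2) := by
  refine QSmooth.of_exists_lift fun x y hxy => ?_
  obtain ⟨g, g1, g2, g3⟩ := hf.exists_lift hxy
  exact ⟨fun z => g z.2, g1, g2.comp_of_eq (contMDiff_snd.smoothNear x) rfl,
    continuousAt_snd.eventually g3⟩

end

namespace QGroup

variable {G H : QGroup.{u}}

/-! ### The Lie algebra as a vector space -/

variable (G) in
/-- A point of the atlas over the unit. -/
noncomputable abbrev unit : G.atlas := (G.surjective 1).choose

variable (G) in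
theorem chart_unit : G.chart G.unit = 1 := (G.surjective 1).choose_spec

theorem lieMk_injective {e : G.atlas} (he : G.chart e = 1) : Injective (lieMk he) := fun _ _ h =>
  G.tmk_injective (congrArg Subtype.val h)

theorem lieMk_surjective {e : G.atlas} (he : G.chart e = 1) : Surjective (lieMk he) := fun w => by
  obtain ⟨v, hv⟩ := G.exists_tmk_eq w.1 e (w.2.trans he.symm)
  exact ⟨v, Subtype.ext hv⟩

variable (G) in
/-- The Lie algebra as the tangent space at a point of the atlas over the unit. -/
noncomputable def lieEquiv : G.LieAlg ≃ G.atlas.T G.unit :=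
  (Equiv.ofBijective _ ⟨lieMk_injective G.chart_unit, lieMk_surjective G.chart_unit⟩).symm

/-- The structure is transported from one chosen point over the unit; `lieMkEquiv` shows that every
other point over the unit gives the same one. -/
noncomputable instance : AddCommGroup G.LieAlg := G.lieEquiv.addCommGroup

noncomputable instance : Module ℝ G.LieAlg := G.lieEquiv.module ℝ

/-- Once representatives at fixed points are used, a tangent map is the derivative of a single lift,
hence linear. -/
theorem exists_lieMk_eq {S : QManifold.{u}} {f : G → S} (hf : G.Smooth S f) {e : G.atlas}
    {y : S.atlas} (hy : f (G.chart e) = S.chart y) :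
    ∃ L : G.atlas.T e →ₗ[ℝ] S.atlas.T y, ∀ v, hf.tmap (G.tmk e v) = S.tmk y (L v) := by
  obtain ⟨g, rfl, h2, h3⟩ := hf.exists_lift hy
  exact ⟨(mfderiv (𝓡 G.atlas.dim) (𝓡 S.atlas.dim) g e).toLinearMap,
    fun v => hf.tmap_tcls ⟨e, v⟩ h2 h3⟩

/-- The Lie algebra as the tangent space at any point of the atlas over the unit. -/
noncomputable def lieMkEquiv {e : G.atlas} (he : G.chart e = 1) : G.atlas.T e ≃ₗ[ℝ] G.LieAlg :=
  LinearEquiv.ofBijective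
    (show IsLinearMap ℝ (lieMk he) by
      obtain ⟨L, hL⟩ := exists_lieMk_eq G.smooth_id (he.trans G.chart_unit.symm)
      have h : ∀ v, lieMk he v = G.lieEquiv.symm (L v) := fun v => Subtype.ext (by
        refine Eq.trans ?_ (hL v)
        exact (QManifold.Smooth.tmap_id _ _).symm)
      refine ⟨fun v w => ?_, fun c v => ?_⟩
      · rw [h, h, h, map_add]
        exact map_add (G.lieEquiv.linearEquiv ℝ).symm _ _
      · rw [h, h, map_smul]
        exact map_smul (G.lieEquiv.linearEquiv ℝ).symm _ _).mk'
    ⟨lieMk_injective he, lieMk_surjective he⟩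

@[simp] theorem lieMkEquiv_apply {e : G.atlas} (he : G.chart e = 1) (v : G.atlas.T e) :
    lieMkEquiv he v = lieMk he v := rfl

/-- The coordinates of the Lie algebra at a point of the atlas over the unit. -/
noncomputable def coord {e : G.atlas} (he : G.chart e = 1) :
    G.LieAlg ≃ₗ[ℝ] EuclideanSpace ℝ (Fin G.atlas.dim) := (lieMkEquiv he).symm

theorem lieMk_symm {e : G.atlas} (he : G.chart e = 1) (w : G.LieAlg) :
    lieMk he ((lieMkEquiv he).symm w) = w := (lieMkEquiv he).apply_symm_apply w

/-- The linear map of Lie algebras that is induced by a Q-smooth map that preserves the unit. -/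
noncomputable def lieMap {f : G → H} (hf : G.Smooth H.toQManifold f) (h1 : f 1 = 1) :
    G.LieAlg →ₗ[ℝ] H.LieAlg :=
  let F : G.LieAlg → H.LieAlg := fun w =>
    ⟨hf.tmap w.1, by rw [QManifold.Smooth.tproj_tmap, w.2, h1]⟩
  -- Linearity is proved through an auxiliary linear map with the same values, so that the
  -- underlying function stays the tangent map by definition.
  have key : ∃ L : G.LieAlg →ₗ[ℝ] H.LieAlg, ∀ w, F w = L w := by
    obtain ⟨L, hL⟩ := exists_lieMk_eq hf (e := G.unit) (y := H.unit)
      (by rw [G.chart_unit, h1, H.chart_unit])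
    refine ⟨(lieMkEquiv H.chart_unit).toLinearMap.comp
      (L.comp (lieMkEquiv G.chart_unit).symm.toLinearMap), fun w => Subtype.ext ?_⟩
    refine Eq.trans ?_ (hL _)
    exact congrArg (fun w : G.LieAlg => hf.tmap w.1) (lieMk_symm G.chart_unit w).symm
  { toFun := F
    map_add' := fun v w => by
      obtain ⟨L, hL⟩ := key
      rw [hL, hL, hL, map_add]
    map_smul' := fun c v => by
      obtain ⟨L, hL⟩ := key
      rw [hL, hL, map_smul]; rfl }

theorem lieMap_val {f : G → H} (hf : G.Smooth H.toQManifold f) (h1 : f 1 = 1) (w : G.LieAlg) :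
    (lieMap hf h1 w).1 = hf.tmap w.1 := rfl

theorem conj_one (g : G) : g * 1 * g⁻¹ = 1 := by simp

/-! ### Right-invariant vector fields -/

theorem rightField_eq {w : G.LieAlg} {m : G.atlas} {v : G.atlas.T m}
    (h : G.tmk m v = (G.smooth_mul_right (G.chart m)).tmap w.1) : rightField w m = v :=
  G.tmk_injective ((tmk_rightField w m).trans h.symm)

theorem exists_rightField_eq (m : G.atlas) : ∃ L : G.LieAlg →ₗ[ℝ] G.atlas.T m,
    ∀ w, rightField w m = L w := by
  obtain ⟨L, hL⟩ := exists_lieMk_eq (G.smooth_mul_right (G.chart m)) (e := G.unit) (y := m)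
    (by rw [G.chart_unit, one_mul])
  refine ⟨L.comp (lieMkEquiv G.chart_unit).symm.toLinearMap, fun w => rightField_eq ?_⟩
  refine (hL _).symm.trans ?_
  exact congrArg (fun w : G.LieAlg => (G.smooth_mul_right (G.chart m)).tmap w.1)
    (lieMk_symm G.chart_unit w)

theorem rightField_add (w v : G.LieAlg) : rightField (w + v) = rightField w + rightField v := by
  funext m
  obtain ⟨L, hL⟩ := exists_rightField_eq m
  rw [Pi.add_apply, hL, hL, hL, map_add]

theorem rightField_smul (c : ℝ) (w : G.LieAlg) : rightField (c • w) = c • rightField w := by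
  funext m
  obtain ⟨L, hL⟩ := exists_rightField_eq m
  rw [Pi.smul_apply, hL, hL, map_smul]

theorem rightField_zero : rightField (0 : G.LieAlg) = 0 := by
  funext m
  obtain ⟨L, hL⟩ := exists_rightField_eq m
  rw [hL, map_zero]; rfl

theorem lieMk_rightField {e : G.atlas} (he : G.chart e = 1) (w : G.LieAlg) :
    lieMk he (rightField w e) = w := by
  refine Subtype.ext ((tmk_rightField w e).trans ?_)
  rw [QManifold.Smooth.tmap_congr _ G.smooth_id (funext fun x => by rw [he, mul_one]),
    QManifold.Smooth.tmap_id]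

theorem rightField_injective {w v : G.LieAlg} (h : rightField w = rightField v) : w = v := by
  rw [← lieMk_rightField G.chart_unit w, h, lieMk_rightField]

/-- Let `μ` lift the multiplication near `(1, m)`, with `μ (unit, z) = z` by rigidity. The
right-invariant field at `z` is the derivative of `μ (·, z)` at the fixed point `unit` applied to a
fixed vector, and it depends smoothly on the parameter `z`. -/
theorem isSmooth_rightField (w : G.LieAlg) : SmoothMfd.IsSmooth (rightField w) := by
  intro m
  have hm1 : G.chart G.unit * G.chart m = G.chart m := by rw [G.chart_unit, one_mul]
  obtain ⟨μ, h1, h2, h3⟩ := G.smooth_mul.exists_lift (x := (G.unit, m)) (y := m) hm1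
  let x := (lieMkEquiv G.chart_unit).symm w
  have hi : ContinuousAt (fun z : G.atlas => (G.unit, z)) m := by fun_prop
  have h2' : SmoothNear (𝓡 G.atlas.dim) (𝓡 G.atlas.dim) (fun z => μ (G.unit, z)) m :=
    SmoothNear.comp (f := fun z : G.atlas => (G.unit, z)) h2
      ((smoothNear_const _ _).prodMk (smoothNear_id _))
  have hid : (fun z => μ (G.unit, z)) =ᶠ[𝓝 m] fun z => z := by
    refine G.eventuallyEq_of_chart_eq h2' (smoothNear_id m) ?_ h1
    filter_upwards [hi.eventually h3] with z hz
    rw [hz]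
    simp only [Prod.map_apply, G.chart_unit, one_mul]
  have key := contMDiffAt_tangentMap_param (J := 𝓡 G.atlas.dim) (g := μ)
    (V := fun _ : G.atlas => (⟨G.unit, x⟩ : TangentBundle (𝓡 G.atlas.dim) G.atlas))
    (c := fun z : G.atlas => z) (t₀ := m) h2.contMDiffAt contMDiffAt_const contMDiffAt_id
  refine key.congr_of_eventuallyEq ?_
  filter_upwards [hid, hi.eventually (eventually_eventually_nhds.2 h3), hi.eventually h2.eventually]
    with z hz h4 h5
  have hi' : ContinuousAt (fun y : G.atlas => (y, z)) G.unit := by fun_prop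
  refine G.tcls_injective_of_proj_eq ?_ hz.symm
  refine (tmk_rightField w z).trans ?_
  rw [← lieMk_symm G.chart_unit w]
  refine (G.smooth_mul_right (G.chart z)).tmap_tcls ⟨G.unit, x⟩ ?_ (hi'.eventually h4)
  exact SmoothNear.comp (f := fun y : G.atlas => (y, z)) h5
    ((smoothNear_id _).prodMk (smoothNear_const _ _))

/-- Maps that intertwine the multiplications from the left relate right-invariant vector fields. -/
theorem mfderiv_rightField {f Λ : G → H} (hf : G.Smooth H.toQManifold f)
    (hΛ : G.Smooth H.toQManifold Λ) (h1 : Λ 1 = 1) (h : ∀ x y, f (x * y) = Λ x * f y)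
    {θ : G.atlas → H.atlas} {m : G.atlas} (hθ : SmoothNear (𝓡 G.atlas.dim) (𝓡 H.atlas.dim) θ m)
    (hl : ∀ᶠ z in 𝓝 m, H.chart (θ z) = f (G.chart z)) (w : G.LieAlg) :
    mfderiv (𝓡 G.atlas.dim) (𝓡 H.atlas.dim) θ m (rightField w m) =
      rightField (lieMap hΛ h1 w) (θ m) := by
  refine (rightField_eq ?_).symm
  refine (hf.tmap_tcls ⟨m, rightField w m⟩ hθ hl).symm.trans ?_
  have e1 : G.tcls ⟨m, rightField w m⟩ = _ := tmk_rightField w m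
  have hc : G.Smooth H.toQManifold (fun x => f (x * G.chart m)) :=
    hf.comp (G.smooth_mul_right _) G.surjective
  have hc' : G.Smooth H.toQManifold (fun x => Λ x * H.chart (θ m)) :=
    (H.smooth_mul_right _).comp hΛ H.surjective
  rw [e1, lieMap_val, ← hf.tmap_comp _ hc, ← QManifold.Smooth.tmap_comp _ _ hc']
  exact QManifold.Smooth.tmap_congr _ _ (funext fun x => by rw [h, hl.self_of_nhds]) _

/-- Related fields have related brackets. With `f` a right translation and `Λ` the identity this
gives right-invariance of the bracket; with `f = Λ` a homomorphism it makes the tangent map at `1` a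
homomorphism of Lie algebras. -/
theorem mfderiv_mlieBracket_rightField {f Λ : G → H} (hf : G.Smooth H.toQManifold f)
    (hΛ : G.Smooth H.toQManifold Λ) (h1 : Λ 1 = 1) (h : ∀ x y, f (x * y) = Λ x * f y)
    {θ : G.atlas → H.atlas} {m : G.atlas} (hθ : SmoothNear (𝓡 G.atlas.dim) (𝓡 H.atlas.dim) θ m)
    (hl : ∀ᶠ z in 𝓝 m, H.chart (θ z) = f (G.chart z)) (w v : G.LieAlg) :
    mfderiv (𝓡 G.atlas.dim) (𝓡 H.atlas.dim) θ m
      (VectorField.mlieBracket (𝓡 G.atlas.dim) (rightField w) (rightField v) m) =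
      VectorField.mlieBracket (𝓡 H.atlas.dim) (rightField (lieMap hΛ h1 w))
        (rightField (lieMap hΛ h1 v)) (θ m) := by
  refine VectorField.mfderiv_mlieBracket_of_related hθ.contMDiffAt
    ((isSmooth_rightField w).mdifferentiableAt m) ((isSmooth_rightField v).mdifferentiableAt m)
    ((isSmooth_rightField _).mdifferentiableAt _) ((isSmooth_rightField _).mdifferentiableAt _) ?_ ?_
  all_goals
    filter_upwards [hθ.eventually, eventually_eventually_nhds.2 hl] with z h2 h3
    exact mfderiv_rightField hf hΛ h1 h h2 h3 _

theorem lieMap_id (w : G.LieAlg) : lieMap G.smooth_id rfl w = w :=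
  Subtype.ext (QManifold.Smooth.tmap_id _ _)

/-- The bracket of right-invariant vector fields is right-invariant. -/
theorem rightField_lieBracket (w v : G.LieAlg) : rightField (lieBracket w v) =
    VectorField.mlieBracket (𝓡 G.atlas.dim) (rightField w) (rightField v) := by
  funext m
  obtain ⟨k, rfl, h2, h3⟩ := (G.smooth_mul_right (G.chart m)).exists_lift (x := G.unit) (y := m)
    (by rw [G.chart_unit, one_mul])
  have h4 := mfderiv_mlieBracket_rightField (G.smooth_mul_right (G.chart (k G.unit))) G.smooth_id rfl
    (fun x y => mul_assoc _ _ _) h2 h3 w v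
  rw [lieMap_id, lieMap_id] at h4
  rw [← h4]
  exact rightField_eq ((G.smooth_mul_right (G.chart (k G.unit))).tmap_tcls ⟨G.unit, _⟩ h2 h3).symm

/-- A homomorphism relates the right-invariant fields of `w` and of its image, hence also their
brackets; evaluation at a point over the unit recovers the elements of the Lie algebra. -/
theorem lieMap_lieBracket {f : G → H} (hf : G.Smooth H.toQManifold f) (h1 : f 1 = 1)
    (h : ∀ x y, f (x * y) = f x * f y) (w v : G.LieAlg) :
    lieMap hf h1 (lieBracket w v) = lieBracket (lieMap hf h1 w) (lieMap hf h1 v) := by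
  obtain ⟨θ, e1, h2, h3⟩ := hf.exists_lift (x := G.unit) (y := H.unit)
    (by rw [G.chart_unit, h1, H.chart_unit])
  have h4 := mfderiv_mlieBracket_rightField hf hf h1 h h2 h3 w v
  rw [← rightField_lieBracket, ← rightField_lieBracket, mfderiv_rightField hf hf h1 h h2 h3] at h4
  have he : H.chart (θ G.unit) = 1 := by rw [e1, H.chart_unit]
  rw [← lieMk_rightField he (lieMap hf h1 (lieBracket w v)), h4, lieMk_rightField]

theorem Ad_lieBracket (g : G) (w v : G.LieAlg) :
    Ad g (lieBracket w v) = lieBracket (Ad g w) (Ad g v) :=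
  lieMap_lieBracket (G.smooth_conj g) (conj_one g) (fun x y => by group) w v

variable (G) in
/-- The Lie bracket as a bilinear map. -/
noncomputable def lieBracketₗ : G.LieAlg →ₗ[ℝ] G.LieAlg →ₗ[ℝ] G.LieAlg :=
  LinearMap.mk₂ ℝ lieBracket
    (fun w w' v => rightField_injective (by
      simp only [rightField_lieBracket, rightField_add]
      exact (isSmooth_rightField w).mlieBracket_add_left (isSmooth_rightField w')))
    (fun c w v => rightField_injective (by
      simp only [rightField_lieBracket, rightField_smul]
      exact (isSmooth_rightField w).mlieBracket_smul_left c))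
    (fun w v v' => rightField_injective (by
      simp only [rightField_lieBracket, rightField_add]
      exact (isSmooth_rightField v).mlieBracket_add_right (isSmooth_rightField v')))
    (fun c w v => rightField_injective (by
      simp only [rightField_lieBracket, rightField_smul]
      exact (isSmooth_rightField v).mlieBracket_smul_right c))

@[simp] theorem lieBracketₗ_apply (w v : G.LieAlg) : G.lieBracketₗ w v = lieBracket w v := rfl

theorem lieBracket_self (w : G.LieAlg) : lieBracket w w = 0 := rightField_injective (by
  rw [rightField_lieBracket, VectorField.mlieBracket_self, rightField_zero])

/-- Inherited from vector fields on the atlas, since an element of the Lie algebra is determined by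
its right-invariant field. -/
theorem lieBracket_jacobi (w v u : G.LieAlg) : lieBracket w (lieBracket v u) =
    lieBracket (lieBracket w v) u + lieBracket v (lieBracket w u) := rightField_injective (by
  simp only [rightField_lieBracket, rightField_add]
  exact (isSmooth_rightField w).jacobi (isSmooth_rightField v) (isSmooth_rightField u))

/-! ### The adjoint action -/

theorem Ad_one (w : G.LieAlg) : Ad 1 w = w := by
  refine Subtype.ext ?_
  change (G.smooth_conj 1).tmap w.1 = w.1
  rw [QManifold.Smooth.tmap_congr _ G.smooth_id (funext fun x => by simp), QManifold.Smooth.tmap_id]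

theorem Ad_mul (g h : G) (w : G.LieAlg) : Ad (g * h) w = Ad g (Ad h w) := by
  refine Subtype.ext ?_
  change (G.smooth_conj (g * h)).tmap w.1 = (G.smooth_conj g).tmap ((G.smooth_conj h).tmap w.1)
  have hc : G.Smooth G.toQManifold (fun x => g * (h * x * h⁻¹) * g⁻¹) :=
    (G.smooth_conj g).comp (G.smooth_conj h) G.surjective
  rw [← QManifold.Smooth.tmap_comp _ _ hc]
  exact QManifold.Smooth.tmap_congr _ _ (funext fun x => by group) _

variable (G) in
-- The conjugated element comes first because `contMDiffAt_tangentMap_param` differentiates in the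
-- first variable and treats the second as a parameter.
theorem smooth_conj_pair : QSmooth ((𝓡 G.atlas.dim).prod (𝓡 G.atlas.dim)) (𝓡 G.atlas.dim)
    (Prod.map G.chart G.chart) G.chart (fun x : G × G => x.2 * x.1 * x.2⁻¹) :=
  G.smooth_mul.comp ((G.smooth_mul.comp (G.smooth_id.comp_snd.prodMk G.smooth_id.comp_fst)
    (G.surjective.prodMap G.surjective)).prodMk (QSmooth.comp_snd G.smooth_inv))
    (G.surjective.prodMap G.surjective)

/-- The adjoint action is smooth. -/
theorem contMDiffAt_Ad {T : SmoothMfd.{u}} {γ : T → G.atlas}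
    {E H : Type*} [NormedAddCommGroup E] [NormedSpace ℝ E] [TopologicalSpace H]
    {J : ModelWithCorners ℝ E H} {T' : Type*} [TopologicalSpace T'] [ChartedSpace H T']
    [IsManifold J ∞ T'] {k : T' → T} {X : T' → EuclideanSpace ℝ (Fin G.atlas.dim)} {t : T'}
    (hγ : SmoothNear (𝓡 T.dim) (𝓡 G.atlas.dim) γ (k t)) (hk : ContMDiffAt J (𝓡 T.dim) ∞ k t)
    (hX : ContMDiffAt J (𝓡 G.atlas.dim) ∞ X t) {e e' : G.atlas} (he : G.chart e = 1)
    (he' : G.chart e' = 1) :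
    ContMDiffAt J (𝓡 G.atlas.dim) ∞ (fun z => coord he' (Ad (G.chart (γ (k z))) (lieMk he (X z)))) t := by
  obtain ⟨C, h1, h2, h3⟩ := G.smooth_conj_pair.exists_lift (x := (e, γ (k t))) (y := e')
    (by simp [he, he'])
  have hi : SmoothNear (𝓡 T.dim) ((𝓡 G.atlas.dim).prod (𝓡 G.atlas.dim)) (fun z => (e, γ z)) (k t) :=
    (smoothNear_const _ _).prodMk hγ
  -- Conjugation fixes the unit, so this lifts a constant map and is constant by rigidity. All
  -- derivatives of `C (·, γ z)` at `e` therefore land in the single tangent space at `e'`.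
  have hid : (fun z => C (e, γ z)) =ᶠ[𝓝 (k t)] fun _ => e' := by
    refine G.eventuallyEq_of_chart_eq (SmoothNear.comp (f := fun z => (e, γ z)) h2 hi) (smoothNear_const _ _) ?_ h1
    filter_upwards [hi.continuousAt.eventually h3] with z hz
    rw [hz]
    simp [he, he']
  let te := trivializationAt (EuclideanSpace ℝ (Fin G.atlas.dim))
    (TangentSpace (𝓡 G.atlas.dim) (M := G.atlas)) e
  have hte : e ∈ te.baseSet := FiberBundle.mem_baseSet_trivializationAt _ _ _
  let te' := trivializationAt (EuclideanSpace ℝ (Fin G.atlas.dim))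
    (TangentSpace (𝓡 G.atlas.dim) (M := G.atlas)) e'
  have hte' : e' ∈ te'.baseSet := FiberBundle.mem_baseSet_trivializationAt _ _ _
  have hV : ContMDiffAt J (𝓡 G.atlas.dim).tangent ∞
      (fun z => (⟨e, X z⟩ : TangentBundle (𝓡 G.atlas.dim) G.atlas)) t := by
    rw [Bundle.contMDiffAt_totalSpace]
    refine ⟨contMDiffAt_const, ?_⟩
    -- At the fixed point `e` the trivialization is one fixed linear isomorphism, so smoothness of
    -- the vector part is the same as smoothness of `X`.
    let A : EuclideanSpace ℝ (Fin G.atlas.dim) ≃L[ℝ] EuclideanSpace ℝ (Fin G.atlas.dim) :=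
      te.continuousLinearEquivAt ℝ e hte
    exact A.toContinuousLinearMap.contMDiff.contMDiffAt.comp t hX
  have key := contMDiffAt_tangentMap_param (g := C) (c := fun z => γ (k z)) h2.contMDiffAt hV
    (hγ.contMDiffAt.comp t hk)
  have hc := hi.continuousAt.comp_of_eq hk.continuousAt rfl
  have key2 : ContMDiffAt J (𝓡 G.atlas.dim).tangent ∞ (fun z => (⟨e', coord he'
      (Ad (G.chart (γ (k z))) (lieMk he (X z)))⟩ : TangentBundle (𝓡 G.atlas.dim) G.atlas)) t := by
    refine key.congr_of_eventuallyEq ?_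
    filter_upwards [hk.continuousAt.eventually hid, hc.eventually h2.eventually,
      hc.eventually (eventually_eventually_nhds.2 h3)] with z h4 h5 h6
    have hi' : ContinuousAt (fun y : G.atlas => (y, γ (k z))) e := by fun_prop
    refine G.tcls_injective_of_proj_eq ?_ h4.symm
    refine (congrArg Subtype.val (lieMk_symm he' _)).trans ?_
    refine (G.smooth_conj (G.chart (γ (k z)))).tmap_tcls ⟨e, X z⟩ ?_ (hi'.eventually h6)
    exact SmoothNear.comp (f := fun y : G.atlas => (y, γ (k z))) h5
      ((smoothNear_id _).prodMk (smoothNear_const _ _))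
  have key3 := (Bundle.contMDiffAt_totalSpace.1 key2).2
  let A : EuclideanSpace ℝ (Fin G.atlas.dim) ≃L[ℝ] EuclideanSpace ℝ (Fin G.atlas.dim) :=
    te'.continuousLinearEquivAt ℝ e' hte'
  have key4 := A.symm.toContinuousLinearMap.contMDiff.contMDiffAt.comp t key3
  refine key4.congr_of_eventuallyEq (Filter.Eventually.of_forall fun z => ?_)
  exact (A.symm_apply_apply _).symm

end QGroup

namespace QPrincipalBundle

variable {P : QPrincipalBundle.{u}}

/-! ### The adjoint bundle -/

theorem adMk_act (p : P.total) (g : P.group) (w : P.group.LieAlg) :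
    P.adMk (P.act p g) w = P.adMk p (QGroup.Ad g w) := by
  refine (Quot.sound ⟨g, ?_⟩ : P.adMk p (QGroup.Ad g w) = P.adMk (P.act p g) w).symm
  refine Prod.ext rfl ?_
  change w = QGroup.Ad g⁻¹ (QGroup.Ad g w)
  rw [← QGroup.Ad_mul, inv_mul_cancel, QGroup.Ad_one]

/-- As for `(TP)/G`, the generating relation is the orbit relation of a group action, so it needs no
closure. -/
theorem adMk_eq_iff {p p' : P.total} {w w' : P.group.LieAlg} : P.adMk p w = P.adMk p' w' ↔
    ∃ g, p' = P.act p g ∧ w = QGroup.Ad g w' := by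
  constructor
  · intro h
    have key : ∀ x y : P.total × P.group.LieAlg, Relation.EqvGen (fun x y =>
        ∃ g : P.group, y = (P.act x.1 g, QGroup.Ad g⁻¹ x.2)) x y →
        ∃ g, y.1 = P.act x.1 g ∧ x.2 = QGroup.Ad g y.2 := by
      intro x y hr
      induction hr with
      | rel x _ h =>
        obtain ⟨g, rfl⟩ := h
        exact ⟨g, rfl, by rw [← QGroup.Ad_mul, mul_inv_cancel, QGroup.Ad_one]⟩
      | refl x => exact ⟨1, (P.act_one _).symm, (QGroup.Ad_one _).symm⟩
      | symm x y _ ih =>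
        obtain ⟨g, h1, h2⟩ := ih
        refine ⟨g⁻¹, ?_, ?_⟩
        · rw [h1, ← P.act_mul, mul_inv_cancel, P.act_one]
        · rw [h2, ← QGroup.Ad_mul, inv_mul_cancel, QGroup.Ad_one]
      | trans x y z _ _ ih₁ ih₂ =>
        obtain ⟨g, h1, h2⟩ := ih₁
        obtain ⟨k, h3, h4⟩ := ih₂
        exact ⟨g * k, by rw [h3, h1, P.act_mul], by rw [h2, h4, QGroup.Ad_mul]⟩
    exact key _ _ (Quot.eqvGen_exact h)
  · rintro ⟨g, rfl, rfl⟩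
    rw [adMk_act]

/-- By freeness only `g = 1` fixes `p`, so a class has at most one representative over `p`. -/
theorem adMk_injective (p : P.total) : Injective (P.adMk p) := by
  intro w v h
  obtain ⟨g, h1, rfl⟩ := adMk_eq_iff.1 h
  rw [P.act_free p g h1.symm, QGroup.Ad_one]

theorem exists_adMk_eq (l : P.AdBundle) {p : P.total} (h : P.proj p = P.adProj l) :
    ∃ w, P.adMk p w = l := by
  induction l using Quot.inductionOn with
  | h x =>
    obtain ⟨g, rfl⟩ := (P.fiber_eq_orbit x.1 p).1 h
    refine ⟨QGroup.Ad g⁻¹ x.2, ?_⟩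
    rw [adMk_act, ← QGroup.Ad_mul, mul_inv_cancel, QGroup.Ad_one]
    rfl

variable (P) in
/-- An identification of `P ×_Ad 𝔤` with the total space of a smooth vector bundle for which the
quotient map from `P × 𝔤` is smooth and fibrewise linear. -/
structure AdLieBundle (r : ℕ) (E : P.base → Type u) [∀ n, AddCommGroup (E n)]
    [∀ n, Module ℝ (E n)] [∀ n, TopologicalSpace (E n)]
    [TopologicalSpace (Bundle.TotalSpace (EuclideanSpace ℝ (Fin r)) E)]
    [FiberBundle (EuclideanSpace ℝ (Fin r)) E] [VectorBundle ℝ (EuclideanSpace ℝ (Fin r)) E] where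
  e : ∀ n, {l : P.AdBundle // P.adProj l = n} ≃ E n
  linear : ∀ p k (hk : P.group.chart k = 1), IsLinearMap ℝ (fun v => e _ (P.adCls p hk v))
  smooth : ∀ k (hk : P.group.chart k = 1),
    ContMDiff ((𝓡 P.total.atlas.dim).prod (𝓡 P.group.atlas.dim)) ((𝓡 P.base.dim).prod (𝓡 r)) ∞
      (fun x : P.total.atlas × EuclideanSpace ℝ (Fin P.group.atlas.dim) =>
        (⟨P.proj (P.total.chart x.1), e _ (P.adCls (P.total.chart x.1) hk x.2)⟩ :
          Bundle.TotalSpace (EuclideanSpace ℝ (Fin r)) E))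

namespace AdLieBundle

section

variable {r : ℕ} {E : P.base → Type u} [∀ n, AddCommGroup (E n)]
    [∀ n, Module ℝ (E n)] [∀ n, TopologicalSpace (E n)]
    [TopologicalSpace (Bundle.TotalSpace (EuclideanSpace ℝ (Fin r)) E)]
    [FiberBundle (EuclideanSpace ℝ (Fin r)) E] [VectorBundle ℝ (EuclideanSpace ℝ (Fin r)) E]
    (𝔩 : P.AdLieBundle r E)

/-- The isomorphism `w ↦ [(p, w)]` from the Lie algebra to a fibre. -/
noncomputable def linAt {n : P.base} {p : P.total} (h : P.proj p = n) :
    P.group.LieAlg ≃ₗ[ℝ] E n :=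
  LinearEquiv.ofBijective
    { toFun := fun w => 𝔩.e n ⟨P.adMk p w, h⟩
      map_add' := fun w v => by
        subst h
        rw [← QGroup.lieMk_symm P.group.chart_unit w, ← QGroup.lieMk_symm P.group.chart_unit v]
        have h1 := map_add (QGroup.lieMkEquiv P.group.chart_unit)
          ((QGroup.lieMkEquiv P.group.chart_unit).symm w)
          ((QGroup.lieMkEquiv P.group.chart_unit).symm v)
        rw [← QGroup.lieMkEquiv_apply, ← QGroup.lieMkEquiv_apply, ← h1]
        exact (𝔩.linear p _ P.group.chart_unit).map_add _ _
      map_smul' := fun c w => by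
        subst h
        rw [← QGroup.lieMk_symm P.group.chart_unit w]
        have h1 := map_smul (QGroup.lieMkEquiv P.group.chart_unit) c
          ((QGroup.lieMkEquiv P.group.chart_unit).symm w)
        rw [← QGroup.lieMkEquiv_apply, ← h1]
        exact (𝔩.linear p _ P.group.chart_unit).map_smul _ _ }
    ⟨fun w v hwv => adMk_injective p (congrArg Subtype.val ((𝔩.e n).injective hwv)), fun a => by
      obtain ⟨w, hw⟩ := exists_adMk_eq ((𝔩.e n).symm a).1 (h.trans ((𝔩.e n).symm a).2.symm)
      refine ⟨w, ?_⟩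
      change 𝔩.e n ⟨P.adMk p w, h⟩ = a
      rw [← Equiv.eq_symm_apply]
      exact Subtype.ext hw⟩

theorem linAt_eq_iff {n : P.base} {p p' : P.total} (h : P.proj p = n) (h' : P.proj p' = n)
    (w w' : P.group.LieAlg) : 𝔩.linAt h w = 𝔩.linAt h' w' ↔ P.adMk p w = P.adMk p' w' :=
  (𝔩.e n).apply_eq_iff_eq.trans Subtype.ext_iff

/-- The quotient map with respect to a point of the atlas of the group over the unit. -/
def quot {k : P.group.atlas} (hk : P.group.chart k = 1)
    (x : P.total.atlas × EuclideanSpace ℝ (Fin P.group.atlas.dim)) :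
    Bundle.TotalSpace (EuclideanSpace ℝ (Fin r)) E :=
  ⟨P.bp x.1, 𝔩.e _ (P.adCls (P.total.chart x.1) hk x.2)⟩

theorem contMDiff_quot {k : P.group.atlas} (hk : P.group.chart k = 1) :
    ContMDiff ((𝓡 P.total.atlas.dim).prod (𝓡 P.group.atlas.dim)) ((𝓡 P.base.dim).prod (𝓡 r)) ∞
      (𝔩.quot hk) := 𝔩.smooth k hk

theorem mk_linAt {n : P.base} {m : P.total.atlas} (h : P.bp m = n) {k : P.group.atlas}
    (hk : P.group.chart k = 1) (w : P.group.LieAlg) :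
    (⟨n, 𝔩.linAt h w⟩ : Bundle.TotalSpace (EuclideanSpace ℝ (Fin r)) E) =
      𝔩.quot hk (m, QGroup.coord hk w) := by
  subst h
  exact congrArg (fun w => (⟨P.bp m, 𝔩.linAt rfl w⟩ : Bundle.TotalSpace _ E))
    (QGroup.lieMk_symm hk w).symm

open Classical in
/-- The element of the Lie algebra which represents an element of a fibre at a point. -/
noncomputable def vec {n : P.base} (a : E n) (p : P.total) : P.group.LieAlg :=
  if h : P.proj p = n then (𝔩.linAt h).symm a else 0

theorem vec_eq {n : P.base} (a : E n) {p : P.total} (h : P.proj p = n) :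
    𝔩.vec a p = (𝔩.linAt h).symm a := dif_pos h

@[simp] theorem linAt_vec {n : P.base} (a : E n) {p : P.total} (h : P.proj p = n) :
    𝔩.linAt h (𝔩.vec a p) = a := by rw [vec_eq _ _ h, LinearEquiv.apply_symm_apply]

/-- The classes `[(s n, x)]`, for fixed coordinates `x`, form a smooth frame along the section `s`;
the representatives at `s n` are the coordinates in this frame. -/
theorem contMDiffAt_vec {s : P.base → P.total.atlas} {k : P.group.atlas} (hk : P.group.chart k = 1)
    (a₀ : Bundle.TotalSpace (EuclideanSpace ℝ (Fin r)) E)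
    (hs : SmoothNear (𝓡 P.base.dim) (𝓡 P.total.atlas.dim) s a₀.proj)
    (hbs : ∀ᶠ n in 𝓝 a₀.proj, P.bp (s n) = n) :
    ContMDiffAt ((𝓡 P.base.dim).prod (𝓡 r)) (𝓡 P.group.atlas.dim) ∞
      (fun a : Bundle.TotalSpace (EuclideanSpace ℝ (Fin r)) E =>
        QGroup.coord hk (𝔩.vec a.2 (P.total.chart (s a.proj)))) a₀ := by
  classical
  let F : ∀ n, EuclideanSpace ℝ (Fin P.group.atlas.dim) → E n := fun n x =>
    if h : P.bp (s n) = n then 𝔩.linAt h ((QGroup.coord hk).symm x) else 0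
  have hF : ∀ n (h : P.bp (s n) = n), F n = (QGroup.coord hk).symm.trans (𝔩.linAt h) := fun n h =>
    funext fun x => dif_pos h
  refine contMDiffAt_frame_coord (N := P.base) (E := E) (n₀ := a₀.proj) (Φ := F)
    (c := fun n a => QGroup.coord hk (𝔩.vec a (P.total.chart (s n)))) ?_ ?_ ?_ ?_ a₀ rfl
  · filter_upwards [hbs] with n h
    rw [hF n h]
    exact ((QGroup.coord hk).symm.trans (𝔩.linAt h)).toLinearMap.isLinear
  · filter_upwards [hbs] with n h a
    rw [hF n h]
    simp [𝔩.linAt_vec a h]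
  · filter_upwards [hbs] with n h x
    rw [hF n h, 𝔩.vec_eq _ h]
    simp
  · intro x
    refine ((𝔩.contMDiff_quot hk _).comp a₀.proj (hs.contMDiffAt.prodMk
      (contMDiffAt_const (c := x)))).congr_of_eventuallyEq ?_
    filter_upwards [hbs] with n h
    rw [hF n h, LinearEquiv.trans_apply, 𝔩.mk_linAt h hk, LinearEquiv.apply_symm_apply]
    rfl

/-- The bracket of a fibre. -/
noncomputable def bracketFib (n : P.base) : E n →ₗ[ℝ] E n →ₗ[ℝ] E n :=
  (P.group.lieBracketₗ.compl₁₂ (𝔩.linAt (p := P.total.chart (P.pt n)) (bp_pt n)).symm.toLinearMap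
    (𝔩.linAt (p := P.total.chart (P.pt n)) (bp_pt n)).symm.toLinearMap).compr₂
    (𝔩.linAt (p := P.total.chart (P.pt n)) (bp_pt n)).toLinearMap

/-- Replacing `p` by `pg` changes representatives by `Ad g`, an automorphism of the Lie algebra, so
the bracket defined at the chosen point is the bracket at every point of the fibre. -/
theorem bracketFib_linAt {n : P.base} {p : P.total} (h : P.proj p = n) (w v : P.group.LieAlg) :
    𝔩.bracketFib n (𝔩.linAt h w) (𝔩.linAt h v) = 𝔩.linAt h (QGroup.lieBracket w v) := by
  have h0 : P.proj (P.total.chart (P.pt n)) = n := bp_pt n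
  obtain ⟨g, rfl⟩ := (P.fiber_eq_orbit (P.total.chart (P.pt n)) p).1 (h.trans h0.symm)
  have hg : ∀ w, 𝔩.linAt h w = 𝔩.linAt h0 (QGroup.Ad g w) := fun w =>
    (𝔩.linAt_eq_iff _ _ _ _).2 (adMk_act _ _ _)
  have hb : ∀ w v, 𝔩.bracketFib n (𝔩.linAt h0 w) (𝔩.linAt h0 v) =
      𝔩.linAt h0 (QGroup.lieBracket w v) := fun w v => by
    simp [bracketFib]
  rw [hg, hg, hg, hb, QGroup.Ad_lieBracket]

end

variable {E : P.base → Type u} [∀ n, AddCommGroup (E n)]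
    [∀ n, Module ℝ (E n)] [∀ n, TopologicalSpace (E n)]
    [TopologicalSpace (Bundle.TotalSpace (EuclideanSpace ℝ (Fin P.group.atlas.dim)) E)]
    [FiberBundle (EuclideanSpace ℝ (Fin P.group.atlas.dim)) E]
    [VectorBundle ℝ (EuclideanSpace ℝ (Fin P.group.atlas.dim)) E]
    (𝔩 : P.AdLieBundle P.group.atlas.dim E)

variable (P) in
/-- The bracket of the Lie algebra in coordinates. -/
noncomputable def coordBracket : EuclideanSpace ℝ (Fin P.group.atlas.dim) →ₗ[ℝ]
    EuclideanSpace ℝ (Fin P.group.atlas.dim) →ₗ[ℝ] EuclideanSpace ℝ (Fin P.group.atlas.dim) :=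
  (P.group.lieBracketₗ.compl₁₂ (QGroup.coord P.group.chart_unit).symm.toLinearMap
    (QGroup.coord P.group.chart_unit).symm.toLinearMap).compr₂
    (QGroup.coord P.group.chart_unit).toLinearMap

theorem coordBracket_coord (w v : P.group.LieAlg) :
    coordBracket P (QGroup.coord P.group.chart_unit w) (QGroup.coord P.group.chart_unit v) =
      QGroup.coord P.group.chart_unit (QGroup.lieBracket w v) := by
  simp [coordBracket]

/-- In the frame along a local section the bracket is one fixed bilinear map, applied to smooth
coordinates. -/
theorem contMDiff_bracketFib
    (σ τ : ContMDiffSection (𝓡 P.base.dim) (EuclideanSpace ℝ (Fin P.group.atlas.dim)) ∞ E) :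
    ContMDiff (𝓡 P.base.dim) ((𝓡 P.base.dim).prod (𝓡 P.group.atlas.dim)) ∞
      (fun n => (⟨n, 𝔩.bracketFib n (σ n) (τ n)⟩ :
        Bundle.TotalSpace (EuclideanSpace ℝ (Fin P.group.atlas.dim)) E)) := by
  intro n
  obtain ⟨m, rfl⟩ := P.bp_surjective n
  obtain ⟨s, s1, s2, s3⟩ := P.exists_section m
  have hc : ∀ σ : ContMDiffSection (𝓡 P.base.dim)
      (EuclideanSpace ℝ (Fin P.group.atlas.dim)) ∞ E,
      ContMDiffAt (𝓡 P.base.dim) (𝓡 P.group.atlas.dim) ∞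
        (fun n => QGroup.coord P.group.chart_unit (𝔩.vec (σ n) (P.total.chart (s n)))) (P.bp m) :=
    fun σ => ContMDiffAt.comp (P.bp m)
      (g := fun a : Bundle.TotalSpace (EuclideanSpace ℝ (Fin P.group.atlas.dim)) E =>
        QGroup.coord P.group.chart_unit (𝔩.vec a.2 (P.total.chart (s a.proj))))
      (f := fun n => ⟨n, σ n⟩)
      (𝔩.contMDiffAt_vec P.group.chart_unit ⟨P.bp m, σ (P.bp m)⟩ s2 s3) (σ.contMDiff _)
  let B : EuclideanSpace ℝ (Fin P.group.atlas.dim) →L[ℝ] EuclideanSpace ℝ (Fin P.group.atlas.dim) →L[ℝ]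
      EuclideanSpace ℝ (Fin P.group.atlas.dim) :=
    LinearMap.toContinuousLinearMap (LinearMap.toContinuousLinearMap.toLinearMap.comp (coordBracket P))
  have hB := (B.contMDiff.contMDiffAt.comp (P.bp m) (hc σ)).clm_apply (hc τ)
  refine ((𝔩.contMDiff_quot P.group.chart_unit _).comp _
    (s2.contMDiffAt.prodMk hB)).congr_of_eventuallyEq ?_
  filter_upwards [s3] with n hn
  have h1 := 𝔩.linAt_vec (σ n) hn
  have h2 := 𝔩.linAt_vec (τ n) hn
  conv_lhs => rw [← h1, ← h2, 𝔩.bracketFib_linAt, 𝔩.mk_linAt hn P.group.chart_unit,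
    ← coordBracket_coord]
  rfl

theorem bracketFib_self {n : P.base} (a : E n) : 𝔩.bracketFib n a a = 0 := by
  obtain ⟨w, rfl⟩ := (𝔩.linAt (p := P.total.chart (P.pt n)) (bp_pt n)).surjective a
  rw [bracketFib_linAt, QGroup.lieBracket_self, map_zero]

theorem bracketFib_jacobi {n : P.base} (a b c : E n) :
    𝔩.bracketFib n a (𝔩.bracketFib n b c) =
      𝔩.bracketFib n (𝔩.bracketFib n a b) c + 𝔩.bracketFib n b (𝔩.bracketFib n a c) := by
  obtain ⟨w, rfl⟩ := (𝔩.linAt (p := P.total.chart (P.pt n)) (bp_pt n)).surjective a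
  obtain ⟨v, rfl⟩ := (𝔩.linAt (p := P.total.chart (P.pt n)) (bp_pt n)).surjective b
  obtain ⟨x, rfl⟩ := (𝔩.linAt (p := P.total.chart (P.pt n)) (bp_pt n)).surjective c
  simp only [bracketFib_linAt, ← map_add]
  rw [QGroup.lieBracket_jacobi]

theorem exists_trivialization (n₀ : P.base) : ∃ U : Set P.base, IsOpen U ∧ n₀ ∈ U ∧
    ∃ φ : ∀ n, E n ≃ₗ[ℝ] EuclideanSpace ℝ (Fin P.group.atlas.dim),
      ContMDiffOn ((𝓡 P.base.dim).prod (𝓡 P.group.atlas.dim)) (𝓡 P.group.atlas.dim) ∞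
        (fun x : Bundle.TotalSpace (EuclideanSpace ℝ (Fin P.group.atlas.dim)) E => φ x.proj x.2)
        {x | x.proj ∈ U} ∧
      ∀ n ∈ U, ∀ a b, φ n (𝔩.bracketFib n a b) = coordBracket P (φ n a) (φ n b) := by
  classical
  obtain ⟨m, rfl⟩ := P.bp_surjective n₀
  obtain ⟨s, s1, s2, s3⟩ := P.exists_section m
  obtain ⟨U, hUs, hU, hmU⟩ := mem_nhds_iff.1 (s2.and s3)
  -- A linear isomorphism is required over every `n`; outside `U`, where nothing is asserted about
  -- it, the chosen point replaces the local section.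
  have hp : ∀ n, ∃ p : P.total, P.proj p = n ∧ (n ∈ U → p = P.total.chart (s n)) := fun n => by
    by_cases hn : n ∈ U
    · exact ⟨_, (hUs hn).2, fun _ => rfl⟩
    · exact ⟨P.total.chart (P.pt n), bp_pt n, fun h => (hn h).elim⟩
  choose p hp1 hp2 using hp
  refine ⟨U, hU, hmU, fun n => (𝔩.linAt (hp1 n)).symm.trans (QGroup.coord P.group.chart_unit),
    fun a ha => ?_, fun n hn x y => ?_⟩
  · have hn : ∀ᶠ n in 𝓝 a.proj, n ∈ U := hU.mem_nhds ha
    refine ((𝔩.contMDiffAt_vec P.group.chart_unit a (hn.mono fun n h => (hUs h).1)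
      (hn.mono fun n h => (hUs h).2)).congr_of_eventuallyEq ?_).contMDiffWithinAt
    have hpr : ContinuousAt (Bundle.TotalSpace.proj : Bundle.TotalSpace
        (EuclideanSpace ℝ (Fin P.group.atlas.dim)) E → P.base) a :=
      (Bundle.contMDiff_proj (IB := 𝓡 P.base.dim) (n := ∞) E).contMDiffAt.continuousAt
    filter_upwards [hpr.eventually hn] with b hb
    have hb' := hp2 b.proj hb
    rw [← hb', 𝔩.vec_eq _ (hp1 b.proj)]
    rfl
  · obtain ⟨w, rfl⟩ := (𝔩.linAt (hp1 n)).surjective x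
    obtain ⟨v, rfl⟩ := (𝔩.linAt (hp1 n)).surjective y
    rw [bracketFib_linAt]
    simp only [LinearEquiv.trans_apply, LinearEquiv.symm_apply_apply]
    rw [coordBracket_coord]

variable [ContMDiffVectorBundle ∞ (EuclideanSpace ℝ (Fin P.group.atlas.dim)) E (𝓡 P.base.dim)]

/-- The Lie algebra bundle. -/
noncomputable def lieAlgebraBundle : LieAlgebraBundle P.base where
  rank := P.group.atlas.dim
  fiber := E
  anchor _ := 0
  anchor_smooth := (Bundle.contMDiff_zeroSection ℝ (TangentSpace (𝓡 P.base.dim))).comp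
    (Bundle.contMDiff_proj E)
  bracket := LinearMap.mk₂ ℝ (fun σ τ => ⟨fun n => 𝔩.bracketFib n (σ n) (τ n),
      𝔩.contMDiff_bracketFib σ τ⟩)
    (fun σ σ' τ => ContMDiffSection.ext fun n => (𝔩.bracketFib n).map_add₂ _ _ _)
    (fun c σ τ => ContMDiffSection.ext fun n => (𝔩.bracketFib n).map_smul₂ _ _ _)
    (fun σ τ τ' => ContMDiffSection.ext fun n => map_add (𝔩.bracketFib n (σ n)) _ _)
    (fun c σ τ => ContMDiffSection.ext fun n => map_smul (𝔩.bracketFib n (σ n)) _ _)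
  bracket_self σ := ContMDiffSection.ext fun n => 𝔩.bracketFib_self (σ n)
  jacobi σ τ υ := ContMDiffSection.ext fun n => 𝔩.bracketFib_jacobi (σ n) (τ n) (υ n)
  leibniz σ τ τ' f hf h n := by
    -- The bracket is fibrewise, so it is bilinear over functions, and the derivative term has to
    -- vanish with the anchor.
    have h0 : dirDeriv (0 : P.base.T n) f = 0 :=
      map_zero (mfderiv (𝓡 P.base.dim) 𝓘(ℝ, ℝ) f n)
    change 𝔩.bracketFib n (σ n) (τ' n) = f n • 𝔩.bracketFib n (σ n) (τ n) +
      dirDeriv (0 : P.base.T n) f • τ n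
    rw [h, h0, zero_smul, add_zero, map_smul]
  anchor_zero _ _ := rfl
  locally_trivial := by
    classical
    refine ⟨coordBracket P, fun x => ?_, fun x y z => ?_, fun n₀ => ?_⟩
    · obtain ⟨w, rfl⟩ := (QGroup.coord P.group.chart_unit).surjective x
      rw [coordBracket_coord, QGroup.lieBracket_self, map_zero]
    · obtain ⟨w, rfl⟩ := (QGroup.coord P.group.chart_unit).surjective x
      obtain ⟨v, rfl⟩ := (QGroup.coord P.group.chart_unit).surjective y
      obtain ⟨t, rfl⟩ := (QGroup.coord P.group.chart_unit).surjective z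
      simp only [coordBracket_coord, ← map_add]
      rw [QGroup.lieBracket_jacobi]
    · obtain ⟨U, hU, hn₀, φ, h1, h2⟩ := 𝔩.exists_trivialization n₀
      exact ⟨U, hU, hn₀, φ, h1, fun σ τ n hn => h2 n hn (σ n) (τ n)⟩

end AdLieBundle

end QPrincipalBundle

/-! ### The inclusion, exactness, and the Atiyah sequence -/

namespace QPrincipalBundle

variable {P : QPrincipalBundle.{u}}

/-- The orbit maps carry right-invariant vector fields to invariant vector fields. -/
theorem bcls_tangentMap_rightField {O : P.group.atlas → P.total.atlas} {p : P.total}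
    {k : P.group.atlas} (hO : SmoothNear (𝓡 P.group.atlas.dim) (𝓡 P.total.atlas.dim) O k)
    (hl : ∀ᶠ z in 𝓝 k, P.total.chart (O z) = P.act p (P.group.chart z)) (w : P.group.LieAlg) :
    P.bcls (tangentMap (𝓡 P.group.atlas.dim) (𝓡 P.total.atlas.dim) O ⟨k, QGroup.rightField w k⟩) =
      P.iota (P.adMk p w) := by
  have h1 := (P.act_smooth_right p).tmap_tcls ⟨k, QGroup.rightField w k⟩ hO hl
  have h2 : P.group.tcls ⟨k, QGroup.rightField w k⟩ = _ := QGroup.tmk_rightField w k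
  -- The identity `p(xk) = (px)k` turns right translation by `k` in the group into the action of `k`
  -- on `P`; modulo `G` the value at `k` is therefore the value at the unit. This is where
  -- right-invariance is needed.
  have hc : P.group.Smooth P.total (fun x => P.act p (x * P.group.chart k)) :=
    (P.act_smooth_right p).comp (P.group.smooth_mul_right _) P.group.surjective
  have hc' : P.group.Smooth P.total (fun x => P.act (P.act p x) (P.group.chart k)) :=
    (P.act_smooth_left _).comp (P.act_smooth_right p) P.total.surjective
  rw [h2, ← QManifold.Smooth.tmap_comp _ _ hc] at h1
  refine (quotTP_eq_iff.2 ⟨P.group.chart k, ?_⟩ :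
    P.quotTP ((P.act_smooth_right p).tmap w.1) = _).symm
  rw [← h1, tact, ← QManifold.Smooth.tmap_comp _ _ hc']
  exact QManifold.Smooth.tmap_congr _ _ (funext fun x => P.act_mul _ _ _) _

section

variable {r r' : ℕ} {E L : P.base → Type u} [∀ n, AddCommGroup (E n)]
    [∀ n, Module ℝ (E n)] [∀ n, TopologicalSpace (E n)]
    [TopologicalSpace (Bundle.TotalSpace (EuclideanSpace ℝ (Fin r)) E)]
    [FiberBundle (EuclideanSpace ℝ (Fin r)) E] [VectorBundle ℝ (EuclideanSpace ℝ (Fin r)) E]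
    [∀ n, AddCommGroup (L n)]
    [∀ n, Module ℝ (L n)] [∀ n, TopologicalSpace (L n)]
    [TopologicalSpace (Bundle.TotalSpace (EuclideanSpace ℝ (Fin r')) L)]
    [FiberBundle (EuclideanSpace ℝ (Fin r')) L] [VectorBundle ℝ (EuclideanSpace ℝ (Fin r')) L]
    (𝔢 : P.AtiyahBundle r E) (𝔩 : P.AdLieBundle r' L)

namespace AtiyahBundle

theorem exists_orbit_linear {n : P.base} {m : P.total.atlas} (h : P.bp m = n) :
    ∃ T : P.group.LieAlg →ₗ[ℝ] E n, ∀ w, 𝔢.e n ⟨P.iota (P.adMk (P.total.chart m) w), by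
      rw [atiyahProj_iota]; exact h⟩ = T w := by
  obtain ⟨T, hT⟩ := QGroup.exists_lieMk_eq (P.act_smooth_right (P.total.chart m))
    (e := P.group.unit) (y := m) (by rw [P.group.chart_unit, P.act_one])
  refine ⟨(𝔢.linAt h).toLinearMap.comp
    (T.comp (QGroup.lieMkEquiv P.group.chart_unit).symm.toLinearMap), fun w => ?_⟩
  refine congrArg (𝔢.e n) (Subtype.ext ?_)
  refine congrArg P.quotTP ((hT _).symm.trans ?_).symm
  exact congrArg (fun w : P.group.LieAlg => (P.act_smooth_right (P.total.chart m)).tmap w.1)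
    (QGroup.lieMk_symm P.group.chart_unit w)

/-- The map `ι_P` on the fibres of the bundles. -/
noncomputable def incl (n : P.base) : L n →ₗ[ℝ] E n :=
  let F : L n → E n := fun a => 𝔢.e n ⟨P.iota ((𝔩.e n).symm a).1,
    (P.atiyahProj_iota _).trans ((𝔩.e n).symm a).2⟩
  have key : ∃ T : L n →ₗ[ℝ] E n, ∀ a, F a = T a := by
    obtain ⟨T, hT⟩ := 𝔢.exists_orbit_linear (bp_pt n)
    let A := 𝔩.linAt (p := P.total.chart (P.pt n)) (bp_pt n)
    refine ⟨T.comp A.symm.toLinearMap, fun a => ?_⟩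
    obtain ⟨w, rfl⟩ := A.surjective a
    refine Eq.trans ?_ ((hT w).trans (congrArg T (A.symm_apply_apply w).symm))
    refine congrArg (𝔢.e n) (Subtype.ext ?_)
    exact congrArg (fun x : {l : P.AdBundle // P.adProj l = n} => P.iota x.1)
      ((𝔩.e n).symm_apply_apply _)
  { toFun := F
    map_add' := fun v w => by
      obtain ⟨T, hT⟩ := key
      rw [hT, hT, hT, map_add]
    map_smul' := fun c v => by
      obtain ⟨T, hT⟩ := key
      rw [hT, hT, map_smul]; rfl }

theorem incl_e {n : P.base} (l : {l : P.AdBundle // P.adProj l = n}) :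
    𝔢.incl 𝔩 n (𝔩.e n l) = 𝔢.e n ⟨P.iota l.1, (P.atiyahProj_iota l.1).trans l.2⟩ := by
  refine congrArg (𝔢.e n) (Subtype.ext ?_)
  exact congrArg (fun x : {l : P.AdBundle // P.adProj l = n} => P.iota x.1)
    ((𝔩.e n).symm_apply_apply l)

theorem incl_linAt {n : P.base} {p : P.total} (h : P.proj p = n) (w : P.group.LieAlg) :
    𝔢.incl 𝔩 n (𝔩.linAt h w) =
      𝔢.e n ⟨P.iota (P.adMk p w), (P.atiyahProj_iota _).trans h⟩ :=
  𝔢.incl_e 𝔩 _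

theorem incl_eq_linAt_iff {n : P.base} {p : P.total} (h : P.proj p = n) (w : P.group.LieAlg)
    {m : P.total.atlas} (hm : P.bp m = n) (v : P.total.atlas.T m) :
    𝔢.incl 𝔩 n (𝔩.linAt h w) = 𝔢.linAt hm v ↔ P.iota (P.adMk p w) = P.bcls ⟨m, v⟩ := by
  rw [incl_linAt]
  exact (𝔢.e n).apply_eq_iff_eq.trans Subtype.ext_iff

/-- If two images agree modulo `G`, comparing base points and using freeness shows that they agree
in `TP`; injectivity of the tangent map of the orbit map does the rest. -/
theorem incl_injective (n : P.base) : Injective (𝔢.incl 𝔩 n) := by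
  intro a b h
  have hp : P.proj (P.total.chart (P.pt n)) = n := bp_pt n
  obtain ⟨w, rfl⟩ := (𝔩.linAt hp).surjective a
  obtain ⟨v, rfl⟩ := (𝔩.linAt hp).surjective b
  rw [incl_linAt, incl_linAt] at h
  have h1 := congrArg Subtype.val ((𝔢.e n).injective h)
  obtain ⟨g, hg⟩ := quotTP_eq_iff.1 h1
  have hp' := congrArg P.total.tproj hg
  simp only [tact, QManifold.Smooth.tproj_tmap] at hp'
  rw [w.2, v.2, P.act_one] at hp'
  rw [P.act_free _ _ hp'.symm, tact_one] at hg
  exact congrArg _ (tmap_orbit_injective _ hg.symm)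

/-- A vertical vector is tangent to an orbit by `exists_orbit_of_mfderiv_bp_eq_zero`; conversely the
projection is constant along orbits, so its derivative kills their tangent vectors. -/
theorem exact (n : P.base) (a : E n) : 𝔢.anchor n a = 0 ↔ ∃ l, 𝔢.incl 𝔩 n l = a := by
  obtain ⟨m, rfl⟩ := P.bp_surjective n
  obtain ⟨v, rfl⟩ := (𝔢.linEquiv m).surjective a
  have ha : 𝔢.anchor (P.bp m) (𝔢.linEquiv m v) = _ := 𝔢.anchor_lin v
  rw [ha]
  constructor
  · intro h
    obtain ⟨w, hw⟩ := exists_orbit_of_mfderiv_bp_eq_zero v h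
    exact ⟨𝔩.linAt rfl w, (𝔢.incl_eq_linAt_iff 𝔩 rfl w rfl v).2 (congrArg P.quotTP hw)⟩
  · rintro ⟨l, hl⟩
    obtain ⟨w, rfl⟩ := (𝔩.linAt (p := P.total.chart m) rfl).surjective l
    replace hl := (𝔢.incl_eq_linAt_iff 𝔩 rfl w rfl v).1 hl
    obtain ⟨O, rfl, hO, hOl⟩ := exists_orbit_lift m P.group.chart_unit
    rw [← bcls_tangentMap_rightField hO hOl] at hl
    have h1 := tangentMap_bp_eq hl
    rw [← tangentMap_fun_comp _ (P.bp_smooth.mdifferentiableAt (by simp)) hO.mdifferentiableAt] at h1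
    have h2 : (fun z => P.bp (O z)) =ᶠ[𝓝 P.group.unit] fun _ => P.bp (O P.group.unit) := by
      filter_upwards [hOl] with z hz
      rw [bp, hz, proj_act]
    rw [tangentMap_congr_of_eventuallyEq h2] at h1
    have h3 := Bundle.TotalSpace.mk_inj.1 h1
    refine h3.symm.trans ?_
    rw [mfderiv_const]
    rfl

theorem anchor_incl (n : P.base) (l : L n) : 𝔢.anchor n (𝔢.incl 𝔩 n l) = 0 :=
  (𝔢.exact 𝔩 n _).2 ⟨l, rfl⟩

theorem mk_incl {n : P.base} {m : P.total.atlas} (h : P.bp m = n)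
    {O : P.group.atlas → P.total.atlas} {k : P.group.atlas} (hk : P.group.chart k = 1)
    (hO : SmoothNear (𝓡 P.group.atlas.dim) (𝓡 P.total.atlas.dim) O k)
    (hl : ∀ᶠ z in 𝓝 k, P.total.chart (O z) = P.act (P.total.chart m) (P.group.chart z))
    (w : P.group.LieAlg) :
    (⟨n, 𝔢.incl 𝔩 n (𝔩.linAt h w)⟩ : Bundle.TotalSpace (EuclideanSpace ℝ (Fin r)) E) =
      𝔢.quot (tangentMap (𝓡 P.group.atlas.dim) (𝓡 P.total.atlas.dim) O ⟨k, QGroup.coord hk w⟩) := by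
  have hb : P.bp (O k) = n := by rw [bp, hl.self_of_nhds, proj_act]; exact h
  refine Eq.trans ?_ (𝔢.mk_linAt hb
    (mfderiv (𝓡 P.group.atlas.dim) (𝓡 P.total.atlas.dim) O k (QGroup.coord hk w)))
  refine congrArg (fun a : E n => (⟨n, a⟩ : Bundle.TotalSpace (EuclideanSpace ℝ (Fin r)) E)) ?_
  rw [incl_eq_linAt_iff]
  refine congrArg P.quotTP (Eq.trans ?_
    ((P.act_smooth_right (P.total.chart m)).tmap_tcls ⟨k, QGroup.coord hk w⟩ hO hl))
  exact congrArg (fun w : P.group.LieAlg => (P.act_smooth_right (P.total.chart m)).tmap w.1)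
    (QGroup.lieMk_symm hk w).symm

/-- Along a local section `s`, the inclusion is the quotient map applied to the derivative at the
unit of the orbit map through `s n`; the lifted action provides these orbit maps as one smooth
family. -/
theorem incl_smooth [ContMDiffVectorBundle ∞ (EuclideanSpace ℝ (Fin r')) L (𝓡 P.base.dim)] :
    ContMDiff ((𝓡 P.base.dim).prod (𝓡 r')) ((𝓡 P.base.dim).prod (𝓡 r)) ∞
      (fun a : Bundle.TotalSpace (EuclideanSpace ℝ (Fin r')) L =>
        (⟨a.proj, 𝔢.incl 𝔩 a.proj a.2⟩ : Bundle.TotalSpace (EuclideanSpace ℝ (Fin r)) E)) := by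
  intro a₀
  obtain ⟨m, hm⟩ := P.bp_surjective a₀.proj
  obtain ⟨s, s1, s2, s3⟩ := P.exists_section m
  rw [hm] at s1 s2 s3
  subst s1
  have hk := P.group.chart_unit
  obtain ⟨R, r1, r2, r3⟩ := P.act_smooth.exists_lift (x := (s a₀.proj, P.group.unit))
    (y := s a₀.proj) (by simp [hk, P.act_one])
  have hp : ContMDiffAt ((𝓡 P.base.dim).prod (𝓡 r')) (𝓡 P.base.dim) ∞
      (Bundle.TotalSpace.proj : Bundle.TotalSpace (EuclideanSpace ℝ (Fin r')) L → P.base) a₀ :=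
    (Bundle.contMDiff_proj L).contMDiffAt
  have hX := 𝔩.contMDiffAt_vec hk a₀ s2 s3
  let t := trivializationAt (EuclideanSpace ℝ (Fin P.group.atlas.dim))
    (TangentSpace (𝓡 P.group.atlas.dim) (M := P.group.atlas)) P.group.unit
  have ht : P.group.unit ∈ t.baseSet := FiberBundle.mem_baseSet_trivializationAt _ _ _
  have hV : ContMDiffAt ((𝓡 P.base.dim).prod (𝓡 r')) (𝓡 P.group.atlas.dim).tangent ∞
      (fun a : Bundle.TotalSpace (EuclideanSpace ℝ (Fin r')) L => (⟨P.group.unit,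
        QGroup.coord hk (𝔩.vec a.2 (P.total.chart (s a.proj)))⟩ :
          TangentBundle (𝓡 P.group.atlas.dim) P.group.atlas)) a₀ := by
    rw [Bundle.contMDiffAt_totalSpace]
    refine ⟨contMDiffAt_const, ?_⟩
    let A : EuclideanSpace ℝ (Fin P.group.atlas.dim) ≃L[ℝ]
        EuclideanSpace ℝ (Fin P.group.atlas.dim) := t.continuousLinearEquivAt ℝ _ ht
    exact A.toContinuousLinearMap.contMDiff.contMDiffAt.comp a₀ hX
  -- The factors are exchanged because the derivative is taken in the group variable, with the point
  -- of `P` as parameter.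
  let R' : P.group.atlas × P.total.atlas → P.total.atlas := fun x => R (x.2, x.1)
  have hR' : SmoothNear ((𝓡 P.group.atlas.dim).prod (𝓡 P.total.atlas.dim)) (𝓡 P.total.atlas.dim)
      R' (P.group.unit, s a₀.proj) :=
    SmoothNear.comp (f := fun x : P.group.atlas × P.total.atlas => (x.2, x.1)) r2
      ((contMDiff_snd.smoothNear _).prodMk (contMDiff_fst.smoothNear _))
  have hRl : ∀ᶠ x in 𝓝 (P.group.unit, s a₀.proj), P.total.chart (R' x) =
      P.act (P.total.chart x.2) (P.group.chart x.1) := by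
    have : ContinuousAt (fun x : P.group.atlas × P.total.atlas => (x.2, x.1))
        (P.group.unit, s a₀.proj) := by fun_prop
    exact this.eventually r3
  have key := contMDiffAt_tangentMap_param (g := R')
    (c := fun a : Bundle.TotalSpace (EuclideanSpace ℝ (Fin r')) L => s a.proj) (t₀ := a₀)
    hR'.contMDiffAt hV (s2.contMDiffAt.comp a₀ hp)
  refine ((𝔢.contMDiff_quot _).comp a₀ key).congr_of_eventuallyEq ?_
  have hc : ContinuousAt (fun a : Bundle.TotalSpace (EuclideanSpace ℝ (Fin r')) L =>
      (P.group.unit, s a.proj)) a₀ :=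
    continuousAt_const.prodMk (s2.continuousAt.comp hp.continuousAt)
  filter_upwards [hp.continuousAt.eventually s3, hc.eventually hR'.eventually,
    hc.eventually (eventually_eventually_nhds.2 hRl)] with a h1 h2 h3
  have hi : ContinuousAt (fun z : P.group.atlas => (z, s a.proj)) P.group.unit := by fun_prop
  have h4 := 𝔢.mk_incl 𝔩 h1 hk (O := fun z => R' (z, s a.proj))
    (SmoothNear.comp (f := fun z : P.group.atlas => (z, s a.proj)) h2
      ((smoothNear_id _).prodMk (smoothNear_const _ _))) (hi.eventually h3)
    (𝔩.vec a.2 (P.total.chart (s a.proj)))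
  rw [𝔩.linAt_vec] at h4
  exact h4

theorem bcls_field_eq (σ : ∀ n, E n) {m : P.total.atlas} {n : P.base} (h : P.bp m = n) :
    P.bcls ⟨m, 𝔢.field σ m⟩ = ((𝔢.e n).symm (σ n)).1 := by
  subst h
  exact 𝔢.bcls_vec _ rfl

/-- An orbit map stays in the fibre over `n`. There the invariant field of `ι ∘ σ` depends only on
`σ n`, and it is related to the right-invariant field of the element representing `σ n`. Hence the
brackets are related too, although the fields vary in other directions. -/
theorem incl_bracket {σ τ : ∀ n, L n}
    (hσ : SmoothMfd.IsSmooth (𝔢.field fun n => 𝔢.incl 𝔩 n (σ n)))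
    (hτ : SmoothMfd.IsSmooth (𝔢.field fun n => 𝔢.incl 𝔩 n (τ n))) (n : P.base) :
    𝔢.incl 𝔩 n (𝔩.bracketFib n (σ n) (τ n)) =
      𝔢.bracketFun (fun n => 𝔢.incl 𝔩 n (σ n)) (fun n => 𝔢.incl 𝔩 n (τ n)) n := by
  have hp : P.proj (P.total.chart (P.pt n)) = n := bp_pt n
  obtain ⟨w, hw⟩ := (𝔩.linAt hp).surjective (σ n)
  obtain ⟨v, hv⟩ := (𝔩.linAt hp).surjective (τ n)
  rw [← hw, ← hv, 𝔩.bracketFib_linAt, bracketFun, incl_eq_linAt_iff]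
  obtain ⟨O, hO1, hO, hOl⟩ := exists_orbit_lift (P.pt n) P.group.chart_unit
  have hrel : ∀ (σ : ∀ n, L n) (w : P.group.LieAlg), 𝔩.linAt hp w = σ n →
      ∀ᶠ z in 𝓝 P.group.unit, mfderiv (𝓡 P.group.atlas.dim) (𝓡 P.total.atlas.dim) O z
        (QGroup.rightField w z) = 𝔢.field (fun n => 𝔢.incl 𝔩 n (σ n)) (O z) := by
    intro σ w hw
    filter_upwards [hO.eventually, eventually_eventually_nhds.2 hOl] with z h1 h2
    have hb : P.bp (O z) = n := by rw [bp, h2.self_of_nhds, proj_act]; exact hp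
    refine Bundle.TotalSpace.mk_inj.1 (eq_of_bcls_eq (P := P)
      (a := tangentMap (𝓡 P.group.atlas.dim) (𝓡 P.total.atlas.dim) O ⟨z, QGroup.rightField w z⟩)
      (b := ⟨O z, 𝔢.field (fun n => 𝔢.incl 𝔩 n (σ n)) (O z)⟩) ?_ rfl)
    rw [bcls_tangentMap_rightField h1 h2, 𝔢.bcls_field_eq _ hb, ← hw, incl_linAt,
      Equiv.symm_apply_apply]
  have hσ' : MDifferentiableAt _ _ _ (O P.group.unit) := hσ.mdifferentiableAt _
  have key := VectorField.mfderiv_mlieBracket_of_related hO.contMDiffAt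
    ((QGroup.isSmooth_rightField w).mdifferentiableAt _)
    ((QGroup.isSmooth_rightField v).mdifferentiableAt _) (hσ.mdifferentiableAt _)
    (hτ.mdifferentiableAt _) (hrel σ w hw) (hrel τ v hv)
  rw [← QGroup.rightField_lieBracket] at key
  rw [← bcls_tangentMap_rightField hO hOl, ← hO1, ← key]
  rfl

/-- Representatives along a section through `m` give a smooth local right inverse of the quotient
map that passes through the given tangent vector; the chain rule then gives surjectivity. -/
theorem quot_submersion (x : TangentBundle (𝓡 P.total.atlas.dim) P.total.atlas) :
    Surjective (mfderiv (𝓡 P.total.atlas.dim).tangent ((𝓡 P.base.dim).prod (𝓡 r)) 𝔢.quot x) := by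
  obtain ⟨m, v⟩ := x
  obtain ⟨s, s1, s2, s3⟩ := P.exists_section m
  let S : Bundle.TotalSpace (EuclideanSpace ℝ (Fin r)) E →
      TangentBundle (𝓡 P.total.atlas.dim) P.total.atlas := fun a => ⟨s a.proj, 𝔢.vec a.2 (s a.proj)⟩
  have hS := 𝔢.contMDiffAt_vec (𝔢.quot ⟨m, v⟩) s2 s3
  have hp : ContMDiffAt ((𝓡 P.base.dim).prod (𝓡 r)) (𝓡 P.base.dim) ∞
      (Bundle.TotalSpace.proj : Bundle.TotalSpace (EuclideanSpace ℝ (Fin r)) E → P.base)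
      (𝔢.quot ⟨m, v⟩) := (Bundle.contMDiff_proj E).contMDiffAt
  have hid : (fun a => 𝔢.quot (S a)) =ᶠ[𝓝 (𝔢.quot ⟨m, v⟩)] fun a => a := by
    filter_upwards [hp.continuousAt.eventually s3] with a ha
    exact 𝔢.quot_vec a.2 ha
  have hSx : S (𝔢.quot ⟨m, v⟩) = ⟨m, v⟩ := by
    refine eq_of_bcls_eq ?_ s1
    have h1 := hid.self_of_nhds
    have h2 : P.bp (s (P.bp m)) = P.bp m := by rw [s1]
    exact (𝔢.bcls_vec _ h2).trans (congrArg Subtype.val ((𝔢.e _).symm_apply_apply (P.cls m v)))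
  intro y
  have hq : MDifferentiableAt (𝓡 P.total.atlas.dim).tangent ((𝓡 P.base.dim).prod (𝓡 r)) 𝔢.quot
      (S (𝔢.quot ⟨m, v⟩)) := (𝔢.contMDiff_quot _).mdifferentiableAt (by simp)
  have h1 := mfderiv_comp (𝔢.quot ⟨m, v⟩) hq (hS.mdifferentiableAt (by simp))
  have h2 : mfderiv ((𝓡 P.base.dim).prod (𝓡 r)) ((𝓡 P.base.dim).prod (𝓡 r)) (𝔢.quot ∘ S)
      (𝔢.quot ⟨m, v⟩) = _ := hid.mfderiv_eq
  rw [h1] at h2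
  have h3 := (congrArg (fun L : (EuclideanSpace ℝ (Fin P.base.dim) × EuclideanSpace ℝ (Fin r)) →L[ℝ]
    (EuclideanSpace ℝ (Fin P.base.dim) × EuclideanSpace ℝ (Fin r)) => L y) h2)
  have h4 : mfderiv ((𝓡 P.base.dim).prod (𝓡 r)) ((𝓡 P.base.dim).prod (𝓡 r))
      (fun a : Bundle.TotalSpace (EuclideanSpace ℝ (Fin r)) E => a) (𝔢.quot ⟨m, v⟩) = _ := mfderiv_id
  rw [h4] at h3
  rw [← hSx]
  exact ⟨_, h3⟩

theorem lin_mlieBracket_field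
    (σ τ : ContMDiffSection (𝓡 P.base.dim) (EuclideanSpace ℝ (Fin r)) ∞ E) (m : P.total.atlas) :
    𝔢.lin m (VectorField.mlieBracket (𝓡 P.total.atlas.dim) (𝔢.field σ) (𝔢.field τ) m) =
      𝔢.bracketSec σ τ (P.bp m) := by
  rw [← field_bracketSec, lin_field]

end AtiyahBundle

end

namespace AtiyahBundle

variable {r : ℕ} {E L : P.base → Type u} [∀ n, AddCommGroup (E n)]
    [∀ n, Module ℝ (E n)] [∀ n, TopologicalSpace (E n)]
    [TopologicalSpace (Bundle.TotalSpace (EuclideanSpace ℝ (Fin r)) E)]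
    [FiberBundle (EuclideanSpace ℝ (Fin r)) E] [VectorBundle ℝ (EuclideanSpace ℝ (Fin r)) E]
    [ContMDiffVectorBundle ∞ (EuclideanSpace ℝ (Fin r)) E (𝓡 P.base.dim)]
    [∀ n, AddCommGroup (L n)]
    [∀ n, Module ℝ (L n)] [∀ n, TopologicalSpace (L n)]
    [TopologicalSpace (Bundle.TotalSpace (EuclideanSpace ℝ (Fin P.group.atlas.dim)) L)]
    [FiberBundle (EuclideanSpace ℝ (Fin P.group.atlas.dim)) L]
    [VectorBundle ℝ (EuclideanSpace ℝ (Fin P.group.atlas.dim)) L]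
    [ContMDiffVectorBundle ∞ (EuclideanSpace ℝ (Fin P.group.atlas.dim)) L (𝓡 P.base.dim)]
    (𝔢 : P.AtiyahBundle r E) (𝔩 : P.AdLieBundle P.group.atlas.dim L)

/-- The image of a section under the inclusion. -/
noncomputable def inclSec (σ : ContMDiffSection (𝓡 P.base.dim)
    (EuclideanSpace ℝ (Fin P.group.atlas.dim)) ∞ L) :
    ContMDiffSection (𝓡 P.base.dim) (EuclideanSpace ℝ (Fin r)) ∞ E :=
  ⟨fun n => 𝔢.incl 𝔩 n (σ n), (𝔢.incl_smooth 𝔩).comp σ.contMDiff⟩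

/-- The base map is the identity, so the image of a section is itself a section and serves as the
witness in the criterion by 1-forms. All derivative terms vanish since both anchors do, and
compatibility of brackets remains. -/
theorem isLieAlgebroidMorphism_incl : IsLieAlgebroidMorphism 𝔩.lieAlgebraBundle.toLieAlgebroid
    𝔢.algebroid (fun n => n) (𝔢.incl (L := L) 𝔩) := by
  refine .of_formCond contMDiff_id (𝔢.incl_smooth 𝔩) (fun n a => ?_) (fun θ σ₁ σ₂ n =>
    ⟨𝔢.inclSec 𝔩 σ₁, 𝔢.inclSec 𝔩 σ₂, rfl, rfl, ?_⟩)
  · refine (𝔢.anchor_incl 𝔩 n a).trans ?_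
    exact (map_zero (mfderiv (𝓡 P.base.dim) (𝓡 P.base.dim) (fun n : P.base => n) n)).symm
  · have h0 : ∀ (X : P.base.T n) (f : P.base → ℝ), X = 0 → dirDeriv X f = 0 := by
      rintro _ f rfl
      exact map_zero (mfderiv (𝓡 P.base.dim) 𝓘(ℝ, ℝ) f n)
    have h1 : ∀ (σ : ContMDiffSection (𝓡 P.base.dim)
        (EuclideanSpace ℝ (Fin P.group.atlas.dim)) ∞ L) (f g : P.base → ℝ),
        dirDeriv (𝔩.lieAlgebraBundle.anchor n (σ n)) f =
          dirDeriv (𝔢.algebroid.anchor n (𝔢.inclSec 𝔩 σ n)) g := fun σ f g =>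
      (h0 _ f rfl).trans (h0 _ g (𝔢.anchor_incl 𝔩 n (σ n))).symm
    have h2 : 𝔢.incl 𝔩 n (𝔩.lieAlgebraBundle.bracket σ₁ σ₂ n) =
        𝔢.algebroid.bracket (𝔢.inclSec 𝔩 σ₁) (𝔢.inclSec 𝔩 σ₂) n :=
      𝔢.incl_bracket 𝔩 (𝔢.isSmooth_field (𝔢.inclSec 𝔩 σ₁)) (𝔢.isSmooth_field (𝔢.inclSec 𝔩 σ₂)) n
    exact congrArg₂ (fun a b : ℝ => a - b) (congrArg₂ (fun a b : ℝ => a - b)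
      (h1 σ₁ _ _) (h1 σ₂ _ _)) (congrArg (θ.toFun n) h2)

/-- The Atiyah sequence. -/
noncomputable def sequence : AbstractAtiyahSequence P.base where
  L := 𝔩.lieAlgebraBundle
  A := 𝔢.algebroid
  transitive := by
    intro n X
    obtain ⟨m, rfl⟩ := P.bp_surjective n
    obtain ⟨s, s1, s2, s3⟩ := P.exists_section m
    -- Differentiating `bp ∘ s = id` shows that `Ts(X)` is a preimage of `X`.
    have h1 := tangentMap_fun_comp (⟨P.bp m, X⟩ : TangentBundle (𝓡 P.base.dim) P.base) (g := P.bp)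
      (P.bp_smooth.mdifferentiableAt (by simp)) s2.mdifferentiableAt
    have h2 : (fun n => P.bp (s n)) =ᶠ[𝓝 (P.bp m)] fun n => n := s3
    rw [tangentMap_congr_of_eventuallyEq h2] at h1
    have h3 := (congrFun (tangentMap_id (I := 𝓡 P.base.dim) (M := P.base)) ⟨P.bp m, X⟩).symm.trans h1
    have hb : P.bp (s (P.bp m)) = P.bp m := by rw [s1]
    refine ⟨𝔢.linAt hb (mfderiv (𝓡 P.base.dim) (𝓡 P.total.atlas.dim) s (P.bp m) X), ?_⟩
    exact Bundle.TotalSpace.mk_inj.1 ((𝔢.mk_anchor hb _).trans h3.symm)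
  j := 𝔢.incl (L := L) 𝔩
  j_hom := 𝔢.isLieAlgebroidMorphism_incl 𝔩
  j_injective := 𝔢.incl_injective 𝔩
  exact := 𝔢.exact 𝔩

/-- The Atiyah sequence with its identifications. -/
noncomputable def sequenceOf : P.AtiyahSequenceOf where
  seq := 𝔢.sequence 𝔩
  eA := 𝔢.e
  eL := 𝔩.e
  eA_linear := 𝔢.linear
  eA_smooth := 𝔢.smooth
  eA_submersion := 𝔢.quot_submersion
  anchor_eA _ v := 𝔢.anchor_lin v
  bracket_eA σ τ X Y hX hY m := by
    have h1 : X = 𝔢.field σ := 𝔢.field_eq hX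
    have h2 : Y = 𝔢.field τ := 𝔢.field_eq hY
    rw [h1, h2]
    exact (𝔢.lin_mlieBracket_field σ τ m).symm
  eL_linear := 𝔩.linear
  eL_smooth := 𝔩.smooth
  bracket_eL σ τ p w v hσ hτ := by
    change 𝔩.bracketFib _ (σ _) (τ _) = 𝔩.linAt rfl (QGroup.lieBracket w v)
    rw [hσ, hτ]
    exact 𝔩.bracketFib_linAt rfl w v
  j_eL _ l := 𝔢.incl_e 𝔩 l

end AtiyahBundle

end QPrincipalBundle

/-! ### Vector bundles from smooth families of frames -/

/-- Coordinates on the fibres of a family of vector spaces, with smooth changes of coordinates. -/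
structure SmoothFrames (N : SmoothMfd.{u}) (r : ℕ) (E : N → Type u) [∀ n, AddCommGroup (E n)]
    [∀ n, Module ℝ (E n)] where
  U : N → Set N
  isOpen_U : ∀ i : N, IsOpen (U i)
  mem_U : ∀ i, i ∈ U i
  L : ∀ i n, E n ≃ₗ[ℝ] EuclideanSpace ℝ (Fin r)
  smooth : ∀ i j x n, n ∈ U i → n ∈ U j →
    ContMDiffAt (𝓡 N.dim) (𝓡 r) ∞ (fun n => L j n ((L i n).symm x)) n

namespace SmoothFrames

variable {N : SmoothMfd.{u}} {r : ℕ} {E : N → Type u} [∀ n, AddCommGroup (E n)]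
    [∀ n, Module ℝ (E n)] (𝔉 : SmoothFrames N r E)

/-- The topology of a fibre. -/
@[reducible] def topFiber (n : N) : TopologicalSpace (E n) := .induced (𝔉.L n n) inferInstance

/-- The local trivializations. -/
def pretrivialization (i : N) : Bundle.Pretrivialization (EuclideanSpace ℝ (Fin r))
    (Bundle.TotalSpace.proj : Bundle.TotalSpace (EuclideanSpace ℝ (Fin r)) E → N) where
  toFun x := (x.proj, 𝔉.L i x.proj x.2)
  invFun y := ⟨y.1, (𝔉.L i y.1).symm y.2⟩
  source := Bundle.TotalSpace.proj ⁻¹' 𝔉.U i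
  target := 𝔉.U i ×ˢ univ
  map_source' _ hx := ⟨hx, mem_univ _⟩
  map_target' _ hy := hy.1
  left_inv' x _ := congrArg (fun a : E x.proj =>
    (⟨x.proj, a⟩ : Bundle.TotalSpace (EuclideanSpace ℝ (Fin r)) E)) ((𝔉.L i x.proj).symm_apply_apply x.2)
  right_inv' y _ := Prod.ext rfl ((𝔉.L i y.1).apply_symm_apply y.2)
  open_target := (𝔉.isOpen_U i).prod isOpen_univ
  baseSet := 𝔉.U i
  open_baseSet := 𝔉.isOpen_U i
  source_eq := rfl
  target_eq := rfl
  proj_toFun _ _ := rfl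

theorem pretrivialization_symm {i n : N} (hn : n ∈ 𝔉.U i) (x : EuclideanSpace ℝ (Fin r)) :
    (𝔉.pretrivialization i).symm n x = (𝔉.L i n).symm x := by
  refine (𝔉.L i n).injective ?_
  rw [LinearEquiv.apply_symm_apply]
  exact congrArg Prod.snd ((𝔉.pretrivialization i).apply_mk_symm hn x)

/-- The change of coordinates. -/
noncomputable def coordChange (i j n : N) :
    EuclideanSpace ℝ (Fin r) →L[ℝ] EuclideanSpace ℝ (Fin r) :=
  LinearMap.toContinuousLinearMap ((𝔉.L i n).symm.trans (𝔉.L j n)).toLinearMap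

/-- The columns of the matrix are the smooth functions supplied by the frames. -/
theorem contMDiffOn_coordChange (i j : N) :
    ContMDiffOn (𝓡 N.dim) 𝓘(ℝ, EuclideanSpace ℝ (Fin r) →L[ℝ] EuclideanSpace ℝ (Fin r)) ∞
      (𝔉.coordChange i j) (𝔉.U i ∩ 𝔉.U j) := by
  intro n hn
  refine ContMDiffAt.contMDiffWithinAt ?_
  have h : 𝔉.coordChange i j = fun n => ∑ k,
      (EuclideanSpace.proj k : EuclideanSpace ℝ (Fin r) →L[ℝ] ℝ).smulRight
        (𝔉.L j n ((𝔉.L i n).symm (EuclideanSpace.single k 1))) := by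
    funext n
    ext1 x
    have hx : x = ∑ k, x k • (EuclideanSpace.single k 1 : EuclideanSpace ℝ (Fin r)) := by
      ext j
      simp [Pi.single_apply]
    conv_lhs => rw [hx, map_sum]
    simp only [map_smul, sum_apply, ContinuousLinearMap.smulRight_apply]
    rfl
  rw [h]
  refine ContMDiffAt.sum fun k _ => ?_
  exact ((ContinuousLinearMap.smulRightL ℝ (EuclideanSpace ℝ (Fin r)) (EuclideanSpace ℝ (Fin r))
    (EuclideanSpace.proj k)).contMDiff.contMDiffAt).comp n (𝔉.smooth i j _ n hn.1 hn.2)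

variable [∀ n, TopologicalSpace (E n)] (h : ∀ n, IsInducing (𝔉.L n n))

/-- The vector prebundle. -/
@[reducible] noncomputable def prebundle : VectorPrebundle ℝ (EuclideanSpace ℝ (Fin r)) E where
  pretrivializationAtlas := range 𝔉.pretrivialization
  pretrivialization_linear' := by
    rintro _ ⟨i, rfl⟩
    exact ⟨fun n _ => (𝔉.L i n).toLinearMap.isLinear⟩
  pretrivializationAt := 𝔉.pretrivialization
  mem_base_pretrivializationAt := 𝔉.mem_U
  pretrivialization_mem_atlas i := ⟨i, rfl⟩
  exists_coordChange := by
    rintro _ ⟨i, rfl⟩ _ ⟨j, rfl⟩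
    refine ⟨𝔉.coordChange i j, (𝔉.contMDiffOn_coordChange i j).continuousOn, fun n hn x => ?_⟩
    rw [𝔉.pretrivialization_symm hn.1]
    rfl
  totalSpaceMk_isInducing n := (isInducing_const_prod (x := n)).2 (h n)

instance : (𝔉.prebundle h).IsContMDiff (𝓡 N.dim) ∞ where
  exists_contMDiffCoordChange := by
    rintro _ ⟨i, rfl⟩ _ ⟨j, rfl⟩
    refine ⟨𝔉.coordChange i j, 𝔉.contMDiffOn_coordChange i j, fun n hn x => ?_⟩
    rw [𝔉.pretrivialization_symm hn.1]
    rfl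

/-- The trivialization of the resulting bundle at `i` is by construction given by the coordinates `L
i`, so smoothness is tested in them. -/
theorem contMDiffAt_total {E' H' : Type*} [NormedAddCommGroup E'] [NormedSpace ℝ E']
    [TopologicalSpace H'] {J : ModelWithCorners ℝ E' H'} {T : Type*} [TopologicalSpace T]
    [ChartedSpace H' T] {f : T → Bundle.TotalSpace (EuclideanSpace ℝ (Fin r)) E} {t : T}
    (h₁ : ContMDiffAt J (𝓡 N.dim) ∞ (fun z => (f z).proj) t)
    (h₂ : ContMDiffAt J (𝓡 r) ∞ (fun z => 𝔉.L (f t).proj (f z).proj (f z).2) t) :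
    letI := (𝔉.prebundle h).totalSpaceTopology
    letI := (𝔉.prebundle h).toFiberBundle
    letI := (𝔉.prebundle h).toVectorBundle
    ContMDiffAt J ((𝓡 N.dim).prod (𝓡 r)) ∞ f t := by
  let := (𝔉.prebundle h).totalSpaceTopology
  let := (𝔉.prebundle h).toFiberBundle
  let := (𝔉.prebundle h).toVectorBundle
  rw [Bundle.contMDiffAt_totalSpace]
  exact ⟨h₁, h₂⟩

end SmoothFrames

/-! ### Chosen local sections of the projection -/

namespace QPrincipalBundle

variable (P : QPrincipalBundle.{u})

/-- The domain is shrunk until the section stays in one trivialization of the tangent bundle of the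
atlas, so that it also provides coordinates on `(TP)/G`. -/
theorem exists_local_section (n : P.base) : ∃ (s : P.base → P.total.atlas) (U : Set P.base),
    IsOpen U ∧ n ∈ U ∧ ∀ z ∈ U, ContMDiffAt (𝓡 P.base.dim) (𝓡 P.total.atlas.dim) ∞ s z ∧
      P.bp (s z) = z ∧ s z ∈ (trivializationAt (EuclideanSpace ℝ (Fin P.total.atlas.dim))
        (TangentSpace (𝓡 P.total.atlas.dim) (M := P.total.atlas)) (s n)).baseSet := by
  obtain ⟨m, rfl⟩ := P.bp_surjective n
  obtain ⟨s, -, s2, s3⟩ := P.exists_section m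
  have h1 : ∀ᶠ z in 𝓝 (P.bp m), s z ∈ (trivializationAt (EuclideanSpace ℝ (Fin P.total.atlas.dim))
      (TangentSpace (𝓡 P.total.atlas.dim) (M := P.total.atlas)) (s (P.bp m))).baseSet :=
    s2.continuousAt.eventually ((trivializationAt (EuclideanSpace ℝ (Fin P.total.atlas.dim))
      (TangentSpace (𝓡 P.total.atlas.dim) (M := P.total.atlas)) (s (P.bp m))).open_baseSet.mem_nhds
      (FiberBundle.mem_baseSet_trivializationAt (EuclideanSpace ℝ (Fin P.total.atlas.dim))
        (TangentSpace (𝓡 P.total.atlas.dim) (M := P.total.atlas)) (s (P.bp m))))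
  obtain ⟨U, hUs, hU, hmU⟩ := mem_nhds_iff.1 (s2.and (s3.and h1))
  exact ⟨s, U, hU, hmU, fun z hz => hUs hz⟩

/-- A local section of the bundle projection. -/
noncomputable def sec (i : P.base) : P.base → P.total.atlas := (P.exists_local_section i).choose

/-- The domain of the local section. -/
noncomputable def dom (i : P.base) : Set P.base := (P.exists_local_section i).choose_spec.choose

theorem isOpen_dom (i : P.base) : IsOpen (P.dom i) :=
  (P.exists_local_section i).choose_spec.choose_spec.1

theorem mem_dom (i : P.base) : i ∈ P.dom i :=
  (P.exists_local_section i).choose_spec.choose_spec.2.1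

variable {P}

theorem smoothNear_sec {i n : P.base} (h : n ∈ P.dom i) :
    SmoothNear (𝓡 P.base.dim) (𝓡 P.total.atlas.dim) (P.sec i) n := by
  filter_upwards [(P.isOpen_dom i).mem_nhds h] with z hz using
    ((P.exists_local_section i).choose_spec.choose_spec.2.2 z hz).1

theorem bp_sec {i n : P.base} (h : n ∈ P.dom i) : P.bp (P.sec i n) = n :=
  ((P.exists_local_section i).choose_spec.choose_spec.2.2 n h).2.1

theorem sec_mem_baseSet {i n : P.base} (h : n ∈ P.dom i) :
    P.sec i n ∈ (trivializationAt (EuclideanSpace ℝ (Fin P.total.atlas.dim))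
        (TangentSpace (𝓡 P.total.atlas.dim) (M := P.total.atlas)) (P.sec i i)).baseSet :=
  ((P.exists_local_section i).choose_spec.choose_spec.2.2 n h).2.2

/-! ### The vector bundle `(TP)/G` -/

variable (P) in
/-- The fibres of `(TP)/G`. -/
def AtiyahFiber (n : P.base) : Type u := {a : P.Atiyah // P.atiyahProj a = n}

namespace AtiyahFiber

/-- A tangent space of the atlas as a fibre of `(TP)/G`. -/
noncomputable def equiv {n : P.base} {m : P.total.atlas} (h : P.bp m = n) :
    P.total.atlas.T m ≃ P.AtiyahFiber n where
  toFun v := ⟨P.bcls ⟨m, v⟩, h⟩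
  invFun a := rep a.1 m
  left_inv v := rep_bcls m v
  right_inv a := Subtype.ext (bcls_rep (h.trans a.2.symm))

noncomputable instance (n : P.base) : AddCommGroup (P.AtiyahFiber n) :=
  (equiv (bp_pt n)).symm.addCommGroup

noncomputable instance (n : P.base) : Module ℝ (P.AtiyahFiber n) :=
  (equiv (bp_pt n)).symm.module ℝ

/-- A tangent space of the atlas as a fibre of `(TP)/G`, linearly. -/
noncomputable def lin {n : P.base} {m : P.total.atlas} (h : P.bp m = n) :
    P.total.atlas.T m ≃ₗ[ℝ] P.AtiyahFiber n :=
  have key : ∃ T : P.total.atlas.T m →ₗ[ℝ] P.AtiyahFiber n, ∀ v, equiv h v = T v := by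
    -- The structure of the fibre comes from the chosen point; the comparison with `m` is the
    -- derivative of a local lift of a translation, hence linear.
    obtain ⟨g, k, hk1, hk2, hk3⟩ := exists_translation (h.trans (bp_pt n).symm)
    have h0 : P.bp (k m) = n := by rw [hk1, bp_pt]
    have h1 : ∀ v, equiv h v = equiv h0
        (mfderiv (𝓡 P.total.atlas.dim) (𝓡 P.total.atlas.dim) k m v) := fun v =>
      Subtype.ext (bcls_tangentMap (g := g) ⟨m, v⟩ hk2 hk3).symm
    -- The point `k m` equals the chosen point only propositionally, so the derivative is replaced
    -- by a variable before its target is rewritten.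
    generalize mfderiv (𝓡 P.total.atlas.dim) (𝓡 P.total.atlas.dim) k m = D at h1
    revert D h0
    rw [hk1]
    intro h0 D h1
    exact ⟨((equiv (bp_pt n)).symm.linearEquiv ℝ).symm.toLinearMap.comp D.toLinearMap, h1⟩
  { equiv h with
    map_add' := fun v w => by
      obtain ⟨T, hT⟩ := key
      change equiv h _ = equiv h _ + equiv h _
      rw [hT, hT, hT, map_add]
    map_smul' := fun c v => by
      obtain ⟨T, hT⟩ := key
      change equiv h _ = c • equiv h _
      rw [hT, hT, map_smul] }

theorem lin_val {n : P.base} {m : P.total.atlas} (h : P.bp m = n) (v : P.total.atlas.T m) :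
    (lin h v).1 = P.bcls ⟨m, v⟩ := rfl

/-- On the domain of the section the coordinates are those of the representative along it; elsewhere
any isomorphism will do, because smoothness is required only on the domain. -/
theorem exists_coord (i n : P.base) : ∃ L : P.AtiyahFiber n ≃ₗ[ℝ]
    EuclideanSpace ℝ (Fin P.total.atlas.dim), n ∈ P.dom i → ∀ a,
      L a = (trivializationAt (EuclideanSpace ℝ (Fin P.total.atlas.dim))
        (TangentSpace (𝓡 P.total.atlas.dim) (M := P.total.atlas)) (P.sec i i)
          ⟨P.sec i n, rep a.1 (P.sec i n)⟩).2 := by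
  by_cases hn : n ∈ P.dom i
  · refine ⟨(lin (bp_sec hn)).symm.trans ((trivializationAt
      (EuclideanSpace ℝ (Fin P.total.atlas.dim))
      (TangentSpace (𝓡 P.total.atlas.dim) (M := P.total.atlas)) (P.sec i i)).continuousLinearEquivAt ℝ
        (P.sec i n) (sec_mem_baseSet hn)).toLinearEquiv, fun _ a => rfl⟩
  · exact ⟨(lin (bp_pt n)).symm, fun h => (hn h).elim⟩

variable (P) in
/-- The coordinates on the fibres of `(TP)/G` near a point of the base. -/
noncomputable def frames : SmoothFrames P.base P.total.atlas.dim P.AtiyahFiber where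
  U := P.dom
  isOpen_U := P.isOpen_dom
  mem_U := P.mem_dom
  L i n := (exists_coord i n).choose
  smooth i j x n hi hj := by
    let t := fun i => trivializationAt (EuclideanSpace ℝ (Fin P.total.atlas.dim))
      (TangentSpace (𝓡 P.total.atlas.dim) (M := P.total.atlas)) (P.sec i i)
    have hUi := (P.isOpen_dom i).mem_nhds hi
    have hUj := (P.isOpen_dom j).mem_nhds hj
    have hV : ContMDiffAt (𝓡 P.base.dim) (𝓡 P.total.atlas.dim).tangent ∞
        (fun z => (⟨P.sec i z, (t i).symm (P.sec i z) x⟩ :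
          TangentBundle (𝓡 P.total.atlas.dim) P.total.atlas)) n := by
      refine ((t i).contMDiffAt_iff (f := fun z => (⟨P.sec i z, (t i).symm (P.sec i z) x⟩ :
        TangentBundle (𝓡 P.total.atlas.dim) P.total.atlas)) (x₀ := n)
        ((t i).mem_source.2 (sec_mem_baseSet hi))).2 ⟨(smoothNear_sec hi).contMDiffAt,
          (contMDiffAt_const (c := x)).congr_of_eventuallyEq ?_⟩
      filter_upwards [hUi] with z hz
      rw [(t i).apply_mk_symm (sec_mem_baseSet hz)]
    -- The vectors with constant coordinates along section `i`, moved to section `j` within their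
    -- classes. Their smoothness is the smoothness of the change of coordinates.
    let W : P.base → TangentBundle (𝓡 P.total.atlas.dim) P.total.atlas := fun z =>
      ⟨P.sec j z, rep ((exists_coord i z).choose.symm x).1 (P.sec j z)⟩
    have hW : ContMDiffAt (𝓡 P.base.dim) (𝓡 P.total.atlas.dim).tangent ∞ W n := by
      refine contMDiffAt_of_bcls_eq (T := P.base) (k := fun z => z) (a := P.sec i) (b := P.sec j)
        (smoothNear_sec hi) (smoothNear_sec hj) ?_ contMDiffAt_id hV
        (Filter.Eventually.of_forall fun _ => rfl) (Filter.Eventually.of_forall fun _ => rfl) ?_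
      · filter_upwards [hUi, hUj] with z hzi hzj
        rw [bp_sec hzi, bp_sec hzj]
      · filter_upwards [hUi, hUj] with z hzi hzj
        refine (bcls_rep ((bp_sec hzj).trans
          ((exists_coord i z).choose.symm x).2.symm)).trans ?_
        have h1 : (exists_coord i z).choose.symm x =
            lin (bp_sec hzi) ((t i).symm (P.sec i z) x) := by
          rw [LinearEquiv.symm_apply_eq, (exists_coord i z).choose_spec hzi, lin_val]
          rw [rep_bcls, (t i).apply_mk_symm (sec_mem_baseSet hzi)]
        rw [h1, lin_val]
    have hW2 := (((t j).contMDiffAt_iff (f := W) (x₀ := n)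
      ((t j).mem_source.2 (sec_mem_baseSet hj))).1 hW).2
    refine hW2.congr_of_eventuallyEq ?_
    filter_upwards [hUj] with z hzj
    rw [(exists_coord j z).choose_spec hzj]

theorem frames_L {i n : P.base} (hn : n ∈ P.dom i) (a : P.AtiyahFiber n) : (frames P).L i n a =
    (trivializationAt (EuclideanSpace ℝ (Fin P.total.atlas.dim))
        (TangentSpace (𝓡 P.total.atlas.dim) (M := P.total.atlas)) (P.sec i i)
          ⟨P.sec i n, rep a.1 (P.sec i n)⟩).2 := (exists_coord i n).choose_spec hn a

noncomputable instance (n : P.base) : TopologicalSpace (P.AtiyahFiber n) := (frames P).topFiber n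

theorem isInducing (n : P.base) : IsInducing ((frames P).L n n) := ⟨rfl⟩

noncomputable instance : TopologicalSpace (Bundle.TotalSpace
    (EuclideanSpace ℝ (Fin P.total.atlas.dim)) P.AtiyahFiber) :=
  ((frames P).prebundle isInducing).totalSpaceTopology

noncomputable instance : FiberBundle (EuclideanSpace ℝ (Fin P.total.atlas.dim)) P.AtiyahFiber :=
  ((frames P).prebundle isInducing).toFiberBundle

instance : VectorBundle ℝ (EuclideanSpace ℝ (Fin P.total.atlas.dim)) P.AtiyahFiber :=
  ((frames P).prebundle isInducing).toVectorBundle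

instance : ContMDiffVectorBundle ∞ (EuclideanSpace ℝ (Fin P.total.atlas.dim)) P.AtiyahFiber
    (𝓡 P.base.dim) :=
  ((frames P).prebundle isInducing).contMDiffVectorBundle (𝓡 P.base.dim)

end AtiyahFiber

variable (P) in
/-- The vector bundle `(TP)/G`. -/
noncomputable def atiyahBundle : P.AtiyahBundle P.total.atlas.dim P.AtiyahFiber where
  e n := Equiv.refl _
  linear m := (AtiyahFiber.lin (rfl : P.bp m = P.bp m)).toLinearMap.isLinear
  smooth := by
    intro x
    have hp : ContMDiff (𝓡 P.total.atlas.dim).tangent (𝓡 P.total.atlas.dim) ∞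
        (Bundle.TotalSpace.proj : TangentBundle (𝓡 P.total.atlas.dim) P.total.atlas → P.total.atlas) :=
      Bundle.contMDiff_proj (TangentSpace (𝓡 P.total.atlas.dim) (M := P.total.atlas))
    have hb := P.bp_smooth.smoothNear x.proj
    have hd := P.mem_dom (P.bp x.proj)
    have hUd := (P.isOpen_dom (P.bp x.proj)).mem_nhds hd
    refine (AtiyahFiber.frames P).contMDiffAt_total AtiyahFiber.isInducing
      (hb.contMDiffAt.comp x hp.contMDiffAt) ?_
    -- Each tangent vector is moved within its class to the section over the same base point, where
    -- the coordinates of `(TP)/G` are read off.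
    let W : TangentBundle (𝓡 P.total.atlas.dim) P.total.atlas →
        TangentBundle (𝓡 P.total.atlas.dim) P.total.atlas := fun z =>
      ⟨P.sec (P.bp x.proj) (P.bp z.proj), rep (P.bcls z) (P.sec (P.bp x.proj) (P.bp z.proj))⟩
    have hU : ∀ᶠ z in 𝓝 x.proj, P.bp z ∈ P.dom (P.bp x.proj) := hb.continuousAt.eventually hUd
    have hW : ContMDiffAt (𝓡 P.total.atlas.dim).tangent (𝓡 P.total.atlas.dim).tangent ∞ W x := by
      refine contMDiffAt_of_bcls_eq (T := P.total.atlas) (k := Bundle.TotalSpace.proj)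
        (a := fun z => z) (b := fun z => P.sec (P.bp x.proj) (P.bp z)) (V := fun z => z)
        (smoothNear_id _) ((smoothNear_sec hd).comp hb) ?_ hp.contMDiffAt contMDiffAt_id
        (Filter.Eventually.of_forall fun _ => rfl) (Filter.Eventually.of_forall fun _ => rfl) ?_
      · filter_upwards [hU] with z hz
        rw [bp_sec hz]
      · filter_upwards [hp.continuous.continuousAt.eventually hU] with z hz
        exact bcls_rep (bp_sec hz)
    have hW2 := (((trivializationAt (EuclideanSpace ℝ (Fin P.total.atlas.dim))
      (TangentSpace (𝓡 P.total.atlas.dim) (M := P.total.atlas))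
      (P.sec (P.bp x.proj) (P.bp x.proj))).contMDiffAt_iff (f := W) (x₀ := x)
      (Bundle.Trivialization.mem_source _ |>.2 (sec_mem_baseSet hd))).1 hW).2
    refine hW2.congr_of_eventuallyEq ?_
    filter_upwards [hp.continuous.continuousAt.eventually hU] with z hz
    exact AtiyahFiber.frames_L hz _

end QPrincipalBundle

namespace QPrincipalBundle

variable {P : QPrincipalBundle.{u}}

/-! ### The Lie algebra bundle `P ×_Ad 𝔤` -/

variable (P) in
/-- The fibres of `P ×_Ad 𝔤`. -/
def AdFiber (n : P.base) : Type u := {l : P.AdBundle // P.adProj l = n}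

namespace AdFiber

/-- The Lie algebra as a fibre of `P ×_Ad 𝔤`. -/
noncomputable def equiv {n : P.base} {p : P.total} (h : P.proj p = n) :
    P.group.LieAlg ≃ P.AdFiber n :=
  Equiv.ofBijective (fun w => ⟨P.adMk p w, h⟩)
    ⟨fun _ _ hwv => adMk_injective p (congrArg Subtype.val hwv), fun a => by
      obtain ⟨w, hw⟩ := exists_adMk_eq a.1 (h.trans a.2.symm)
      exact ⟨w, Subtype.ext hw⟩⟩

noncomputable instance (n : P.base) : AddCommGroup (P.AdFiber n) :=
  (equiv (p := P.total.chart (P.pt n)) (bp_pt n)).symm.addCommGroup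

noncomputable instance (n : P.base) : Module ℝ (P.AdFiber n) :=
  (equiv (p := P.total.chart (P.pt n)) (bp_pt n)).symm.module ℝ

/-- The Lie algebra as a fibre of `P ×_Ad 𝔤`, linearly. -/
noncomputable def lin {n : P.base} {p : P.total} (h : P.proj p = n) :
    P.group.LieAlg ≃ₗ[ℝ] P.AdFiber n :=
  have key : ∃ T : P.group.LieAlg →ₗ[ℝ] P.AdFiber n, ∀ v, equiv h v = T v := by
    have h0 : P.proj (P.total.chart (P.pt n)) = n := bp_pt n
    obtain ⟨g, rfl⟩ := (P.fiber_eq_orbit (P.total.chart (P.pt n)) p).1 (h.trans h0.symm)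
    -- Passing from `p` to `pg` acts on representatives by `Ad g`, which is linear.
    exact ⟨((equiv h0).symm.linearEquiv ℝ).symm.toLinearMap.comp
      (QGroup.lieMap (P.group.smooth_conj g) (QGroup.conj_one g)),
      fun v => Subtype.ext (adMk_act _ g v)⟩
  { equiv h with
    map_add' := fun v w => by
      obtain ⟨T, hT⟩ := key
      change equiv h _ = equiv h _ + equiv h _
      rw [hT, hT, hT, map_add]
    map_smul' := fun c v => by
      obtain ⟨T, hT⟩ := key
      change equiv h _ = c • equiv h _
      rw [hT, hT, map_smul] }

theorem eq_lin_iff {n : P.base} {p : P.total} (h : P.proj p = n) (a : P.AdFiber n)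
    (w : P.group.LieAlg) : a = lin h w ↔ a.1 = P.adMk p w := Subtype.ext_iff

theorem exists_point (i n : P.base) : ∃ p : P.total, P.proj p = n ∧
    (n ∈ P.dom i → p = P.total.chart (P.sec i n)) := by
  by_cases hn : n ∈ P.dom i
  · exact ⟨_, bp_sec hn, fun _ => rfl⟩
  · exact ⟨P.total.chart (P.pt n), bp_pt n, fun h => (hn h).elim⟩

/-- The coordinates on the fibres of `P ×_Ad 𝔤` with respect to a local section. -/
noncomputable def coord (i n : P.base) :
    P.AdFiber n ≃ₗ[ℝ] EuclideanSpace ℝ (Fin P.group.atlas.dim) :=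
  (lin (exists_point i n).choose_spec.1).symm.trans (QGroup.coord P.group.chart_unit)

theorem coord_eq_iff {i n : P.base} (hn : n ∈ P.dom i) (a : P.AdFiber n) (w : P.group.LieAlg) :
    coord i n a = QGroup.coord P.group.chart_unit w ↔
      a.1 = P.adMk (P.total.chart (P.sec i n)) w := by
  rw [coord, LinearEquiv.trans_apply, EmbeddingLike.apply_eq_iff_eq, LinearEquiv.symm_apply_eq,
    eq_lin_iff, (exists_point i n).choose_spec.2 hn]

variable (P) in
/-- The coordinates on the fibres of `P ×_Ad 𝔤` near a point of the base. -/
noncomputable def frames : SmoothFrames P.base P.group.atlas.dim P.AdFiber where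
  U := P.dom
  isOpen_U := P.isOpen_dom
  mem_U := P.mem_dom
  L := coord
  smooth i j x n hi hj := by
    have hUi := (P.isOpen_dom i).mem_nhds hi
    have hUj := (P.isOpen_dom j).mem_nhds hj
    have hij : ∀ᶠ z in 𝓝 n, P.bp (P.sec j z) = P.bp (P.sec i z) := by
      filter_upwards [hUi, hUj] with z hzi hzj
      rw [bp_sec hzi, bp_sec hzj]
    obtain ⟨g, hg⟩ := P.exists_act_of_bp_eq hij.self_of_nhds
    -- Section `i` is section `j` translated by a smooth `γ`, so the coordinates change by `Ad γ`,
    -- which is smooth in the point.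
    obtain ⟨γ, -, h2, h3⟩ := exists_division (smoothNear_sec hj) (smoothNear_sec hi) hij hg
    refine (QGroup.contMDiffAt_Ad (T := P.base) (k := fun z => z) (X := fun _ => x) h2 contMDiffAt_id
      contMDiffAt_const P.group.chart_unit P.group.chart_unit).congr_of_eventuallyEq ?_
    filter_upwards [h3, hUi, hUj] with z hz hzi hzj
    rw [coord_eq_iff hzj, ← adMk_act, ← hz, ← coord_eq_iff hzi, LinearEquiv.apply_symm_apply]
    exact ((QGroup.coord P.group.chart_unit).apply_symm_apply x).symm

noncomputable instance (n : P.base) : TopologicalSpace (P.AdFiber n) := (frames P).topFiber n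

theorem isInducing (n : P.base) : IsInducing ((frames P).L n n) := ⟨rfl⟩

noncomputable instance : TopologicalSpace (Bundle.TotalSpace
    (EuclideanSpace ℝ (Fin P.group.atlas.dim)) P.AdFiber) :=
  ((frames P).prebundle isInducing).totalSpaceTopology

noncomputable instance : FiberBundle (EuclideanSpace ℝ (Fin P.group.atlas.dim)) P.AdFiber :=
  ((frames P).prebundle isInducing).toFiberBundle

instance : VectorBundle ℝ (EuclideanSpace ℝ (Fin P.group.atlas.dim)) P.AdFiber :=
  ((frames P).prebundle isInducing).toVectorBundle

instance : ContMDiffVectorBundle ∞ (EuclideanSpace ℝ (Fin P.group.atlas.dim)) P.AdFiber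
    (𝓡 P.base.dim) :=
  ((frames P).prebundle isInducing).contMDiffVectorBundle (𝓡 P.base.dim)

end AdFiber

variable (P) in
/-- The Lie algebra bundle `P ×_Ad 𝔤`. -/
noncomputable def adLieBundle : P.AdLieBundle P.group.atlas.dim P.AdFiber where
  e n := Equiv.refl _
  linear p k hk := ((AdFiber.lin (rfl : P.proj p = P.proj p)).toLinearMap.comp
    (QGroup.lieMkEquiv hk).toLinearMap).isLinear
  smooth k hk := by
    intro x
    have hp : ContMDiffAt ((𝓡 P.total.atlas.dim).prod (𝓡 P.group.atlas.dim)) (𝓡 P.total.atlas.dim) ∞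
        (Prod.fst : P.total.atlas × EuclideanSpace ℝ (Fin P.group.atlas.dim) → P.total.atlas) x :=
      contMDiffAt_fst
    have hb := P.bp_smooth.smoothNear x.1
    have hd := P.mem_dom (P.bp x.1)
    have hU : ∀ᶠ z in 𝓝 x.1, P.bp z ∈ P.dom (P.bp x.1) :=
      hb.continuousAt.eventually ((P.isOpen_dom (P.bp x.1)).mem_nhds hd)
    refine (AdFiber.frames P).contMDiffAt_total AdFiber.isInducing (hb.contMDiffAt.comp x hp) ?_
    have hij : ∀ᶠ z in 𝓝 x.1, P.bp (P.sec (P.bp x.1) (P.bp z)) = P.bp z :=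
      hU.mono fun z hz => bp_sec hz
    obtain ⟨g, hg⟩ := P.exists_act_of_bp_eq hij.self_of_nhds
    -- Division compares an arbitrary point with the section over the same base point; the
    -- coordinates of `[(z, w)]` are then those of `Ad (γ z) w`.
    obtain ⟨γ, -, h2, h3⟩ := exists_division (T := P.total.atlas)
      (a := fun z => P.sec (P.bp x.1) (P.bp z)) ((smoothNear_sec hd).comp hb)
      (smoothNear_id _) hij hg
    refine (QGroup.contMDiffAt_Ad (T := P.total.atlas) (k := Prod.fst) (X := Prod.snd) h2 hp
      contMDiffAt_snd hk P.group.chart_unit).congr_of_eventuallyEq ?_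
    filter_upwards [hp.continuousAt.eventually h3, hp.continuousAt.eventually hU] with z hz hzi
    refine (AdFiber.coord_eq_iff hzi _ _).2 ?_
    rw [← adMk_act, ← hz]
    rfl

theorem nonempty_atiyahSequenceOf (P : QPrincipalBundle.{u}) : Nonempty P.AtiyahSequenceOf :=
  ⟨P.atiyahBundle.sequenceOf P.adLieBundle⟩

end QPrincipalBundle

namespace QPrincipalBundle

variable {P Q : QPrincipalBundle.{u}} (F : Hom P Q)

namespace Hom

/-! ### The maps that are induced by a morphism -/

theorem exists_lift (m : P.total.atlas) : ∃ g : P.total.atlas → Q.total.atlas,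
    SmoothNear (𝓡 P.total.atlas.dim) (𝓡 Q.total.atlas.dim) g m ∧
      ∀ᶠ z in 𝓝 m, Q.total.chart (g z) = F.map (P.total.chart z) := by
  obtain ⟨y, hy⟩ := Q.total.surjective (F.map (P.total.chart m))
  obtain ⟨g, -, h2, h3⟩ := F.map_smooth.exists_lift hy.symm
  exact ⟨g, h2, h3⟩

variable {F} in
theorem bp_lift {m : P.total.atlas} {y : Q.total.atlas} (h : Q.total.chart y = F.map (P.total.chart m)) :
    Q.bp y = F.base (P.bp m) := by
  rw [bp, h, F.proj_map]

variable {F} in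
theorem atiyah_bcls {g : P.total.atlas → Q.total.atlas} {m : P.total.atlas}
    (hg : SmoothNear (𝓡 P.total.atlas.dim) (𝓡 Q.total.atlas.dim) g m)
    (hl : ∀ᶠ z in 𝓝 m, Q.total.chart (g z) = F.map (P.total.chart z)) (v : P.total.atlas.T m) :
    F.atiyah (P.bcls ⟨m, v⟩) =
      Q.bcls ⟨g m, mfderiv (𝓡 P.total.atlas.dim) (𝓡 Q.total.atlas.dim) g m v⟩ :=
  congrArg Q.quotTP (F.map_smooth.tmap_tcls ⟨m, v⟩ hg hl)

theorem atiyahProj_atiyah (a : P.Atiyah) : Q.atiyahProj (F.atiyah a) = F.base (P.atiyahProj a) := by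
  induction a using Quot.inductionOn with
  | h v =>
    change Q.proj (Q.total.tproj (F.map_smooth.tmap v)) = F.base (P.proj (P.total.tproj v))
    rw [QManifold.Smooth.tproj_tmap, F.proj_map]

theorem adProj_ad (l : P.AdBundle) : Q.adProj (F.ad l) = F.base (P.adProj l) := by
  induction l using Quot.inductionOn with
  | h x => exact F.proj_map x.1

/-- The derivative at `g = 1` of `F(pg) = F(p) Θ(g)`. -/
theorem atiyah_iota (l : P.AdBundle) : F.atiyah (P.iota l) = Q.iota (F.ad l) := by
  induction l using Quot.inductionOn with
  | h x =>
    obtain ⟨p, w⟩ := x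
    have h1 : P.group.Smooth Q.total (fun g => F.map (P.act p g)) :=
      F.map_smooth.comp (P.act_smooth_right p) P.total.surjective
    have h2 : P.group.Smooth Q.total (fun g => Q.act (F.map p) (F.group g)) :=
      (Q.act_smooth_right (F.map p)).comp F.group_smooth Q.group.surjective
    refine congrArg Q.quotTP ?_
    change F.map_smooth.tmap ((P.act_smooth_right p).tmap w.1) =
      (Q.act_smooth_right (F.map p)).tmap (F.group_smooth.tmap w.1)
    rw [← F.map_smooth.tmap_comp (P.act_smooth_right p) h1,
      ← (Q.act_smooth_right (F.map p)).tmap_comp F.group_smooth h2]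
    exact QManifold.Smooth.tmap_congr _ _ (funext fun g => F.map_act p g) _

theorem atiyah_id (a : P.Atiyah) : Hom.atiyah (𝟙 P : P ⟶ P) a = a := by
  induction a using Quot.inductionOn with
  | h v => exact congrArg P.quotTP (QManifold.Smooth.tmap_id _ v)

theorem ad_id (l : P.AdBundle) : Hom.ad (𝟙 P : P ⟶ P) l = l := by
  induction l using Quot.inductionOn with
  | h x => exact congrArg (P.adMk x.1) (Subtype.ext (QManifold.Smooth.tmap_id _ x.2.1))

theorem atiyah_comp {R : QPrincipalBundle.{u}} (F : P ⟶ Q) (F' : Q ⟶ R) (a : P.Atiyah) :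
    Hom.atiyah (F ≫ F') a = Hom.atiyah F' (Hom.atiyah F a) := by
  induction a using Quot.inductionOn with
  | h v => exact congrArg R.quotTP (F'.map_smooth.tmap_comp F.map_smooth (F ≫ F').map_smooth v)

theorem ad_comp {R : QPrincipalBundle.{u}} (F : P ⟶ Q) (F' : Q ⟶ R) (l : P.AdBundle) :
    Hom.ad (F ≫ F') l = Hom.ad F' (Hom.ad F l) := by
  induction l using Quot.inductionOn with
  | h x => exact congrArg (R.adMk _) (Subtype.ext
      (F'.group_smooth.tmap_comp F.group_smooth (F ≫ F').group_smooth x.2.1))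

section Atiyah

variable {r r' : ℕ} {E : P.base → Type u} [∀ n, AddCommGroup (E n)]
    [∀ n, Module ℝ (E n)] [∀ n, TopologicalSpace (E n)]
    [TopologicalSpace (Bundle.TotalSpace (EuclideanSpace ℝ (Fin r)) E)]
    [FiberBundle (EuclideanSpace ℝ (Fin r)) E] [VectorBundle ℝ (EuclideanSpace ℝ (Fin r)) E]
    {E' : Q.base → Type u} [∀ n, AddCommGroup (E' n)]
    [∀ n, Module ℝ (E' n)] [∀ n, TopologicalSpace (E' n)]
    [TopologicalSpace (Bundle.TotalSpace (EuclideanSpace ℝ (Fin r')) E')]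
    [FiberBundle (EuclideanSpace ℝ (Fin r')) E'] [VectorBundle ℝ (EuclideanSpace ℝ (Fin r')) E']
    (𝔢 : P.AtiyahBundle r E) (𝔢' : Q.AtiyahBundle r' E')

noncomputable def atiyahFun (n : P.base) (a : E n) : E' (F.base n) :=
  𝔢'.e _ ⟨F.atiyah ((𝔢.e n).symm a).1, by rw [atiyahProj_atiyah, ((𝔢.e n).symm a).2]⟩

variable {F} in
theorem atiyahFun_linAt {g : P.total.atlas → Q.total.atlas} {m : P.total.atlas}
    (hg : SmoothNear (𝓡 P.total.atlas.dim) (𝓡 Q.total.atlas.dim) g m)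
    (hl : ∀ᶠ z in 𝓝 m, Q.total.chart (g z) = F.map (P.total.chart z)) {n : P.base}
    (h : P.bp m = n) (h' : Q.bp (g m) = F.base n) (v : P.total.atlas.T m) :
    F.atiyahFun 𝔢 𝔢' n (𝔢.linAt h v) =
      𝔢'.linAt h' (mfderiv (𝓡 P.total.atlas.dim) (𝓡 Q.total.atlas.dim) g m v) := by
  refine congrArg (𝔢'.e _) (Subtype.ext ?_)
  refine (congrArg (fun a : {a : P.Atiyah // P.atiyahProj a = n} => F.atiyah a.1)
    ((𝔢.e n).symm_apply_apply ⟨P.bcls ⟨m, v⟩, h⟩)).trans (atiyah_bcls hg hl v)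

/-- The linear map of fibres that is induced by a morphism. -/
noncomputable def atiyahLin (n : P.base) : E n →ₗ[ℝ] E' (F.base n) :=
  have key : ∃ T : E n →ₗ[ℝ] E' (F.base n), ∀ a, F.atiyahFun 𝔢 𝔢' n a = T a := by
    obtain ⟨g, hg, hl⟩ := F.exists_lift (P.pt n)
    have h' : Q.bp (g (P.pt n)) = F.base n := by rw [bp_lift hl.self_of_nhds, bp_pt]
    let D : P.total.atlas.T (P.pt n) →ₗ[ℝ] Q.total.atlas.T (g (P.pt n)) :=
      (mfderiv (𝓡 P.total.atlas.dim) (𝓡 Q.total.atlas.dim) g (P.pt n)).toLinearMap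
    refine ⟨(𝔢'.linAt h').toLinearMap.comp (D.comp (𝔢.linAt (bp_pt n)).symm.toLinearMap),
      fun a => ?_⟩
    obtain ⟨v, rfl⟩ := (𝔢.linAt (bp_pt n)).surjective a
    rw [atiyahFun_linAt 𝔢 𝔢' hg hl _ h']
    simp only [LinearMap.comp_apply, LinearEquiv.coe_coe, LinearEquiv.symm_apply_apply]
    rfl
  { toFun := F.atiyahFun 𝔢 𝔢' n
    map_add' := fun v w => by
      obtain ⟨T, hT⟩ := key
      rw [hT, hT, hT, map_add]
    map_smul' := fun c v => by
      obtain ⟨T, hT⟩ := key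
      rw [hT, hT, map_smul]; rfl }

variable {F} in
theorem atiyahLin_linAt {g : P.total.atlas → Q.total.atlas} {m : P.total.atlas}
    (hg : SmoothNear (𝓡 P.total.atlas.dim) (𝓡 Q.total.atlas.dim) g m)
    (hl : ∀ᶠ z in 𝓝 m, Q.total.chart (g z) = F.map (P.total.chart z)) {n : P.base}
    (h : P.bp m = n) (h' : Q.bp (g m) = F.base n) (v : P.total.atlas.T m) :
    F.atiyahLin 𝔢 𝔢' n (𝔢.linAt h v) =
      𝔢'.linAt h' (mfderiv (𝓡 P.total.atlas.dim) (𝓡 Q.total.atlas.dim) g m v) :=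
  atiyahFun_linAt 𝔢 𝔢' hg hl h h' v

/-- Near a given point the map is a composite of smooth maps: representatives along a section, the
tangent map of a local lift of `F`, and the quotient map of the target. -/
theorem atiyahLin_smooth [ContMDiffVectorBundle ∞ (EuclideanSpace ℝ (Fin r)) E (𝓡 P.base.dim)] :
    ContMDiff ((𝓡 P.base.dim).prod (𝓡 r)) ((𝓡 Q.base.dim).prod (𝓡 r')) ∞
      (fun a : Bundle.TotalSpace (EuclideanSpace ℝ (Fin r)) E =>
        (⟨F.base a.proj, F.atiyahLin 𝔢 𝔢' a.proj a.2⟩ :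
          Bundle.TotalSpace (EuclideanSpace ℝ (Fin r')) E')) := by
  intro a₀
  obtain ⟨m, hm⟩ := P.bp_surjective a₀.proj
  obtain ⟨s, s1, s2, s3⟩ := P.exists_section m
  rw [hm] at s1 s2 s3
  obtain ⟨g, hg, hl⟩ := F.exists_lift (s a₀.proj)
  have hp : ContinuousAt (Bundle.TotalSpace.proj :
      Bundle.TotalSpace (EuclideanSpace ℝ (Fin r)) E → P.base) a₀ :=
    (Bundle.contMDiff_proj (IB := 𝓡 P.base.dim) (n := ∞) E).contMDiffAt.continuousAt
  have hc : ContinuousAt (fun a : Bundle.TotalSpace (EuclideanSpace ℝ (Fin r)) E => s a.proj) a₀ :=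
    s2.continuousAt.comp hp
  -- The lift does not depend on a parameter; a constant one is supplied.
  have key := contMDiffAt_tangentMap_param (g := fun x : P.total.atlas × P.base => g x.1)
    (c := fun _ : Bundle.TotalSpace (EuclideanSpace ℝ (Fin r)) E => a₀.proj) (t₀ := a₀)
    (hg.contMDiffAt.comp (s a₀.proj, a₀.proj) contMDiffAt_fst) (𝔢.contMDiffAt_vec a₀ s2 s3)
    (contMDiffAt_const (I' := 𝓡 P.base.dim))
  refine ((𝔢'.contMDiff_quot _).comp a₀ key).congr_of_eventuallyEq ?_
  filter_upwards [hp.eventually s3, hc.eventually hg.eventually,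
    hc.eventually (eventually_eventually_nhds.2 hl)] with a h1 h2 h3
  have h' : Q.bp (g (s a.proj)) = F.base a.proj := by rw [bp_lift h3.self_of_nhds, h1]
  refine Eq.trans ?_ (𝔢'.mk_linAt h' _)
  rw [← atiyahLin_linAt 𝔢 𝔢' h2 h3 h1]
  exact congrArg (fun b => (⟨F.base a.proj, F.atiyahLin 𝔢 𝔢' _ b⟩ : Bundle.TotalSpace _ E'))
    ((𝔢.linAt h1).apply_symm_apply a.2).symm

end Atiyah

end Hom

/-! ### The morphism of Lie algebroids induced by a morphism of bundles -/

namespace AtiyahSequenceOf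

variable (𝔖 : P.AtiyahSequenceOf) (𝔗 : Q.AtiyahSequenceOf)

/-- The vector bundle `(TP)/G` of an Atiyah sequence. -/
def atiyahBundle : P.AtiyahBundle 𝔖.seq.A.rank 𝔖.seq.A.fiber := ⟨𝔖.eA, 𝔖.eA_linear, 𝔖.eA_smooth⟩

theorem mk_anchor {n : P.base} {m : P.total.atlas} (h : P.bp m = n) (v : P.total.atlas.T m) :
    (⟨n, 𝔖.seq.A.anchor n (𝔖.atiyahBundle.linAt h v)⟩ : TangentBundle (𝓡 P.base.dim) P.base) =
      tangentMap (𝓡 P.total.atlas.dim) (𝓡 P.base.dim) P.bp ⟨m, v⟩ := by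
  subst h
  exact Bundle.TotalSpace.mk_inj.2 (𝔖.anchor_eA m v)

theorem linAt_field (σ : 𝔖.seq.A.Sec) {n : P.base} {m : P.total.atlas} (h : P.bp m = n) :
    𝔖.atiyahBundle.linAt h (𝔖.atiyahBundle.field σ m) = σ n := by
  subst h
  exact 𝔖.atiyahBundle.lin_field σ m

theorem bracket_eq (σ τ : 𝔖.seq.A.Sec) {n : P.base} {m : P.total.atlas} (h : P.bp m = n) :
    𝔖.seq.A.bracket σ τ n = 𝔖.atiyahBundle.linAt h (VectorField.mlieBracket (𝓡 P.total.atlas.dim)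
      (𝔖.atiyahBundle.field σ) (𝔖.atiyahBundle.field τ) m) := by
  subst h
  exact 𝔖.bracket_eA σ τ _ _ (𝔖.atiyahBundle.lin_field σ) (𝔖.atiyahBundle.lin_field τ) m

variable {𝔖 𝔗}

/-- A local lift `g` of `F` satisfies `Q.bp ∘ g = F.base ∘ P.bp`; the chain rule gives the claim on
representatives. -/
theorem anchor_atiyahLin (n : P.base) (a : 𝔖.seq.A.fiber n) :
    𝔗.seq.A.anchor (F.base n) (F.atiyahLin 𝔖.atiyahBundle 𝔗.atiyahBundle n a) =
      mfderiv (𝓡 P.base.dim) (𝓡 Q.base.dim) F.base n (𝔖.seq.A.anchor n a) := by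
  obtain ⟨g, hg, hl⟩ := F.exists_lift (P.pt n)
  have h := bp_pt n
  have h' : Q.bp (g (P.pt n)) = F.base n := by rw [Hom.bp_lift hl.self_of_nhds, h]
  obtain ⟨v, rfl⟩ := (𝔖.atiyahBundle.linAt h).surjective a
  rw [Hom.atiyahLin_linAt _ _ hg hl h h']
  refine Bundle.TotalSpace.mk_inj.1 ((𝔗.mk_anchor h' _).trans ?_)
  refine (tangentMap_fun_comp (⟨P.pt n, v⟩ : TangentBundle (𝓡 P.total.atlas.dim) P.total.atlas)
    (Q.bp_smooth.mdifferentiableAt (by simp)) hg.mdifferentiableAt).symm.trans ?_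
  have h2 : (fun z => Q.bp (g z)) =ᶠ[𝓝 (P.pt n)] fun z => F.base (P.bp z) :=
    hl.mono fun z hz => Hom.bp_lift hz
  rw [tangentMap_congr_of_eventuallyEq h2, tangentMap_fun_comp _
    (F.base_smooth.mdifferentiableAt (by simp)) (P.bp_smooth.mdifferentiableAt (by simp)),
    ← 𝔖.mk_anchor h]
  rfl

theorem dirDeriv_anchor_field (σ : 𝔖.seq.A.Sec) {u : P.base → ℝ}
    (hu : ContMDiff (𝓡 P.base.dim) 𝓘(ℝ, ℝ) ∞ u) (m : P.total.atlas) :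
    dirDeriv (𝔖.atiyahBundle.field σ m) (fun z => u (P.bp z)) =
      dirDeriv (𝔖.seq.A.anchor (P.bp m) (σ (P.bp m))) u := by
  refine (LieAlgebroid.dirDeriv_comp _ P.bp_smooth hu).trans ?_
  have h1 := 𝔖.anchor_eA m (𝔖.atiyahBundle.field σ m)
  have h2 : 𝔖.eA _ (P.cls m (𝔖.atiyahBundle.field σ m)) = σ (P.bp m) :=
    𝔖.atiyahBundle.lin_field σ m
  rw [h2] at h1
  exact congrArg (fun X : P.base.T (P.bp m) => dirDeriv X u) h1.symm

/-- The morphism of Lie algebroids that is induced by a morphism of Q-principal bundles. -/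
theorem isLieAlgebroidMorphism_atiyahLin : IsLieAlgebroidMorphism 𝔖.seq.A 𝔗.seq.A F.base
    (F.atiyahLin 𝔖.atiyahBundle 𝔗.atiyahBundle) where
  base_smooth := F.base_smooth
  smooth := F.atiyahLin_smooth 𝔖.atiyahBundle 𝔗.atiyahBundle
  anchor := anchor_atiyahLin F
  bracket σ₁ σ₂ n k τ u₁ u₂ hu₁ hu₂ h₁ h₂ := by
    obtain ⟨m, rfl⟩ := P.bp_surjective n
    obtain ⟨g, hg, hl⟩ := F.exists_lift m
    have h' : Q.bp (g m) = F.base (P.bp m) := Hom.bp_lift hl.self_of_nhds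
    -- The decomposition of the image of a section becomes a decomposition of vector fields on the
    -- atlases, with coefficients pulled back by the projection.
    have hrel : ∀ (σ : 𝔖.seq.A.Sec) (u : Fin k → P.base → ℝ), (∀ᶠ x in 𝓝 (P.bp m),
        F.atiyahLin 𝔖.atiyahBundle 𝔗.atiyahBundle x (σ x) = ∑ i, u i x • τ i (F.base x)) →
        ∀ᶠ z in 𝓝 m, mfderiv (𝓡 P.total.atlas.dim) (𝓡 Q.total.atlas.dim) g z
          (𝔖.atiyahBundle.field σ z) = ∑ i, u i (P.bp z) • 𝔗.atiyahBundle.field (τ i) (g z) := by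
      intro σ u h
      filter_upwards [hg.eventually, eventually_eventually_nhds.2 hl,
        (P.bp_smooth.smoothNear m).continuousAt.eventually h] with z z1 z2 z3
      have hz : Q.bp (g z) = F.base (P.bp z) := Hom.bp_lift z2.self_of_nhds
      refine (𝔗.atiyahBundle.linAt hz).injective ?_
      rw [← Hom.atiyahLin_linAt 𝔖.atiyahBundle 𝔗.atiyahBundle z1 z2 rfl hz, map_sum]
      refine ((congrArg _ (𝔖.linAt_field σ rfl)).trans z3).trans
        (Finset.sum_congr rfl fun i _ => ?_)
      rw [map_smul, 𝔗.linAt_field]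
    have hu : ∀ u : Fin k → P.base → ℝ, (∀ i, ContMDiff (𝓡 P.base.dim) 𝓘(ℝ, ℝ) ∞ (u i)) → ∀ i,
        MDifferentiableAt (𝓡 P.total.atlas.dim) 𝓘(ℝ, ℝ) (fun z => u i (P.bp z)) m := fun u h i =>
      ((h i).comp P.bp_smooth).mdifferentiableAt (by simp)
    -- The bracket formula upstairs already has the required shape; passing to classes gives the
    -- formula in the Lie algebroids.
    have key := VectorField.mfderiv_mlieBracket_of_sum hg.contMDiffAt
      ((𝔖.atiyahBundle.isSmooth_field σ₁).mdifferentiableAt m)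
      ((𝔖.atiyahBundle.isSmooth_field σ₂).mdifferentiableAt m)
      (fun i => (𝔗.atiyahBundle.isSmooth_field (τ i)).mdifferentiableAt (g m))
      (hu u₁ hu₁) (hu u₂ hu₂) (hrel σ₁ u₁ h₁) (hrel σ₂ u₂ h₂)
    rw [𝔖.bracket_eq σ₁ σ₂ rfl, Hom.atiyahLin_linAt _ _ hg hl rfl h']
    refine (congrArg (𝔗.atiyahBundle.linAt h') key).trans ?_
    rw [map_add, map_sum, map_sum]
    refine congrArg₂ (· + ·) (Finset.sum_congr rfl fun i _ => ?_)
      (Finset.sum_congr rfl fun i _ => ?_)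
    · rw [map_sum]
      refine Finset.sum_congr rfl fun j _ => ?_
      rw [map_smul, ← 𝔗.bracket_eq]
    · rw [map_smul, 𝔗.linAt_field, ← dirDeriv_anchor_field σ₁ (hu₂ i),
        ← dirDeriv_anchor_field σ₂ (hu₁ i)]
      rfl

end AtiyahSequenceOf

end QPrincipalBundle

/-! ### The morphism of adjoint bundles and compatibility with the inclusions -/

namespace QPrincipalBundle

variable {P Q : QPrincipalBundle.{u}} (F : Hom P Q)

namespace Hom

/-- The linear map of Lie algebras `T₁Θ`. -/
noncomputable def lieLin : P.group.LieAlg →ₗ[ℝ] Q.group.LieAlg :=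
  QGroup.lieMap F.group_smooth (map_one F.group)

section Ad

variable {r r' : ℕ} {L : P.base → Type u} [∀ n, AddCommGroup (L n)]
    [∀ n, Module ℝ (L n)] [∀ n, TopologicalSpace (L n)]
    [TopologicalSpace (Bundle.TotalSpace (EuclideanSpace ℝ (Fin r)) L)]
    [FiberBundle (EuclideanSpace ℝ (Fin r)) L] [VectorBundle ℝ (EuclideanSpace ℝ (Fin r)) L]
    {L' : Q.base → Type u} [∀ n, AddCommGroup (L' n)]
    [∀ n, Module ℝ (L' n)] [∀ n, TopologicalSpace (L' n)]
    [TopologicalSpace (Bundle.TotalSpace (EuclideanSpace ℝ (Fin r')) L')]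
    [FiberBundle (EuclideanSpace ℝ (Fin r')) L'] [VectorBundle ℝ (EuclideanSpace ℝ (Fin r')) L']
    (𝔩 : P.AdLieBundle r L) (𝔩' : Q.AdLieBundle r' L')

noncomputable def adFun (n : P.base) (a : L n) : L' (F.base n) :=
  𝔩'.e _ ⟨F.ad ((𝔩.e n).symm a).1, by rw [adProj_ad, ((𝔩.e n).symm a).2]⟩

theorem adFun_linAt {n : P.base} {p : P.total} (h : P.proj p = n)
    (h' : Q.proj (F.map p) = F.base n) (w : P.group.LieAlg) :
    F.adFun 𝔩 𝔩' n (𝔩.linAt h w) = 𝔩'.linAt h' (F.lieLin w) :=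
  congrArg (𝔩'.e _) (Subtype.ext
    (congrArg (fun a : {a : P.AdBundle // P.adProj a = n} => F.ad a.1)
      ((𝔩.e n).symm_apply_apply ⟨P.adMk p w, h⟩)))

/-- The linear map of fibres that is induced by a morphism. -/
noncomputable def adLin (n : P.base) : L n →ₗ[ℝ] L' (F.base n) :=
  have key : ∃ T : L n →ₗ[ℝ] L' (F.base n), ∀ a, F.adFun 𝔩 𝔩' n a = T a := by
    have h : P.proj (P.total.chart (P.pt n)) = n := bp_pt n
    have h' : Q.proj (F.map (P.total.chart (P.pt n))) = F.base n := by rw [F.proj_map, h]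
    refine ⟨(𝔩'.linAt h').toLinearMap.comp (F.lieLin.comp (𝔩.linAt h).symm.toLinearMap),
      fun a => ?_⟩
    obtain ⟨v, rfl⟩ := (𝔩.linAt h).surjective a
    rw [adFun_linAt F 𝔩 𝔩' h h']
    simp only [LinearMap.comp_apply, LinearEquiv.coe_coe, LinearEquiv.symm_apply_apply]
  { toFun := F.adFun 𝔩 𝔩' n
    map_add' := fun v w => by
      obtain ⟨T, hT⟩ := key
      rw [hT, hT, hT, map_add]
    map_smul' := fun c v => by
      obtain ⟨T, hT⟩ := key
      rw [hT, hT, map_smul]; rfl }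

theorem adLin_linAt {n : P.base} {p : P.total} (h : P.proj p = n)
    (h' : Q.proj (F.map p) = F.base n) (w : P.group.LieAlg) :
    F.adLin 𝔩 𝔩' n (𝔩.linAt h w) = 𝔩'.linAt h' (F.lieLin w) := F.adFun_linAt 𝔩 𝔩' h h' w

/-- At `p` and `F(p)` the fibre brackets are those of the two Lie algebras, and the map is `T₁Θ`, a
homomorphism of Lie algebras. -/
theorem adLin_bracketFib (n : P.base) (a b : L n) : F.adLin 𝔩 𝔩' n (𝔩.bracketFib n a b) =
    𝔩'.bracketFib (F.base n) (F.adLin 𝔩 𝔩' n a) (F.adLin 𝔩 𝔩' n b) := by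
  have h : P.proj (P.total.chart (P.pt n)) = n := bp_pt n
  have h' : Q.proj (F.map (P.total.chart (P.pt n))) = F.base n := by rw [F.proj_map, h]
  obtain ⟨w, rfl⟩ := (𝔩.linAt h).surjective a
  obtain ⟨v, rfl⟩ := (𝔩.linAt h).surjective b
  rw [𝔩.bracketFib_linAt, adLin_linAt F 𝔩 𝔩' h h', adLin_linAt F 𝔩 𝔩' h h',
    adLin_linAt F 𝔩 𝔩' h h', 𝔩'.bracketFib_linAt]
  exact congrArg _ (QGroup.lieMap_lieBracket F.group_smooth (map_one F.group) (map_mul F.group) w v)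

theorem adLin_smooth : ContMDiff ((𝓡 P.base.dim).prod (𝓡 r)) ((𝓡 Q.base.dim).prod (𝓡 r')) ∞
      (fun a : Bundle.TotalSpace (EuclideanSpace ℝ (Fin r)) L =>
        (⟨F.base a.proj, F.adLin 𝔩 𝔩' a.proj a.2⟩ :
          Bundle.TotalSpace (EuclideanSpace ℝ (Fin r')) L')) := by
  intro a₀
  obtain ⟨m, hm⟩ := P.bp_surjective a₀.proj
  obtain ⟨s, s1, s2, s3⟩ := P.exists_section m
  rw [hm] at s1 s2 s3
  obtain ⟨g, hg, hl⟩ := F.exists_lift (s a₀.proj)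
  have hp : ContMDiffAt ((𝓡 P.base.dim).prod (𝓡 r)) (𝓡 P.base.dim) ∞ (Bundle.TotalSpace.proj :
      Bundle.TotalSpace (EuclideanSpace ℝ (Fin r)) L → P.base) a₀ :=
    (Bundle.contMDiff_proj (IB := 𝓡 P.base.dim) (n := ∞) L).contMDiffAt
  have hc : ContMDiffAt ((𝓡 P.base.dim).prod (𝓡 r)) (𝓡 P.total.atlas.dim) ∞
      (fun a : Bundle.TotalSpace (EuclideanSpace ℝ (Fin r)) L => s a.proj) a₀ :=
    s2.contMDiffAt.comp a₀ hp
  have hk := P.group.chart_unit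
  have hk' := Q.group.chart_unit
  -- In the frames along `s` and along the lift `g ∘ s` the map has the constant matrix of `T₁Θ`.
  let A : EuclideanSpace ℝ (Fin P.group.atlas.dim) →L[ℝ] EuclideanSpace ℝ (Fin Q.group.atlas.dim) :=
    LinearMap.toContinuousLinearMap ((QGroup.coord hk').toLinearMap.comp
      (F.lieLin.comp (QGroup.coord hk).symm.toLinearMap))
  have hA : ∀ w, A (QGroup.coord hk w) = QGroup.coord hk' (F.lieLin w) := fun w => by simp [A]
  have key := (ContMDiffAt.comp a₀ (g := g)
    (f := fun a : Bundle.TotalSpace (EuclideanSpace ℝ (Fin r)) L => s a.proj) hg.contMDiffAt hc).prodMk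
      (A.contMDiff.contMDiffAt.comp a₀ (𝔩.contMDiffAt_vec hk a₀ s2 s3))
  refine ((𝔩'.contMDiff_quot hk' _).comp a₀ key).congr_of_eventuallyEq ?_
  filter_upwards [hp.continuousAt.eventually s3, hc.continuousAt.eventually hl] with a h1 h2
  have h' : Q.bp (g (s a.proj)) = F.base a.proj := by rw [bp_lift h2, h1]
  have h'' : Q.proj (F.map (P.total.chart (s a.proj))) = F.base a.proj := by
    rw [F.proj_map]; exact congrArg F.base h1
  have h3 := 𝔩'.mk_linAt h' hk' (F.lieLin (𝔩.vec a.2 (P.total.chart (s a.proj))))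
  rw [← hA] at h3
  refine Eq.trans ?_ h3
  refine congrArg (fun b : L' (F.base a.proj) =>
    (⟨F.base a.proj, b⟩ : Bundle.TotalSpace (EuclideanSpace ℝ (Fin r')) L')) ?_
  have h4 := F.adLin_linAt 𝔩 𝔩' h1 h'' (𝔩.vec a.2 (P.total.chart (s a.proj)))
  rw [𝔩.linAt_vec] at h4
  refine h4.trans ?_
  rw [𝔩'.linAt_eq_iff, h2]

end Ad

end Hom

namespace AtiyahSequenceOf

variable (𝔖 : P.AtiyahSequenceOf) (𝔗 : Q.AtiyahSequenceOf)

/-- The bundle `P ×_Ad 𝔤` of an Atiyah sequence. -/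
def adLieBundle : P.AdLieBundle 𝔖.seq.L.rank 𝔖.seq.L.fiber := ⟨𝔖.eL, 𝔖.eL_linear, 𝔖.eL_smooth⟩

/-- Every element of a fibre is a class at any given point over it, so `bracket_eL` determines the
bracket of an arbitrary Atiyah sequence. -/
theorem bracket_eq_bracketFib (σ τ : 𝔖.seq.L.toLieAlgebroid.Sec) (n : P.base) :
    𝔖.seq.L.bracket σ τ n = 𝔖.adLieBundle.bracketFib n (σ n) (τ n) := by
  obtain ⟨m, rfl⟩ := P.bp_surjective n
  obtain ⟨w, hw⟩ := (𝔖.adLieBundle.linAt (p := P.total.chart m) rfl).surjective (σ (P.bp m))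
  obtain ⟨v, hv⟩ := (𝔖.adLieBundle.linAt (p := P.total.chart m) rfl).surjective (τ (P.bp m))
  rw [← hw, ← hv, AdLieBundle.bracketFib_linAt]
  exact 𝔖.bracket_eL σ τ (P.total.chart m) w v hw.symm hv.symm

variable {𝔖 𝔗}

/-- The morphism of Lie algebra bundles that is induced by a morphism of Q-principal bundles. -/
theorem isLieAlgebroidMorphism_adLin : IsLieAlgebroidMorphism 𝔖.seq.L.toLieAlgebroid
    𝔗.seq.L.toLieAlgebroid F.base (F.adLin 𝔖.adLieBundle 𝔗.adLieBundle) where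
  base_smooth := F.base_smooth
  smooth := F.adLin_smooth 𝔖.adLieBundle 𝔗.adLieBundle
  anchor n a := by
    rw [𝔗.seq.L.anchor_zero, 𝔖.seq.L.anchor_zero]
    exact (map_zero (mfderiv (𝓡 P.base.dim) (𝓡 Q.base.dim) F.base n)).symm
  bracket σ₁ σ₂ n k τ u₁ u₂ hu₁ hu₂ h₁ h₂ := by
    have h0 : ∀ (a : 𝔖.seq.L.fiber n) (u : P.base → ℝ), dirDeriv (𝔖.seq.L.anchor n a) u = 0 :=
      fun a u => by
        rw [𝔖.seq.L.anchor_zero]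
        exact map_zero (mfderiv (𝓡 P.base.dim) 𝓘(ℝ, ℝ) u n)
    -- With zero anchors only the terms `u₁ᵢ u₂ⱼ [τᵢ, τⱼ]` remain, and these come from bilinearity
    -- of the fibre bracket.
    simp only [h0, sub_self, zero_smul, Finset.sum_const_zero, add_zero]
    rw [𝔖.bracket_eq_bracketFib, F.adLin_bracketFib, h₁.self_of_nhds, h₂.self_of_nhds]
    simp only [𝔗.bracket_eq_bracketFib, map_sum, LinearMap.sum_apply, map_smul,
      LinearMap.smul_apply, Finset.smul_sum, smul_smul]
    rw [Finset.sum_comm]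
    simp only [mul_comm]

theorem mk_eA {a : P.Atiyah} {n : P.base} (h : P.atiyahProj a = n) :
    (⟨n, 𝔖.eA n ⟨a, h⟩⟩ : 𝔖.seq.A.Total) = 𝔖.totA a := by
  subst h; rfl

theorem mk_eL {l : P.AdBundle} {n : P.base} (h : P.adProj l = n) :
    (⟨n, 𝔖.eL n ⟨l, h⟩⟩ : 𝔖.seq.L.toLieAlgebroid.Total) = 𝔖.totL l := by
  subst h; rfl

theorem exists_totA_eq (a : 𝔖.seq.A.Total) : ∃ b, 𝔖.totA b = a := by
  obtain ⟨n, a⟩ := a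
  obtain ⟨⟨b, h⟩, rfl⟩ := (𝔖.eA n).surjective a
  exact ⟨b, (mk_eA h).symm⟩

theorem exists_totL_eq (l : 𝔖.seq.L.toLieAlgebroid.Total) : ∃ b, 𝔖.totL b = l := by
  obtain ⟨n, a⟩ := l
  obtain ⟨⟨b, h⟩, rfl⟩ := (𝔖.eL n).surjective a
  exact ⟨b, (mk_eL h).symm⟩

theorem totalMap_atiyahLin (a : P.Atiyah) : 𝔖.seq.A.totalMap 𝔗.seq.A F.base
    (F.atiyahLin 𝔖.atiyahBundle 𝔗.atiyahBundle) (𝔖.totA a) = 𝔗.totA (F.atiyah a) := by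
  refine Eq.trans ?_ (mk_eA (F.atiyahProj_atiyah a))
  refine congrArg (fun b : {b : Q.Atiyah // Q.atiyahProj b = F.base (P.atiyahProj a)} =>
    (⟨_, 𝔗.eA _ b⟩ : 𝔗.seq.A.Total)) (Subtype.ext ?_)
  exact congrArg (fun b : {b : P.Atiyah // P.atiyahProj b = P.atiyahProj a} => F.atiyah b.1)
    ((𝔖.eA _).symm_apply_apply ⟨a, rfl⟩)

theorem totalMap_adLin (l : P.AdBundle) : 𝔖.seq.L.totalMap 𝔗.seq.L.toLieAlgebroid F.base
    (F.adLin 𝔖.adLieBundle 𝔗.adLieBundle) (𝔖.totL l) = 𝔗.totL (F.ad l) := by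
  refine Eq.trans ?_ (mk_eL (F.adProj_ad l))
  refine congrArg (fun b : {b : Q.AdBundle // Q.adProj b = F.base (P.adProj l)} =>
    (⟨_, 𝔗.eL _ b⟩ : 𝔗.seq.L.toLieAlgebroid.Total)) (Subtype.ext ?_)
  exact congrArg (fun b : {b : P.AdBundle // P.adProj b = P.adProj l} => F.ad b.1)
    ((𝔖.eL _).symm_apply_apply ⟨l, rfl⟩)

end AtiyahSequenceOf

/-- The morphism of abstract Atiyah sequences that is induced by a morphism of Q-principal bundles. -/
noncomputable def AtiyahSequenceOf.homAB (𝔖 : P.AtiyahSequenceOf) (𝔗 : Q.AtiyahSequenceOf) (F : Hom P Q) :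
    AB.Hom 𝔖.toAB 𝔗.toAB where
  base := F.base
  A := show ∀ n, 𝔖.seq.A.fiber n →ₗ[ℝ] 𝔗.seq.A.fiber (F.base n) from
    F.atiyahLin 𝔖.atiyahBundle 𝔗.atiyahBundle
  L := show ∀ n, 𝔖.seq.L.fiber n →ₗ[ℝ] 𝔗.seq.L.fiber (F.base n) from
    F.adLin 𝔖.adLieBundle 𝔗.adLieBundle
  A_hom := AtiyahSequenceOf.isLieAlgebroidMorphism_atiyahLin F
  L_hom := AtiyahSequenceOf.isLieAlgebroidMorphism_adLin F
  comm n l := by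
    obtain ⟨⟨l, rfl⟩, rfl⟩ := (𝔖.eL n).surjective l
    change F.atiyahLin 𝔖.atiyahBundle 𝔗.atiyahBundle _ (𝔖.seq.j _ (𝔖.eL _ ⟨l, rfl⟩)) =
      𝔗.seq.j _ (F.adLin 𝔖.adLieBundle 𝔗.adLieBundle _ (𝔖.eL _ ⟨l, rfl⟩))
    have h1 : F.adLin 𝔖.adLieBundle 𝔗.adLieBundle _ (𝔖.eL _ ⟨l, rfl⟩) =
        𝔗.eL _ ⟨F.ad l, F.adProj_ad l⟩ :=
      congrArg (𝔗.eL _) (Subtype.ext (congrArg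
        (fun b : {b : P.AdBundle // P.adProj b = P.adProj l} => F.ad b.1)
        ((𝔖.eL _).symm_apply_apply ⟨l, rfl⟩)))
    rw [h1, 𝔖.j_eL, 𝔗.j_eL]
    refine congrArg (𝔗.eA _) (Subtype.ext ?_)
    refine (congrArg (fun b : {b : P.Atiyah // P.atiyahProj b = P.adProj l} => F.atiyah b.1)
      ((𝔖.eA _).symm_apply_apply ⟨P.iota l, P.atiyahProj_iota l⟩)).trans (F.atiyah_iota l)

end QPrincipalBundle

/-! ### The Atiyah functor -/

/-- The fibre maps have types that depend on the base map, so morphisms are compared through total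
spaces, where equality can be stated before the base maps are identified. -/
theorem AB.Hom.ext_totalMap {S T : AB.{u}} {Φ Ψ : AB.Hom S T} (hb : Φ.base = Ψ.base)
    (hA : ∀ a, S.seq.A.totalMap T.seq.A Φ.base Φ.A a = S.seq.A.totalMap T.seq.A Ψ.base Ψ.A a)
    (hL : ∀ l, S.seq.L.totalMap T.seq.L.toLieAlgebroid Φ.base Φ.L l =
      S.seq.L.totalMap T.seq.L.toLieAlgebroid Ψ.base Ψ.L l) : Φ = Ψ := by
  obtain ⟨f, A, L, _, _, _⟩ := Φ
  obtain ⟨f', A', L', _, _, _⟩ := Ψ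
  obtain rfl : f = f' := hb
  obtain rfl : A = A' := funext fun n => LinearMap.ext fun a =>
    Bundle.TotalSpace.mk_inj.1 (hA ⟨n, a⟩)
  obtain rfl : L = L' := funext fun n => LinearMap.ext fun a =>
    Bundle.TotalSpace.mk_inj.1 (hL ⟨n, a⟩)
  rfl

namespace QPrincipalBundle

open AtiyahSequenceOf

/-- The Atiyah functor. -/
noncomputable def atiyahFunctor (𝔖 : ∀ P : QPrincipalBundle.{u}, P.AtiyahSequenceOf) :
    QPrincipalBundle.{u} ⥤ AB.{u} where
  obj P := (𝔖 P).toAB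
  map {P Q} F := (𝔖 P).homAB (𝔖 Q) F
  map_id P := by
    refine AB.Hom.ext_totalMap rfl (fun a => ?_) fun l => ?_
    · obtain ⟨a, rfl⟩ := exists_totA_eq (𝔖 := 𝔖 P) a
      refine (totalMap_atiyahLin (𝔖 := 𝔖 P) (𝔗 := 𝔖 P) (𝟙 P) a).trans ?_
      rw [Hom.atiyah_id]
      rfl
    · obtain ⟨l, rfl⟩ := exists_totL_eq (𝔖 := 𝔖 P) l
      refine (totalMap_adLin (𝔖 := 𝔖 P) (𝔗 := 𝔖 P) (𝟙 P) l).trans ?_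
      rw [Hom.ad_id]
      rfl
  map_comp {P Q R} F F' := by
    refine AB.Hom.ext_totalMap rfl (fun a => ?_) fun l => ?_
    · obtain ⟨a, rfl⟩ := exists_totA_eq (𝔖 := 𝔖 P) a
      refine (totalMap_atiyahLin (𝔖 := 𝔖 P) (𝔗 := 𝔖 R) (F ≫ F') a).trans ?_
      rw [Hom.atiyah_comp, ← totalMap_atiyahLin (𝔖 := 𝔖 Q), ← totalMap_atiyahLin (𝔖 := 𝔖 P)]
      rfl
    · obtain ⟨l, rfl⟩ := exists_totL_eq (𝔖 := 𝔖 P) l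
      refine (totalMap_adLin (𝔖 := 𝔖 P) (𝔗 := 𝔖 R) (F ≫ F') l).trans ?_
      rw [Hom.ad_comp, ← totalMap_adLin (𝔖 := 𝔖 Q), ← totalMap_adLin (𝔖 := 𝔖 P)]
      rfl

end QPrincipalBundle

theorem proposition4p8 :
    (∀ P : QPrincipalBundle.{u}, Nonempty P.AtiyahSequenceOf) ∧
    ∀ 𝔖 : ∀ P : QPrincipalBundle.{u}, P.AtiyahSequenceOf,
      (∀ (P Q : QPrincipalBundle.{u}) (F : QPrincipalBundle.Hom P Q),
        ∃ φ : ∀ n, (𝔖 P).seq.A.fiber n →ₗ[ℝ] (𝔖 Q).seq.A.fiber (F.base n),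
          (∀ a, (𝔖 P).seq.A.totalMap (𝔖 Q).seq.A F.base φ ((𝔖 P).totA a) = (𝔖 Q).totA (F.atiyah a)) ∧
          IsLieAlgebroidMorphism (𝔖 P).seq.A (𝔖 Q).seq.A F.base φ) ∧
      ∃ (𝔄 : QPrincipalBundle.{u} ⥤ AB.{u}) (h : ∀ P, 𝔄.obj P = (𝔖 P).toAB),
        ∀ (P Q : QPrincipalBundle.{u}) (F : P ⟶ Q),
          (𝔖 P).IsInducedBy (𝔖 Q) (eqToHom (h P).symm ≫ 𝔄.map F ≫ eqToHom (h Q)) F := by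
  refine ⟨QPrincipalBundle.nonempty_atiyahSequenceOf, fun 𝔖 => ⟨fun P Q F => ⟨_,
    QPrincipalBundle.AtiyahSequenceOf.totalMap_atiyahLin F,
    QPrincipalBundle.AtiyahSequenceOf.isLieAlgebroidMorphism_atiyahLin F⟩,
    QPrincipalBundle.atiyahFunctor 𝔖, fun _ => rfl, fun P Q F => ?_⟩⟩
  -- The functor sends `P` to `(𝔖 P).toAB` by definition, so the transports along equalities of
  -- objects are identities.
  have key : ∀ {S T : AB.{u}} (f : S ⟶ T), eqToHom rfl ≫ f ≫ eqToHom rfl = f := by simp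
  have h : (𝔖 P).IsInducedBy (𝔖 Q) ((𝔖 P).homAB (𝔖 Q) F) F :=
    ⟨rfl, QPrincipalBundle.AtiyahSequenceOf.totalMap_atiyahLin F,
      QPrincipalBundle.AtiyahSequenceOf.totalMap_adLin F⟩
  rw [← key (S := (𝔖 P).toAB) (T := (𝔖 Q).toAB) ((𝔖 P).homAB (𝔖 Q) F)] at h
  exact h
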